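/- \textbf{Setting.} Let $F$ be a non-archimedean local field of characteristic zero with normalized absolute value $|\cdot|$ and residue field of cardinality $q$, let $n\ge 1$, $G=GL_n(F)$, $Z$ its center (identified with $F^\times$), $A$ the diagonal torus, $U$ the group of upper triangular unipotent matrices with a Haar measure $du$, and let $\psi$ be a non-trivial continuous unitary additive character of $F$, also viewed as the character $\psi(u)=\psi(\sum_{i=1}^{n-1}u_{i,i+1})$ of $U$. Let $\omega$ be a continuous character of $F^\times$. For an open subset $\Omega\subset G$ let $C_c^\infty(\Omega;\omega)$ be the space of locally constant $f:G\to\mathbb C$ with $f(zg)=\omega(z)f(g)$ for $z\in Z$ that vanish outside $ZK$ for some compact $K\subset\Omega$. For $f\in C_c^\infty(G;\omega)$ put $W^f(g)=\int_U f(xg)\psi^{-1}(x)\,dx$. \textbf{Weyl elements and tori.} Let $W=S_n$ be the Weyl group, $\Delta$ the set of simple roots, $w_\ell$ the long element, and $\dot w_\ell$ the antidiagonal matrix with entries $1,-1,\dots,(-1)^{n-1}$ from the top row down. Let $C(w)=UwAU$, write $w\le w'$ if $C(w)\subset\overline{C(w')}$, and let $\Omega_w=\bigcup_{w\le w'}C(w')$.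 Let $B(G)$ be the set of $w\in W$ such that for every $\alpha\in\Delta$, $w\alpha>0$ implies $w\alpha\in\Delta$. For $w>w'$ in $B(G)$ let $d_B(w,w')$ be the largest $m$ for which there is a chain $w=w_m>\dots>w_0=w'$ in $B(G)$; thus the $w'\in B(G)$ with $d_B(w',e)\ge 1$ are the $w'\in B(G)$ with $w'\ne e$. For $w\in B(G)$ let $A_w=\{a\in A:\alpha(a)=1\text{ for all }\alpha\in\Delta\text{ with }w\alpha>0\}$, let $A'_w=\{a\in A_w: a_1=1\}$, let $M_w$ be the standard Levi subgroup whose simple roots are the $\alpha\in\Delta$ with $w\alpha>0$, and let $M_w^d$ be its derived group (block diagonal matrices with all blocks of determinant $1$). For $w'\in B(G)$ let $A_{w_\ell}^{w'}=A\cap M_{w'}^d$ be the transverse torus. \textbf{Partial Bessel integrals.} For $N\in\mathbb N$ let $\varphi_N$ be the characteristic function of the $n\times n$ matrices $x$ over $F$ with $|x_{i,j}|\le q^{(i+j-1)N}$ for all $1\le i,j\le n$. For $a\in A$ with first entry $a_1$ put $a'=a_1^{-1}a$ and \[B^G_{\varphi}(\dot w_\ell a,f)=\int_U W^f(\dot w_\ell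 a u)\,\varphi({}^tu\,a'u)\,\psi^{-1}(u)\,du .\] \textbf{Proposition.} Fix an auxiliary $f_0\in C_c^\infty(G;\omega)$ with $W^{f_0}(e)=1$. There is a function $f_{1,e}\in C_c^\infty(G;\omega)$, depending only on $f_0$ and $\omega$ (given $F,n,\psi,du$), such that the following holds for every irreducible supercuspidal representation $\pi$ of $G$ with central character $\omega_\pi=\omega$ and every $f$ in the space $\mathcal M(\pi)$ spanned by its matrix coefficients with $W^f(e)=1$. There exist $f_{1,w'}\in C_c^\infty(\Omega_{w'};\omega_\pi)$ for each $w'\in B(G)$ with $d_B(w',e)\ge 1$, and $N_0\in\mathbb N$, such that for $\varphi=\varphi_N$ with any $N\ge N_0$: \begin{enumerate} \item[(i)] for all $a\in A$, \[B^G_\varphi(\dot w_\ell a,f)=B^G_\varphi(\dot w_\ell a,f_{1,e})+\sum_{w'\in B(G),\ d_B(w',e)\ge 1}B^G_\varphi(\dot w_\ell a,f_{1,w'});\] \item[(ii)] the term $B^G_\varphi(\dot w_\ell a,f_{1,e})$ depends only on $f_0$ and $\omega_\pi$ (and not otherwise on $\pi$ and $f$), since this is so for $f_{1,e}$; \item[(iii)]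 for each $w'\in B(G)$ with $d_B(w',e)\ge1$, each $b\in A^{w'}_{w_\ell}$, $c'\in A'_{w'}$ and $z\in Z$, \[B^G_\varphi(\dot w_\ell bc'z,f_{1,w'})=\omega_\pi(z)B^G_\varphi(\dot w_\ell bc',f_{1,w'}),\] and this is uniformly smooth as a function of $c'\in A'_{w'}$: there are an open compact subgroup $C\subset A'_{w'}$ and a compact set $K\subset A'_{w'}$, independent of $b$ and of $N\ge N_0$, such that $B^G_\varphi(\dot w_\ell ac_1,f_{1,w'})=B^G_\varphi(\dot w_\ell a,f_{1,w'})$ for all $a\in A$ and $c_1\in C$ (in particular for $a=bc'$), and $B^G_\varphi(\dot w_\ell bc',f_{1,w'})=0$ for all $b\in A^{w'}_{w_\ell}$ and all $c'\in A'_{w'}\setminus K$. \end{enumerate} -/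

import Mathlib

open scoped Matrix
open Matrix MeasureTheory ValuativeRel

namespace PartialBessel

noncomputable section

section Groups

variable (n : ℕ) (F : Type*) [Field F]

/-- The group `U` of upper triangular unipotent matrices in `GL_n(F)`. -/
def unipotent : Subgroup (GL (Fin n) F) where
  carrier := {g | (∀ i, (g : Matrix (Fin n) (Fin n) F) i i = 1) ∧
    ∀ i j, j < i → (g : Matrix (Fin n) (Fin n) F) i j = 0}
  one_mem' := by
    refine ⟨fun i => by simp, fun i j hij => by simp [hij.ne']⟩
  mul_mem' := by
    rintro a b ⟨ha1, ha0⟩ ⟨hb1, hb0⟩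
    refine ⟨fun i => ?_, fun i j hij => ?_⟩
    · rw [Units.val_mul, Matrix.mul_apply, Finset.sum_eq_single i]
      · rw [ha1, hb1, one_mul]
      · intro k _ hk
        rcases lt_or_gt_of_ne hk with h | h
        · rw [ha0 i k h, zero_mul]
        · rw [hb0 k i h, mul_zero]
      · simp
    · rw [Units.val_mul, Matrix.mul_apply]
      refine Finset.sum_eq_zero fun k _ => ?_
      rcases lt_or_ge k i with h | h
      · rw [ha0 i k h, zero_mul]
      · rw [hb0 k j (hij.trans_le h), mul_zero]
  inv_mem' := by
    rintro a ⟨ha1, ha0⟩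
    have hA : Matrix.BlockTriangular (a : Matrix (Fin n) (Fin n) F) id := fun i j h => ha0 i j h
    have hinv : Matrix.BlockTriangular ((a : Matrix (Fin n) (Fin n) F)⁻¹) id := by
      let _ : Invertible (a : Matrix (Fin n) (Fin n) F) := a.isUnit.invertible
      exact Matrix.blockTriangular_inv_of_blockTriangular hA
    rw [← Matrix.coe_units_inv] at hinv
    refine ⟨fun i => ?_, fun i j hij => hinv hij⟩
    have h : ((a * a⁻¹ : GL (Fin n) F) : Matrix (Fin n) (Fin n) F) i i = 1 := by simp
    rw [Units.val_mul, Matrix.mul_apply, Finset.sum_eq_single i] at h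
    · rwa [ha1, one_mul] at h
    · intro k _ hk
      rcases lt_or_gt_of_ne hk with h | h
      · rw [ha0 i k h, zero_mul]
      · rw [show ((a⁻¹ : GL (Fin n) F) : Matrix (Fin n) (Fin n) F) k i = 0 from hinv h, mul_zero]
    · simp

/-- The diagonal torus `A`, a tuple standing for its diagonal entries. -/
abbrev Torus : Type _ := Fin n → Fˣ

variable {n F}

/-- The element `diag(a_1, …, a_n)` of `GL_n(F)`. -/
def diag (a : Torus n F) : GL (Fin n) F where
  val := Matrix.diagonal fun i => (a i : F)
  inv := Matrix.diagonal fun i => ((a i)⁻¹ : Fˣ)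
  val_inv := by simp [Matrix.diagonal_mul_diagonal]
  inv_val := by simp [Matrix.diagonal_mul_diagonal]

/-- The element `z · I_n` of the center `Z`, as an element of the torus. -/
def central (z : Fˣ) : Torus n F := fun _ => z

variable (n F)

/-- The antidiagonal matrix with entries `1, -1, 1, …, (-1)^(n-1)`, read from the top row down. -/
def longMatrix : Matrix (Fin n) (Fin n) F :=
  Matrix.of fun i j => if j = Fin.rev i then (-1) ^ (i : ℕ) else 0

/-- The representative `ẇ_ℓ` of the long Weyl element. -/
def longRep : GL (Fin n) F where
  val := longMatrix n F
  inv := (longMatrix n F)ᵀ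
  val_inv := by
    ext i j
    rw [Matrix.mul_apply, Finset.sum_eq_single (Fin.rev i)]
    · by_cases h : i = j
      · subst h
        simp [longMatrix, ← pow_add]
      · simp [longMatrix, h]
    · intro k _ hk
      simp [longMatrix, hk]
    · simp
  inv_val := by
    ext i j
    rw [Matrix.mul_apply, Finset.sum_eq_single (Fin.rev i)]
    · by_cases h : i = j
      · subst h
        simp [longMatrix, ← pow_add]
      · simp [longMatrix, h, Ne.symm h]
    · intro k _ hk
      have : i ≠ Fin.rev k := fun h => hk (by simp [h])
      simp [longMatrix, this]
    · simp

variable {n F}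

/-- The twisted centralizer `U_g` of `g` in `U`. -/
def twistedCentralizer (g : GL (Fin n) F) : Set (unipotent n F) :=
  {u | ((u : GL (Fin n) F) : Matrix (Fin n) (Fin n) F)ᵀ *
      (((longRep n F)⁻¹ * g : GL (Fin n) F) : Matrix (Fin n) (Fin n) F) *
      ((u : GL (Fin n) F) : Matrix (Fin n) (Fin n) F) =
    (((longRep n F)⁻¹ * g : GL (Fin n) F) : Matrix (Fin n) (Fin n) F)}

/-- On the elements `ẇ_ℓ a` the twisted centralizer is trivial. -/
theorem twistedCentralizer_longRep_mul_diag (a : Torus n F) :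
    twistedCentralizer (longRep n F * diag a) = {1} := by
  ext u
  simp only [twistedCentralizer, inv_mul_cancel_left, Set.mem_ofPred_eq, Set.mem_singleton_iff]
  constructor
  · intro h
    have hu := u.2
    have hv := (u⁻¹).2
    have h2 : ((u : GL (Fin n) F) : Matrix (Fin n) (Fin n) F)ᵀ * (diag a).1 =
        (diag a).1 * (((u⁻¹ : unipotent n F) : GL (Fin n) F) : Matrix (Fin n) (Fin n) F) := by
      conv_rhs => rw [← h, Matrix.mul_assoc]
      rw [← Units.val_mul, ← Subgroup.coe_mul, mul_inv_cancel]
      simp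
    apply Subtype.ext
    apply Units.ext
    ext i j
    rcases lt_trichotomy i j with hij | hij | hij
    · have h3 := congrFun (congrFun h2 j) i
      simp only [diag, Matrix.mul_diagonal, Matrix.diagonal_mul, Matrix.transpose_apply,
        hv.2 j i hij, mul_zero] at h3
      have := (mul_eq_zero.mp h3).resolve_right (a i).ne_zero
      simp [this, hij.ne]
    · subst hij
      simp [hu.1]
    · simp [hu.2 i j hij, hij.ne']
  · rintro rfl
    simp

end Groups

section Weyl

variable {n : ℕ}

/-- `w` sends the simple root `α = e_i - e_j` (`j = i + 1`) to a positive root.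
The Weyl group is the group of permutations, acting by `w e_i = e_{w i}`. -/
def SendsPos (w : Equiv.Perm (Fin n)) (i j : Fin n) : Prop :=
  (i : ℕ) + 1 = j ∧ w i < w j

/-- `w ∈ B(G)`: whenever `α` is simple and `w α` is positive, `w α` is simple. -/
def SupportsBessel (w : Equiv.Perm (Fin n)) : Prop :=
  ∀ i j, SendsPos w i j → (w i : ℕ) + 1 = w j

/-- `i` and `j` lie in the same block of the standard Levi subgroup `M_w`, whose simple roots
are the simple roots sent by `w` to positive roots. -/
def SameBlock (w : Equiv.Perm (Fin n)) (i j : Fin n) : Prop :=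
  ∀ k l : Fin n, (k : ℕ) + 1 = l → min i j ≤ k → l ≤ max i j → SendsPos w k l

variable (F : Type*) [Field F]

/-- `A_w = {a ∈ A | α(a) = 1 for all simple α with w α > 0}`. -/
def besselTorus (w : Equiv.Perm (Fin n)) : Subgroup (Torus n F) where
  carrier := {a | ∀ i j, SendsPos w i j → a i = a j}
  one_mem' := by simp
  mul_mem' := by
    intro a b ha hb i j h
    simp [ha i j h, hb i j h]
  inv_mem' := by
    intro a ha i j h
    simp [ha i j h]

/-- `A'_w`, the elements of `A_w` with first coordinate `1`. -/
def reducedTorus [NeZero n] (w : Equiv.Perm (Fin n)) : Subgroup (Torus n F) where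
  carrier := {a | a ∈ besselTorus F w ∧ a 0 = 1}
  one_mem' := ⟨one_mem _, rfl⟩
  mul_mem' := by
    rintro a b ⟨ha, ha'⟩ ⟨hb, hb'⟩
    exact ⟨mul_mem ha hb, by simp [ha', hb']⟩
  inv_mem' := by
    rintro a ⟨ha, ha'⟩
    exact ⟨inv_mem ha, by simp [ha']⟩

open Classical in
/-- The derived group `M_w^d` of the standard Levi subgroup `M_w`: block diagonal matrices whose
diagonal blocks all have determinant `1`. -/
def derivedLevi (w : Equiv.Perm (Fin n)) : Set (GL (Fin n) F) :=
  {g | (∀ i j, ¬ SameBlock w i j → (g : Matrix (Fin n) (Fin n) F) i j = 0) ∧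
    ∀ i, ((g : Matrix (Fin n) (Fin n) F).submatrix
      (Subtype.val : {j // SameBlock w i j} → Fin n) Subtype.val).det = 1}

/-- The transverse torus `A_w^{w'} = A_w ∩ M_{w'}^d`. -/
def transverseTorus (w w' : Equiv.Perm (Fin n)) : Set (Torus n F) :=
  {a | a ∈ besselTorus F w ∧ diag a ∈ derivedLevi F w'}

/-- The permutation matrix of `w`, sending `e_j` to `e_{w j}`. -/
def weylMatrix (w : Equiv.Perm (Fin n)) : Matrix (Fin n) (Fin n) F :=
  Matrix.of fun i j => if i = w j then 1 else 0

/-- The Bruhat cell `C(w) = U w A U`. -/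
def bruhatCell (w : Equiv.Perm (Fin n)) : Set (GL (Fin n) F) :=
  {g | ∃ u₁ ∈ unipotent n F, ∃ a : Torus n F, ∃ u₂ ∈ unipotent n F,
    (g : Matrix (Fin n) (Fin n) F) = u₁.1 * weylMatrix F w * (diag a).1 * u₂.1}

variable [TopologicalSpace F]

/-- The Bruhat order: `w ≤ w'` if `C(w)` lies in the closure of `C(w')`. -/
def BruhatLE (w w' : Equiv.Perm (Fin n)) : Prop :=
  bruhatCell F w ⊆ closure (bruhatCell F w')

/-- `Ω_w`, the union of the Bruhat cells `C(w')` with `w ≤ w'`. -/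
def bruhatOpen (w : Equiv.Perm (Fin n)) : Set (GL (Fin n) F) :=
  {g | ∃ w', BruhatLE F w w' ∧ g ∈ bruhatCell F w'}

/-- The Bessel distance `d_B(w, w')`: the largest `m` for which there is a chain
`w = w_m > ⋯ > w_0 = w'` of elements of `B(G)`. -/
def besselDist (w w' : Equiv.Perm (Fin n)) : ℕ :=
  sSup {m | ∃ c : Fin (m + 1) → Equiv.Perm (Fin n), (∀ i, SupportsBessel (c i)) ∧
    c 0 = w' ∧ c (Fin.last m) = w ∧
    ∀ i : Fin m, BruhatLE F (c i.castSucc) (c i.succ) ∧ c i.castSucc ≠ c i.succ}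

end Weyl

section Functions

variable {n : ℕ} {F : Type*} [Field F] [TopologicalSpace F]

/-- `f ∈ C_c^∞(Ω; ω)`: `f` is smooth (locally constant), transforms by `ω` under the center, and
is supported in `Z K` for a compact subset `K` of `Ω`. -/
structure IsSmoothCompactModCenter (ω : Fˣ →ₜ* ℂˣ) (Ω : Set (GL (Fin n) F))
    (f : GL (Fin n) F → ℂ) : Prop where
  smooth : IsLocallyConstant f
  central : ∀ (z : Fˣ) (g : GL (Fin n) F), f (GeneralLinearGroup.scalar (Fin n) z * g) = ω z * f g
  support : ∃ K : Set (GL (Fin n) F), IsCompact K ∧ K ⊆ Ω ∧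
    ∀ g, f g ≠ 0 → ∃ z : Fˣ, ∃ k ∈ K, g = GeneralLinearGroup.scalar (Fin n) z * k

variable {V : Type*} [AddCommGroup V] [Module ℂ V]

/-- `l` is a smooth linear form: its stabilizer is open. -/
def IsSmoothForm (π : Representation ℂ (GL (Fin n) F) V) (l : Module.Dual ℂ V) : Prop :=
  IsOpen {g : GL (Fin n) F | ∀ v, l (π g v) = l v}

/-- `π` is an irreducible smooth supercuspidal representation: its matrix coefficients
`g ↦ ⟨π(g) v, l⟩`, with `l` in the contragredient, are compactly supported modulo the center. -/
structure IsSupercuspidal (π : Representation ℂ (GL (Fin n) F) V) : Prop where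
  irreducible : π.IsIrreducible
  smooth : ∀ v, IsOpen {g : GL (Fin n) F | π g v = v}
  cuspidal : ∀ (v : V) (l : Module.Dual ℂ V), IsSmoothForm π l →
    ∃ K : Set (GL (Fin n) F), IsCompact K ∧
      ∀ g, l (π g v) ≠ 0 → ∃ z : Fˣ, ∃ k ∈ K, g = GeneralLinearGroup.scalar (Fin n) z * k

/-- `ω` is the central character of `π`. -/
def HasCentralCharacter (π : Representation ℂ (GL (Fin n) F) V) (ω : Fˣ →ₜ* ℂˣ) : Prop :=
  ∀ (z : Fˣ) (v : V), π (GeneralLinearGroup.scalar (Fin n) z) v = (ω z : ℂ) • v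

/-- `𝓜(π)`, the space spanned by the matrix coefficients of `π`. -/
def matrixCoefficients (π : Representation ℂ (GL (Fin n) F) V) :
    Submodule ℂ (GL (Fin n) F → ℂ) :=
  Submodule.span ℂ {f | ∃ (v : V) (l : Module.Dual ℂ V), IsSmoothForm π l ∧ f = fun g => l (π g v)}

end Functions

section Bessel

variable {n : ℕ} {F : Type*} [Field F]

/-- The generic character `ψ(u) = ψ(∑ u_{i,i+1})` of `U`. -/
def genericChar (ψ : AddChar F Circle) (u : unipotent n F) : Circle :=
  ψ (∑ i : Fin n, ∑ j : Fin n,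
    if (i : ℕ) + 1 = j then ((u : GL (Fin n) F) : Matrix (Fin n) (Fin n) F) i j else 0)

section Cutoff

variable [ValuativeRel F] [TopologicalSpace F] [IsNonarchimedeanLocalField F]

open Classical in
/-- The cutoff `φ_N`: the characteristic function of the matrices `x` with
`|x_{i,j}| ≤ q^{(i+j-1)N}`, where rows and columns are numbered from `1` in this formula. -/
def cutoff (N : ℕ) (x : Matrix (Fin n) (Fin n) F) : ℂ :=
  if ∀ i j : Fin n, valuation F (x i j) ≤ (uniformizer F)⁻¹ ^ (((i : ℕ) + j + 1) * N)
  then 1 else 0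

end Cutoff

variable [TopologicalSpace F] [MeasurableSpace (unipotent n F)]

/-- `W^f(g) = ∫_U f(x g) ψ⁻¹(x) dx`. -/
def whittaker (μ : Measure (unipotent n F)) (ψ : AddChar F Circle) (f : GL (Fin n) F → ℂ)
    (g : GL (Fin n) F) : ℂ :=
  ∫ x : unipotent n F, f (x * g) * ((genericChar ψ x)⁻¹ : Circle) ∂μ

/-- The partial Bessel integral `B^G_φ(ẇ_ℓ a, f)`. Here `g = ẇ_ℓ a = z g'` with `z = a_1 · I_n` and
`g' = ẇ_ℓ a'`, so that `ẇ_ℓ⁻¹ g' = a' = a_1⁻¹ a`; the twisted centralizer `U_g` is trivial, so the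
integral over `U_g \ U` is an integral over `U`. -/
def partialBessel [NeZero n] (μ : Measure (unipotent n F)) (ψ : AddChar F Circle)
    (φ : Matrix (Fin n) (Fin n) F → ℂ) (f : GL (Fin n) F → ℂ) (a : Torus n F) : ℂ :=
  ∫ u : unipotent n F,
    whittaker μ ψ f (longRep n F * diag a * u) *
      φ (((u : GL (Fin n) F) : Matrix (Fin n) (Fin n) F)ᵀ *
        (diag ((central (a 0))⁻¹ * a)).1 * ((u : GL (Fin n) F) : Matrix (Fin n) (Fin n) F)) *
      ((genericChar ψ u)⁻¹ : Circle) ∂μ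

/-- A family of functions on the torus is uniformly smooth in the variable `c' ∈ A'_{w'}`:
there are an open compact subgroup `C` and a compact subset `K` of `A'_{w'}`, the same for all
members of the family, such that every member is invariant under translation by `C`, and vanishes
at `b c'` for `b` in the transverse torus `A_{w_ℓ}^{w'}` and `c' ∈ A'_{w'}` outside `K`. -/
def UniformlySmooth [NeZero n] (w' : Equiv.Perm (Fin n)) {ι : Type*} (s : Set ι)
    (B : ι → Torus n F → ℂ) : Prop :=
  ∃ (C : Subgroup (reducedTorus F w')) (K : Set (reducedTorus F w')),
    IsOpen (C : Set (reducedTorus F w')) ∧ IsCompact (C : Set (reducedTorus F w')) ∧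
    IsCompact K ∧ ∀ N ∈ s,
      (∀ a : Torus n F, ∀ c₁ ∈ C, B N (a * c₁) = B N a) ∧
      ∀ b ∈ transverseTorus F Fin.revPerm w', ∀ c' : reducedTorus F w',
        B N (b * c') ≠ 0 → c' ∈ K

end Bessel

end

end PartialBessel

open PartialBessel

/-!
The function `f₁e` may be taken to be `f₀`. Everything then follows from the study of functions
`f` in `C_c^∞(G; ω)` with `W^f(1) = 0`, applied to the difference of a matrix coefficient and
`f₀`: for large `N`, the partial Bessel integrals of such an `f` are those of a function supported
in the union of the open sets `Ω_k = {Δ_k ≠ 0}`, `1 ≤ k < n`, where `Δ_k` is the lower left minor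
of size `k` (`lowerMinor`).

The way to change `f` is to average it against `ψ` over `U_m × U_m`, where the `U_m` are compact
open subgroups exhausting `U` (`unipotentBall`). They are chosen such that `φ_N(ᵗy S y) = φ_N(S)`
for `y ∈ U_m` and `N ≥ m`, so that averaging leaves the partial Bessel integrals unchanged for
`N ≥ m` (`exists_average`). The averaged function vanishes at every `g` for which some pair
`(x, y) ∈ U_m × U_m` satisfies `x g y = g` and `ψ(x) ψ(y) ≠ 1`. If all minors `Δ_k` vanish
at `g` and `g` is not in `Z U`, such a pair is written down explicitly as a rank one perturbation
of the identity (`exists_isIrrelevantAt`, `exists_stabilizer`). It depends continuously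
on `g` along the strata on which the staircase of zeros of `g` is constant (`zeroCorners`), so
by compactness one `m` serves
for the support of `f` in a stratum, and the strata are treated one after the other, those with
most zeros first. On `Z U` itself averaging produces a multiple of `W^f(1) = 0`. This is
`exists_vanish_of_lowerMinor_eq_zero`.

The resulting function is a sum of functions `h_k` supported in `Ω_k` (`exists_split_lowerMinor`),
and `Ω_k` is contained in `Ω_w` for the block antidiagonal permutation `w = levelPerm k`, because
`levelPerm k` is the least element of the Bruhat order whose cell meets `Ω_k`
(`bruhatLE_levelPerm`). So `f₁ w` is taken to be `h_k` if `w = levelPerm k` and zero for the other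
`w`.

It remains to see that the partial Bessel integrals of a function supported in `Ω_k` are uniformly
smooth along `A'_w`, a torus whose elements are `c = diag(1, …, 1, β, …, β)` with `k` entries `1`.
On `x ẇ_ℓ b c u` with `b` in the transverse torus, the ratio `Δ_k^n / det^k`, which is invariant
under `Z`, is a constant times a power of `β`, and it is bounded away from zero and infinity on
the support; hence the vanishing outside of a compact set
(`exists_bound_of_partialBessel_ne_zero`). For the invariance, write `c u = u y` with
`y = u⁻¹ c u`. By inverting the minor, the conjugate by `u` of the projection to the first
`k` coordinates is a function of `x ẇ_ℓ a u` that is continuous on `Ω_k` (`conj_headProj_eq`),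
so it is bounded on the
support, and `y` is as close to `1` as desired if `β` is. Then neither the function nor the cutoff
sees `y`, whatever `a` and `N` are (`exists_partialBessel_mul_congruenceTorus`).
-/

namespace PartialBessel

open Filter Topology

/-! ### Valuation balls, and compact and open subsets of `GL_n(F)` -/

section Valuation

variable {F : Type*} [Field F] [ValuativeRel F] [TopologicalSpace F]
  [IsNonarchimedeanLocalField F]

/-- The closed ball of radius `γ` around zero, as an additive subgroup. -/
def ballSubgroup (γ : ValueGroupWithZero F) : AddSubgroup F where
  carrier := {x | valuation F x ≤ γ}
  zero_mem' := by simp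
  add_mem' := fun ha hb => (valuation F).map_add_le ha hb
  neg_mem' := fun ha => by simpa using ha

theorem isOpen_ball {γ : ValueGroupWithZero F} (hγ : γ ≠ 0) :
    IsOpen {x : F | valuation F x ≤ γ} := by
  refine (ballSubgroup γ).isOpen_of_mem_nhds (g := 0) ?_
  rw [(IsValuativeTopology.hasBasis_nhds_zero' F).mem_iff]
  exact ⟨γ, hγ, fun x (hx : valuation F x < γ) => show valuation F x ≤ γ from hx.le⟩

theorem isClosed_ball (γ : ValueGroupWithZero F) : IsClosed {x : F | valuation F x ≤ γ} := by
  by_cases hγ : γ = 0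
  · subst hγ
    have h : IsClosed (⋂ γ : {γ : ValueGroupWithZero F // γ ≠ 0}, {x : F | valuation F x ≤ γ.1}) :=
      isClosed_iInter fun γ => (ballSubgroup γ.1).isClosed_of_isOpen (isOpen_ball γ.2)
    convert h using 1
    ext x
    simp only [le_zero_iff, map_eq_zero, Set.mem_ofPred_eq, Set.mem_iInter, Subtype.forall]
    refine ⟨fun h => by simp [h], fun h => ?_⟩
    by_contra hx
    obtain ⟨y, hy0, hy1⟩ := Valuation.IsNontrivial.exists_lt_one (v := valuation F)
    have h1 := h (valuation F (x * y)) (by simp [hx]; simpa using hy0)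
    rw [map_mul] at h1
    have h2 : valuation F x * valuation F y < valuation F x * 1 := by
      gcongr
      exact zero_lt_iff.mpr (by simpa using hx)
    rw [mul_one] at h2
    exact absurd h1 (not_le.mpr h2)
  · exact (ballSubgroup γ).isClosed_of_isOpen (isOpen_ball hγ)

instance instT2SpaceLocalField : T2Space F := by
  have : T1Space F := by
    have h : IsClosed ({0} : Set F) := by
      simpa using isClosed_ball (F := F) 0
    refine ⟨fun x => ?_⟩
    have := h.preimage (continuous_id.sub (continuous_const (y := x)))
    convert this using 1
    ext y
    simp [sub_eq_zero]
  infer_instance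

theorem exists_le_uniformizer_inv_pow (γ : ValueGroupWithZero F) :
    ∃ m : ℕ, γ ≤ (uniformizer F)⁻¹ ^ m :=
  MulArchimedean.arch γ ((one_lt_inv₀ uniformizer_pos).mpr uniformizer_lt_one)

theorem one_le_uniformizer_inv : 1 ≤ (uniformizer F)⁻¹ :=
  ((one_lt_inv₀ uniformizer_pos).mpr uniformizer_lt_one).le

/-- A function with values in `F` that is continuous on a compact set is bounded there. -/
theorem exists_valuation_le_of_continuousOn {X : Type*} [TopologicalSpace X] {K : Set X}
    (hK : IsCompact K) {h : X → F} (hh : ContinuousOn h K) :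
    ∃ γ : ValueGroupWithZero F, γ ≠ 0 ∧ ∀ x ∈ K, valuation F (h x) ≤ γ := by
  have hK' := hK.image_of_continuousOn hh
  have : Nonempty {γ : ValueGroupWithZero F // γ ≠ 0} := ⟨⟨1, one_ne_zero⟩⟩
  obtain ⟨t, ht⟩ := hK'.elim_directed_cover
    (fun γ : {γ : ValueGroupWithZero F // γ ≠ 0} => {x : F | valuation F x ≤ γ.1})
    (fun γ => isOpen_ball γ.2)
    (fun x _ => Set.mem_iUnion.mpr (by
      by_cases hx : x = 0
      · exact ⟨⟨1, one_ne_zero⟩, by simp [hx]⟩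
      · exact ⟨⟨valuation F x, by simpa using hx⟩, le_refl (valuation F x)⟩))
    (directed_of_isDirected_le fun a b hab x (hx : valuation F x ≤ a.1) =>
      show valuation F x ≤ b.1 from hx.trans hab)
  exact ⟨t.1, t.2, fun x hx => ht (Set.mem_image_of_mem h hx)⟩

end Valuation

section GeneralLinear

variable {n : ℕ} {F : Type*} [Field F] [TopologicalSpace F]

theorem continuous_entry (i j : Fin n) :
    Continuous fun g : GL (Fin n) F => (g : Matrix (Fin n) (Fin n) F) i j :=
  (Units.continuous_val (M := Matrix (Fin n) (Fin n) F)).matrix_elem i j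

variable [ValuativeRel F] [IsNonarchimedeanLocalField F]

instance instT2SpaceGL : T2Space (GL (Fin n) F) :=
  inferInstanceAs (T2Space (Matrix (Fin n) (Fin n) F)ˣ)

theorem isCompact_setOf_entry_le (γ : ValueGroupWithZero F) :
    IsCompact {g : GL (Fin n) F | ∀ i j,
      valuation F ((g : Matrix (Fin n) (Fin n) F) i j) ≤ γ ∧
      valuation F (((g⁻¹ : GL (Fin n) F) : Matrix (Fin n) (Fin n) F) i j) ≤ γ} := by
  have hM : IsCompact {A : Matrix (Fin n) (Fin n) F | ∀ i j, valuation F (A i j) ≤ γ} := by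
    have := isCompact_univ_pi (X := fun _ : Fin n => Fin n → F) (s := fun _ : Fin n =>
      Set.pi Set.univ fun _ : Fin n => {x : F | valuation F x ≤ γ})
      fun i => isCompact_univ_pi fun j => IsNonarchimedeanLocalField.isCompact_closedBall F γ
    refine (congrArg IsCompact (Set.ext fun A => ?_)).mp this
    exact ⟨fun h i j => h i trivial j trivial, fun h i _ j _ => h i j⟩
  have h2 := hM.prod (hM.image (MulOpposite.continuous_op (M := Matrix (Fin n) (Fin n) F)))
  refine (congrArg IsCompact (Set.ext fun g => ?_)).mp ((Units.isClosedEmbedding_embedProduct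
    (α := Matrix (Fin n) (Fin n) F)).isCompact_preimage h2)
  constructor
  · rintro ⟨h1, A, hA, hA'⟩ i j
    obtain rfl := MulOpposite.op_injective hA'
    exact ⟨h1 i j, hA i j⟩
  · exact fun h => ⟨fun i j => (h i j).1, _, fun i j => (h i j).2, rfl⟩

/-- The sets of matrices congruent, together with their inverse, to the identity matrix modulo
a small ball form a basis of neighbourhoods of the identity of `GL_n(F)`. -/
theorem exists_congruence_subset {s : Set (GL (Fin n) F)} (hs : s ∈ 𝓝 1) :
    ∃ ρ : ValueGroupWithZero F, ρ ≠ 0 ∧ ρ ≤ 1 ∧ ∀ g : GL (Fin n) F,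
      (∀ i j, valuation F ((g : Matrix (Fin n) (Fin n) F) i j - (1 : Matrix _ _ F) i j) ≤ ρ) →
      (∀ i j, valuation F (((g⁻¹ : GL (Fin n) F) : Matrix (Fin n) (Fin n) F) i j
        - (1 : Matrix _ _ F) i j) ≤ ρ) → g ∈ s := by
  have key : ∀ t ∈ 𝓝 (1 : Matrix (Fin n) (Fin n) F), ∃ ρ : ValueGroupWithZero F, ρ ≠ 0 ∧
      ∀ A : Matrix (Fin n) (Fin n) F,
        (∀ i j, valuation F (A i j - (1 : Matrix _ _ F) i j) ≤ ρ) → A ∈ t := by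
    intro t ht
    rw [show 𝓝 (1 : Matrix (Fin n) (Fin n) F) = Filter.pi fun i => Filter.pi fun j =>
      𝓝 ((1 : Matrix (Fin n) (Fin n) F) i j) from
        (nhds_pi (A := fun _ : Fin n => Fin n → F)).trans
          (congrArg Filter.pi (funext fun i => nhds_pi))] at ht
    have hb : ∀ x : F, (𝓝 x).HasBasis (fun γ : ValueGroupWithZero F => γ ≠ 0)
        fun γ => {y | valuation F (y - x) < γ} := fun x =>
      IsValuativeTopology.hasBasis_nhds' x
    have hb2 := hasBasis_pi fun i : Fin n => hasBasis_pi fun j : Fin n =>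
      hb ((1 : Matrix (Fin n) (Fin n) F) i j)
    obtain ⟨⟨I, J⟩, ⟨hI, hJ⟩, hsub⟩ := hb2.mem_iff.mp ht
    have : ∃ ρ : ValueGroupWithZero F, ρ ≠ 0 ∧ ∀ i ∈ I, ∀ j ∈ (J i).1, ρ < (J i).2 j := by
      obtain ⟨y, hy0, hy1⟩ := Valuation.IsNontrivial.exists_lt_one (v := valuation F)
      have hfin : ∀ T : Finset (Fin n × Fin n), (∀ p ∈ T, (J p.1).2 p.2 ≠ 0) →
          ∃ ρ : ValueGroupWithZero F, ρ ≠ 0 ∧ ∀ p ∈ T, ρ < (J p.1).2 p.2 := by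
        classical
        intro T
        induction T using Finset.induction_on with
        | empty => exact fun _ => ⟨1, one_ne_zero, by simp⟩
        | insert p T hp ih =>
          intro hT
          obtain ⟨ρ, h0, h⟩ := ih fun q hq => hT q (Finset.mem_insert_of_mem hq)
          have hp0 := hT p (Finset.mem_insert_self _ _)
          have hlt : (J p.1).2 p.2 * valuation F y < (J p.1).2 p.2 := by
            have : (J p.1).2 p.2 * valuation F y < (J p.1).2 p.2 * 1 := by
              gcongr
              exact zero_lt_iff.mpr hp0
            simpa using this
          refine ⟨min ρ ((J p.1).2 p.2 * valuation F y), ?_, ?_⟩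
          · rcases min_choice ρ ((J p.1).2 p.2 * valuation F y) with h | h <;> rw [h]
            · exact h0
            · exact mul_ne_zero hp0 (by simpa using hy0)
          · intro q hq
            rcases Finset.mem_insert.mp hq with rfl | hq
            · exact (min_le_right _ _).trans_lt hlt
            · exact (min_le_left _ _).trans_lt (h q hq)
      classical
      obtain ⟨ρ, h0, h⟩ := hfin (Finset.univ.filter fun p : Fin n × Fin n => p.1 ∈ I ∧
        p.2 ∈ (J p.1).1) (by
          intro p hp
          simp only [Finset.mem_filter, Finset.mem_univ, true_and] at hp
          exact (hJ p.1 hp.1).2 p.2 hp.2)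
      exact ⟨ρ, h0, fun i hi j hj => h (i, j) (by simp [hi, hj])⟩
    obtain ⟨ρ, h0, h⟩ := this
    exact ⟨ρ, h0, fun A hA => hsub fun i hi j hj => (hA i j).trans_lt (h i hi j hj)⟩
  have h1 := hs
  rw [Units.isInducing_embedProduct.nhds_eq_comap, Filter.mem_comap] at h1
  obtain ⟨t, ht, hts⟩ := h1
  rw [map_one, show (1 : Matrix (Fin n) (Fin n) F × (Matrix (Fin n) (Fin n) F)ᵐᵒᵖ) = (1, 1)
    from rfl, nhds_prod_eq, Filter.mem_prod_iff] at ht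
  obtain ⟨t1, ht1, t2, ht2, ht⟩ := ht
  obtain ⟨ρ1, h10, h1⟩ := key t1 ht1
  obtain ⟨ρ2, h20, h2⟩ := key (MulOpposite.op ⁻¹' t2)
    (MulOpposite.continuous_op.continuousAt.preimage_mem_nhds (by simpa using ht2))
  refine ⟨min (min ρ1 ρ2) 1, ?_, min_le_right _ _, fun g hg hg' => hts (ht ⟨?_, ?_⟩)⟩
  · rcases min_choice (min ρ1 ρ2) 1 with h | h <;> rw [h]
    · rcases min_choice ρ1 ρ2 with h | h <;> rw [h] <;> assumption
    · exact one_ne_zero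
  · exact h1 _ fun i j => (hg i j).trans ((min_le_left _ _).trans (min_le_left _ _))
  · exact h2 _ fun i j => (hg' i j).trans ((min_le_left _ _).trans (min_le_right _ _))

end GeneralLinear

/-! ### The unipotent group and its exhaustion by compact open subgroups -/

section Unipotent

variable {n : ℕ} {F : Type*} [Field F]

theorem unipotent_diag (u : unipotent n F) (i : Fin n) : u.1.1 i i = 1 := u.2.1 i

theorem unipotent_lower (u : unipotent n F) {i j : Fin n} (h : j < i) : u.1.1 i j = 0 := u.2.2 i j h

theorem unipotent_mul_inv_apply (u : unipotent n F) (i j : Fin n) :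
    ∑ l, u.1.1 i l * (u⁻¹).1.1 l j = (1 : Matrix (Fin n) (Fin n) F) i j := by
  rw [← Matrix.mul_apply, ← Units.val_mul, ← Subgroup.coe_mul, mul_inv_cancel]
  simp

theorem det_unipotent (u : unipotent n F) : u.1.1.det = 1 := by
  have h : u.1.1.BlockTriangular id := fun i j h => unipotent_lower u h
  rw [Matrix.det_of_isUpperTriangular h]
  simp [unipotent_diag]

/-- An upper triangular unipotent matrix as an element of `U`. -/
def toUnipotent (A : Matrix (Fin n) (Fin n) F) (h1 : ∀ i, A i i = 1)
    (h0 : ∀ i j, j < i → A i j = 0) : unipotent n F :=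
  ⟨GeneralLinearGroup.mkOfDetNeZero A (by
    have h : A.BlockTriangular id := fun i j h => h0 i j h
    rw [Matrix.det_of_isUpperTriangular h]
    simp [h1]), h1, h0⟩

theorem genericChar_mul (ψ : AddChar F Circle) (x y : unipotent n F) :
    genericChar ψ (x * y) = genericChar ψ x * genericChar ψ y := by
  rw [genericChar, genericChar, genericChar, ← AddChar.map_add_eq_mul, ← Finset.sum_add_distrib]
  congr 1
  refine Finset.sum_congr rfl fun i _ => ?_
  rw [← Finset.sum_add_distrib]
  refine Finset.sum_congr rfl fun j _ => ?_
  split_ifs with h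
  · have hij : i ≠ j := fun e => by subst e; omega
    rw [Subgroup.coe_mul, Units.val_mul, Matrix.mul_apply, Finset.sum_eq_add i j hij,
      unipotent_diag, unipotent_diag, one_mul, mul_one, add_comm]
    · rintro l - ⟨h1, h2⟩
      rcases lt_or_gt_of_ne h1 with h' | h'
      · rw [unipotent_lower x h', zero_mul]
      · rw [unipotent_lower y (i := l) (j := j), mul_zero]
        refine lt_of_le_of_ne ?_ (Ne.symm h2)
        rw [Fin.le_def, ← h]
        exact h'
    · simp
    · simp
  · simp

theorem genericChar_one (ψ : AddChar F Circle) : genericChar ψ (1 : unipotent n F) = 1 := by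
  have h := genericChar_mul ψ (1 : unipotent n F) 1
  rw [mul_one] at h
  exact (mul_eq_left.mp h.symm)

section Topology

variable [TopologicalSpace F]

theorem continuous_unipotent_entry (i j : Fin n) : Continuous fun u : unipotent n F => u.1.1 i j :=
  (continuous_entry i j).comp continuous_subtype_val

variable [ValuativeRel F] [IsNonarchimedeanLocalField F]

theorem continuous_genericChar {ψ : AddChar F Circle} (hψ : Continuous ψ) :
    Continuous (genericChar ψ : unipotent n F → Circle) := by
  refine hψ.comp (continuous_finsetSum _ fun i _ => continuous_finsetSum _ fun j _ => ?_)
  split_ifs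
  · exact continuous_unipotent_entry i j
  · exact continuous_const

theorem isClosed_unipotent : IsClosed (unipotent n F : Set (GL (Fin n) F)) := by
  have : (unipotent n F : Set (GL (Fin n) F)) =
      (⋂ i, {g : GL (Fin n) F | g.1 i i = 1}) ∩
        ⋂ i, ⋂ j, ⋂ _ : j < i, {g : GL (Fin n) F | g.1 i j = 0} := by
    ext g
    simp [unipotent]
  rw [this]
  exact (isClosed_iInter fun i => isClosed_eq (continuous_entry i i) continuous_const).inter
    (isClosed_iInter fun i => isClosed_iInter fun j => isClosed_iInter fun _ =>
      isClosed_eq (continuous_entry i j) continuous_const)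

variable (n F) in
/-- The subgroup `U_m` of the `u ∈ U` with `|u_{i,j}| ≤ q^{(j-i)m}` for `i ≤ j`. -/
def unipotentBall (m : ℕ) : Subgroup (unipotent n F) where
  carrier := {u | ∀ i j : Fin n, i ≤ j →
    valuation F (u.1.1 i j) ≤ (uniformizer F)⁻¹ ^ (((j : ℕ) - i) * m)}
  one_mem' := by
    intro i j _
    rcases eq_or_ne i j with rfl | h
    · simp
    · simp [h]
  mul_mem' := by
    intro a b ha hb i j hij
    rw [Subgroup.coe_mul, Units.val_mul, Matrix.mul_apply]
    refine (valuation F).map_sum_le fun l _ => ?_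
    rcases lt_or_ge l i with h | h
    · simp [unipotent_lower a h]
    rcases lt_or_ge j l with h' | h'
    · simp [unipotent_lower b h']
    rw [map_mul]
    refine (mul_le_mul' (ha i l h) (hb l j h')).trans (le_of_eq ?_)
    rw [← pow_add, ← add_mul]
    congr 2
    rw [Fin.le_def] at h h'
    omega
  inv_mem' := by
    intro a ha
    have key : ∀ d : ℕ, ∀ i j : Fin n, (j : ℕ) - i = d → i ≤ j →
        valuation F ((a⁻¹).1.1 i j) ≤ (uniformizer F)⁻¹ ^ (((j : ℕ) - i) * m) := by
      intro d
      induction d using Nat.strong_induction_on with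
      | _ d ih =>
        intro i j hd hij
        rcases hij.eq_or_lt with rfl | hlt
        · rw [unipotent_diag a⁻¹]
          simp
        have h := unipotent_mul_inv_apply a i j
        rw [← Finset.add_sum_erase _ _ (Finset.mem_univ i), unipotent_diag, one_mul,
          Matrix.one_apply_ne hlt.ne, add_eq_zero_iff_eq_neg] at h
        rw [h, Valuation.map_neg]
        refine (valuation F).map_sum_le fun l hl => ?_
        have hl : l ≠ i := (Finset.mem_erase.mp hl).1
        rcases lt_or_gt_of_ne hl with h | h
        · simp [unipotent_lower a h]
        rcases lt_or_ge j l with h' | h'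
        · rw [unipotent_lower a⁻¹ h']
          simp
        rw [map_mul]
        rw [Fin.lt_def] at h
        rw [Fin.le_def] at h'
        refine (mul_le_mul' (ha i l (Fin.le_def.mpr h.le))
          (ih (j - l) (by omega) l j rfl h')).trans (le_of_eq ?_)
        rw [← pow_add, ← add_mul]
        congr 2
        omega
    exact fun i j hij => key _ i j rfl hij

theorem mem_unipotentBall {m : ℕ} {u : unipotent n F} : u ∈ unipotentBall n F m ↔
    ∀ i j : Fin n, i ≤ j →
      valuation F (u.1.1 i j) ≤ (uniformizer F)⁻¹ ^ (((j : ℕ) - i) * m) := Iff.rfl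

theorem unipotentBall_mono {m m' : ℕ} (h : m ≤ m') : unipotentBall n F m ≤ unipotentBall n F m' :=
  fun _ hu i j hij => (hu i j hij).trans
    (pow_le_pow_right₀ one_le_uniformizer_inv (Nat.mul_le_mul_left _ h))

theorem mem_unipotentBall_of_entry_le {γ : ValueGroupWithZero F} {m : ℕ}
    (hγ : γ ≤ (uniformizer F)⁻¹ ^ m) {u : unipotent n F}
    (hu : ∀ i j, valuation F (u.1.1 i j) ≤ γ) : u ∈ unipotentBall n F m := by
  intro i j hij
  rcases hij.eq_or_lt with rfl | hlt
  · simp [unipotent_diag]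
  · refine (hu i j).trans (hγ.trans (pow_le_pow_right₀ one_le_uniformizer_inv ?_))
    rw [Fin.lt_def] at hlt
    exact Nat.le_mul_of_pos_left _ (by omega)

theorem isOpen_unipotentBall (m : ℕ) : IsOpen (unipotentBall n F m : Set (unipotent n F)) := by
  have : (unipotentBall n F m : Set (unipotent n F)) = ⋂ i, ⋂ j, ⋂ _ : i ≤ j,
      {u : unipotent n F |
        valuation F (u.1.1 i j) ≤ (uniformizer F)⁻¹ ^ (((j : ℕ) - i) * m)} := by
    ext u
    simp [mem_unipotentBall]
  rw [this]
  exact isOpen_iInter_of_finite fun i => isOpen_iInter_of_finite fun j =>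
    isOpen_iInter_of_finite fun _ => (isOpen_ball
      (pow_ne_zero _ (inv_ne_zero uniformizer_ne_zero))).preimage (continuous_unipotent_entry i j)

theorem isCompact_unipotentBall (m : ℕ) :
    IsCompact (unipotentBall n F m : Set (unipotent n F)) := by
  have h := (isClosed_unipotent (n := n) (F := F)).isClosedEmbedding_subtypeVal.isCompact_preimage
    (isCompact_setOf_entry_le ((uniformizer F)⁻¹ ^ (n * m)))
  refine h.of_isClosed_subset (Subgroup.isClosed_of_isOpen (unipotentBall n F m)
    (isOpen_unipotentBall m)) ?_
  have key : ∀ u ∈ unipotentBall n F m, ∀ i j : Fin n,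
      valuation F (u.1.1 i j) ≤ (uniformizer F)⁻¹ ^ (n * m) := by
    intro u hu i j
    rcases lt_or_ge j i with h | h
    · simp [unipotent_lower u h]
    · exact (hu i j h).trans (pow_le_pow_right₀ one_le_uniformizer_inv
        (Nat.mul_le_mul_right _ (by omega)))
  exact fun u hu i j => ⟨key u hu i j, key u⁻¹ (inv_mem hu) i j⟩

instance instLocallyCompactSpaceUnipotent : LocallyCompactSpace (unipotent n F) :=
  (isCompact_unipotentBall 0).locallyCompactSpace_of_mem_nhds_of_group
    ((isOpen_unipotentBall 0).mem_nhds (one_mem (unipotentBall n F 0)))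

theorem exists_mem_unipotentBall (u : unipotent n F) : ∃ m, u ∈ unipotentBall n F m := by
  obtain ⟨γ, -, hγ⟩ := exists_valuation_le_of_continuousOn (F := F)
    (isCompact_univ : IsCompact (Set.univ : Set (Fin n × Fin n)))
    (h := fun p => u.1.1 p.1 p.2) continuous_of_discreteTopology.continuousOn
  obtain ⟨m, hm⟩ := exists_le_uniformizer_inv_pow γ
  exact ⟨m, mem_unipotentBall_of_entry_le hm fun i j => hγ (i, j) trivial⟩

/-- The cutoff `φ_N` is invariant under `S ↦ ᵗy S y` for `y ∈ U_m` with `m ≤ N`. -/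
theorem cutoff_conj {m N : ℕ} (h : m ≤ N) {y : unipotent n F} (hy : y ∈ unipotentBall n F m)
    (S : Matrix (Fin n) (Fin n) F) : cutoff N (y.1.1ᵀ * S * y.1.1) = cutoff N S := by
  have key : ∀ (y : unipotent n F) (S : Matrix (Fin n) (Fin n) F), y ∈ unipotentBall n F m →
      (∀ i j : Fin n, valuation F (S i j) ≤ (uniformizer F)⁻¹ ^ (((i : ℕ) + j + 1) * N)) →
      ∀ i j : Fin n, valuation F ((y.1.1ᵀ * S * y.1.1) i j) ≤
        (uniformizer F)⁻¹ ^ (((i : ℕ) + j + 1) * N) := by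
    intro y S hy hS i j
    have hy' := unipotentBall_mono h hy
    rw [Matrix.mul_apply]
    refine (valuation F).map_sum_le fun l _ => ?_
    rw [Matrix.mul_apply, Finset.sum_mul]
    refine (valuation F).map_sum_le fun k _ => ?_
    rw [Matrix.transpose_apply]
    rcases lt_or_ge i k with h1 | h1
    · simp [unipotent_lower y h1]
    rcases lt_or_ge j l with h2 | h2
    · simp [unipotent_lower y h2]
    rw [map_mul, map_mul]
    refine (mul_le_mul' (mul_le_mul' (hy' k i h1) (hS k l)) (hy' l j h2)).trans (le_of_eq ?_)
    rw [← pow_add, ← pow_add, ← add_mul, ← add_mul]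
    congr 2
    rw [Fin.le_def] at h1 h2
    omega
  have hiff : (∀ i j : Fin n, valuation F ((y.1.1ᵀ * S * y.1.1) i j) ≤
      (uniformizer F)⁻¹ ^ (((i : ℕ) + j + 1) * N)) ↔
      ∀ i j : Fin n, valuation F (S i j) ≤ (uniformizer F)⁻¹ ^ (((i : ℕ) + j + 1) * N) := by
    refine ⟨fun hS => ?_, key y S hy⟩
    have h1 := key y⁻¹ _ (inv_mem hy) hS
    have h2 : (y⁻¹).1.1ᵀ * (y.1.1ᵀ * S * y.1.1) * (y⁻¹).1.1 = S := by
      have h3 : y.1.1 * (y⁻¹).1.1 = 1 := by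
        rw [← Units.val_mul, ← Subgroup.coe_mul, mul_inv_cancel]; simp
      have h4 : (y⁻¹).1.1ᵀ * y.1.1ᵀ = 1 := by
        rw [← Matrix.transpose_mul, h3, Matrix.transpose_one]
      calc (y⁻¹).1.1ᵀ * (y.1.1ᵀ * S * y.1.1) * (y⁻¹).1.1
          = ((y⁻¹).1.1ᵀ * y.1.1ᵀ) * S * (y.1.1 * (y⁻¹).1.1) := by
            simp only [Matrix.mul_assoc]
        _ = S := by rw [h3, h4, Matrix.one_mul, Matrix.mul_one]
    rwa [h2] at h1
  simp only [cutoff, hiff]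

variable [MeasurableSpace (unipotent n F)] [BorelSpace (unipotent n F)]

/-- `U` is unimodular, as every element lies in a compact open subgroup. -/
theorem integral_unipotent_mul_right (μ : Measure (unipotent n F)) [μ.IsHaarMeasure]
    {h : unipotent n F → ℂ} (hc : Continuous h) (hs : HasCompactSupport h) (y : unipotent n F) :
    ∫ x, h (x * y) ∂μ = ∫ x, h x ∂μ := by
  obtain ⟨m, hm⟩ := exists_mem_unipotentBall y
  have hmeas : Measurable fun x : unipotent n F => x * y := measurable_mul_const y
  have h3 := Measure.measure_isHaarMeasure_eq_smul_of_isOpen (μ.map (· * y)) μ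
    (isOpen_unipotentBall (n := n) (F := F) m)
  rw [Measure.map_apply hmeas (isOpen_unipotentBall m).measurableSet] at h3
  have h4 : (fun x : unipotent n F => x * y) ⁻¹' (unipotentBall n F m) = unipotentBall n F m := by
    ext x
    exact (unipotentBall n F m).mul_mem_cancel_right hm
  rw [h4] at h3
  have h5 : (Measure.haarScalarFactor (μ.map (· * y)) μ : ENNReal) = 1 := by
    have h0 : μ (unipotentBall n F m) ≠ 0 :=
      ((isOpen_unipotentBall m).measure_pos μ ⟨1, one_mem _⟩).ne'
    have ht : μ (unipotentBall n F m) ≠ ⊤ := (isCompact_unipotentBall m).measure_lt_top.ne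
    rw [ENNReal.smul_def, smul_eq_mul] at h3
    exact (ENNReal.mul_left_inj h0 ht).mp (by rw [← h3, one_mul])
  have hreal : ∀ k : unipotent n F → ℝ, Continuous k → HasCompactSupport k →
      ∫ x, k x ∂(μ.map (· * y)) = ∫ x, k x ∂μ := fun k hk hk' => by
    rw [Measure.integral_isMulLeftInvariant_eq_smul_of_hasCompactSupport
      (μ.map (· * y)) μ hk hk', ENNReal.coe_eq_one.mp h5]
    simp
  rw [← integral_map (f := h) hmeas.aemeasurable hc.aestronglyMeasurable,
    ← integral_re_add_im (hc.integrable_of_hasCompactSupport hs),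
    ← integral_re_add_im (hc.integrable_of_hasCompactSupport hs)]
  have hre := hreal (fun x => RCLike.re (h x)) (RCLike.continuous_re.comp hc)
    (hs.comp_left (g := fun z : ℂ => (RCLike.re z : ℝ)) (by simp))
  have him := hreal (fun x => RCLike.im (h x)) (RCLike.continuous_im.comp hc)
    (hs.comp_left (g := fun z : ℂ => (RCLike.im z : ℝ)) (by simp))
  rw [hre, him]

end Topology

end Unipotent

/-! ### Smooth functions compactly supported modulo the center -/

section Character

variable {n : ℕ} {F : Type*} [Field F] [ValuativeRel F] [TopologicalSpace F]
  [IsNonarchimedeanLocalField F]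

theorem circle_eq_one_of_forall_norm_pow_sub_one_lt {z : Circle}
    (h : ∀ k : ℕ, ‖((z : ℂ) ^ k) - 1‖ < 1 / 2) : z = 1 := by
  by_contra hz
  have hz' : 0 < ‖(z : ℂ) - 1‖ := by
    rw [norm_pos_iff, sub_ne_zero]
    exact fun e => hz (Circle.ext e)
  -- squaring `w` multiplies `w - 1` by `w + 1`, of absolute value at least `3 / 2`
  have key : ∀ k : ℕ, (3 / 2 : ℝ) ^ k * ‖(z : ℂ) - 1‖ ≤ ‖(z : ℂ) ^ (2 ^ k) - 1‖ := by
    intro k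
    induction k with
    | zero => simp
    | succ k ih =>
      have h1 : (z : ℂ) ^ (2 ^ (k + 1)) - 1 =
          ((z : ℂ) ^ (2 ^ k) - 1) * ((z : ℂ) ^ (2 ^ k) + 1) := by
        rw [pow_succ 2 k, pow_mul]; ring
      have h2 : (3 / 2 : ℝ) ≤ ‖(z : ℂ) ^ (2 ^ k) + 1‖ := by
        have h3 := norm_sub_norm_le (2 : ℂ) (1 - (z : ℂ) ^ (2 ^ k))
        have h4 : (2 : ℂ) - (1 - (z : ℂ) ^ (2 ^ k)) = (z : ℂ) ^ (2 ^ k) + 1 := by ring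
        rw [h4, norm_sub_rev] at h3
        have h5 := h (2 ^ k)
        have h6 : ‖(2 : ℂ)‖ = 2 := by simp
        linarith
      rw [h1, norm_mul, pow_succ]
      calc (3 / 2 : ℝ) ^ k * (3 / 2) * ‖(z : ℂ) - 1‖
          = ((3 / 2 : ℝ) ^ k * ‖(z : ℂ) - 1‖) * (3 / 2) := by ring
        _ ≤ _ := mul_le_mul ih h2 (by norm_num) (norm_nonneg _)
  obtain ⟨k, hk⟩ := pow_unbounded_of_one_lt (1 / ‖(z : ℂ) - 1‖) (by norm_num : (1 : ℝ) < 3 / 2)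
  rw [div_lt_iff₀ hz'] at hk
  linarith [key k, h (2 ^ k)]

/-- A continuous character of `F` is locally constant, as the circle has no small subgroups. -/
theorem isLocallyConstant_addChar {ψ : AddChar F Circle} (hψ : Continuous ψ) :
    IsLocallyConstant ψ := by
  have h1 : {x : F | ‖((ψ x : Circle) : ℂ) - 1‖ < 1 / 2} ∈ 𝓝 (0 : F) := by
    have hc : Continuous fun x : F => ‖((ψ x : Circle) : ℂ) - 1‖ := by fun_prop
    exact (isOpen_lt hc continuous_const).mem_nhds (by simp)
  obtain ⟨γ, hγ, hsub⟩ := (IsValuativeTopology.hasBasis_nhds_zero' F).mem_iff.mp h1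
  have h2 : ∀ x : F, valuation F x < γ → ψ x = 1 := by
    intro x hx
    refine circle_eq_one_of_forall_norm_pow_sub_one_lt fun k => ?_
    have h3 : valuation F ((k : F) * x) < γ := by
      rw [map_mul]
      refine lt_of_le_of_lt (mul_le_of_le_one_left' ?_) hx
      induction k with
      | zero => simp
      | succ k ih => push_cast; exact (valuation F).map_add_le ih (by simp)
    have h4 := hsub h3
    rwa [Set.mem_ofPred_eq, ← nsmul_eq_mul, AddChar.map_nsmul_eq_pow, Circle.coe_pow] at h4
  rw [IsLocallyConstant.iff_eventually_eq]
  intro x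
  have h5 := (IsValuativeTopology.hasBasis_nhds' x).mem_of_mem hγ
  filter_upwards [h5] with y hy
  have h6 := h2 _ hy
  rw [sub_eq_add_neg, AddChar.map_add_eq_mul, AddChar.map_neg_eq_inv] at h6
  exact mul_inv_eq_one.mp h6

theorem isLocallyConstant_genericChar {ψ : AddChar F Circle} (hψ : Continuous ψ) :
    IsLocallyConstant (genericChar ψ : unipotent n F → Circle) := by
  refine (isLocallyConstant_addChar hψ).comp_continuous
    (f := fun u : unipotent n F => ∑ i : Fin n, ∑ j : Fin n,
      if (i : ℕ) + 1 = j then u.1.1 i j else 0)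
    (continuous_finsetSum _ fun i _ => continuous_finsetSum _ fun j _ => ?_)
  split_ifs
  · exact continuous_unipotent_entry i j
  · exact continuous_const

end Character

section Functions

variable {n : ℕ} {F : Type*} [Field F]

theorem scalar_mul_apply (z : Fˣ) (g : GL (Fin n) F) (i j : Fin n) :
    (GeneralLinearGroup.scalar (Fin n) z * g).1 i j = z * g.1 i j := by
  simp [Matrix.mul_apply, Matrix.diagonal_apply]

theorem mul_scalar_mul (z : Fˣ) (g h : GL (Fin n) F) :
    g * (GeneralLinearGroup.scalar (Fin n) z * h) =
      GeneralLinearGroup.scalar (Fin n) z * (g * h) := by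
  have : g * GeneralLinearGroup.scalar (Fin n) z = GeneralLinearGroup.scalar (Fin n) z * g := by
    apply Units.ext
    ext i j
    rw [scalar_mul_apply]
    simp [mul_comm]
  rw [← mul_assoc, this, mul_assoc]

theorem scalar_mul_mul (z : Fˣ) (x g y : GL (Fin n) F) :
    x * (GeneralLinearGroup.scalar (Fin n) z * g) * y =
      GeneralLinearGroup.scalar (Fin n) z * (x * g * y) := by
  rw [mul_scalar_mul, mul_assoc]

variable [TopologicalSpace F]

namespace IsSmoothCompactModCenter

variable {ω : Fˣ →ₜ* ℂˣ} {Ω : Set (GL (Fin n) F)} {f f' : GL (Fin n) F → ℂ}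

theorem zero : IsSmoothCompactModCenter ω Ω (0 : GL (Fin n) F → ℂ) where
  smooth := IsLocallyConstant.const 0
  central := by simp
  support := ⟨∅, isCompact_empty, Set.empty_subset _, by simp⟩

theorem add (hf : IsSmoothCompactModCenter ω Ω f) (hf' : IsSmoothCompactModCenter ω Ω f') :
    IsSmoothCompactModCenter ω Ω (f + f') where
  smooth := hf.smooth.add hf'.smooth
  central z g := by simp only [Pi.add_apply, hf.central, hf'.central]; ring
  support := by
    obtain ⟨K, hK, hKΩ, h⟩ := hf.support
    obtain ⟨K', hK', hKΩ', h'⟩ := hf'.support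
    refine ⟨K ∪ K', hK.union hK', Set.union_subset hKΩ hKΩ', fun g hg => ?_⟩
    by_cases h0 : f g = 0
    · have h1 : f' g ≠ 0 := fun h1 => hg (by simp [h0, h1])
      obtain ⟨z, k, hk, e⟩ := h' g h1
      exact ⟨z, k, Or.inr hk, e⟩
    · obtain ⟨z, k, hk, e⟩ := h g h0
      exact ⟨z, k, Or.inl hk, e⟩

theorem smul (c : ℂ) (hf : IsSmoothCompactModCenter ω Ω f) :
    IsSmoothCompactModCenter ω Ω (c • f) where
  smooth := hf.smooth.comp (c * ·)
  central z g := by simp only [Pi.smul_apply, hf.central, smul_eq_mul]; ring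
  support := by
    obtain ⟨K, hK, hKΩ, h⟩ := hf.support
    exact ⟨K, hK, hKΩ, fun g hg => h g fun h0 => hg (by simp [h0])⟩

theorem finset_sum {ι : Type*} {s : Finset ι} {f : ι → GL (Fin n) F → ℂ}
    (h : ∀ i ∈ s, IsSmoothCompactModCenter ω Ω (f i)) :
    IsSmoothCompactModCenter ω Ω (∑ i ∈ s, f i) := by
  classical
  induction s using Finset.induction_on with
  | empty => exact zero
  | insert i s hi ih =>
    rw [Finset.sum_insert hi]
    exact (h i (Finset.mem_insert_self _ _)).add
      (ih fun j hj => h j (Finset.mem_insert_of_mem hj))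

/-- The compact set in the support condition may be taken in the support of `f`. -/
theorem exists_compact_support (hf : IsSmoothCompactModCenter ω Ω f) :
    ∃ K : Set (GL (Fin n) F), IsCompact K ∧ (∀ k ∈ K, f k ≠ 0) ∧
      ∀ g, f g ≠ 0 → ∃ z : Fˣ, ∃ k ∈ K, g = GeneralLinearGroup.scalar (Fin n) z * k := by
  obtain ⟨K, hK, -, h⟩ := hf.support
  refine ⟨K ∩ {g | f g ≠ 0}, hK.inter_right ?_, fun k hk => hk.2, fun g hg => ?_⟩
  · exact (hf.smooth.isClopen_fiber 0).compl.isClosed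
  · obtain ⟨z, k, hk, rfl⟩ := h g hg
    refine ⟨z, k, ⟨hk, fun h0 => hg ?_⟩, rfl⟩
    rw [hf.central, h0, mul_zero]

theorem of_vanish {Ω' : Set (GL (Fin n) F)} (hf : IsSmoothCompactModCenter ω Ω f)
    (h : ∀ g, f g ≠ 0 → g ∈ Ω') : IsSmoothCompactModCenter ω Ω' f := by
  obtain ⟨K, hK, hKf, hs⟩ := hf.exists_compact_support
  exact ⟨hf.smooth, hf.central, K, hK, fun k hk => h k (hKf k hk), hs⟩

end IsSmoothCompactModCenter

end Functions

section Stability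

variable {n : ℕ} {F : Type*} [Field F] [ValuativeRel F] [TopologicalSpace F]
  [IsNonarchimedeanLocalField F] {ω : Fˣ →ₜ* ℂˣ} {Ω : Set (GL (Fin n) F)}
  {f : GL (Fin n) F → ℂ}

/-- Functions in `C_c^∞(Ω; ω)` are uniformly locally constant on both sides. -/
theorem IsSmoothCompactModCenter.exists_nhds_one (hf : IsSmoothCompactModCenter ω Ω f) :
    ∃ V ∈ 𝓝 (1 : GL (Fin n) F), ∀ v ∈ V, ∀ w ∈ V, ∀ g, f (v * g * w) = f g := by
  obtain ⟨K, hK, -, hs⟩ := hf.support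
  have h1 : ∀ᶠ p : GL (Fin n) F × GL (Fin n) F in 𝓝 1, ∀ g ∈ K, f (p.1 * g * p.2) = f g := by
    refine hK.eventually_forall_of_forall_eventually fun g _ => ?_
    have hc : Continuous fun q : (GL (Fin n) F × GL (Fin n) F) × GL (Fin n) F =>
        q.1.1 * q.2 * q.1.2 := by fun_prop
    have h2 := (hf.smooth.comp_continuous hc).eventually_eq ((1, 1), g)
    have h3 := (hf.smooth.comp_continuous (continuous_snd (X := GL (Fin n) F × GL (Fin n) F)
      (Y := GL (Fin n) F))).eventually_eq ((1, 1), g)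
    filter_upwards [h2, h3] with q hq hq'
    simp only [Function.comp_apply, one_mul, mul_one] at hq hq'
    rw [hq, hq']
  have h2 : ∀ᶠ p : GL (Fin n) F × GL (Fin n) F in 𝓝 1,
      ∀ g ∈ K, f (p.1⁻¹ * g * p.2⁻¹) = f g := by
    have hc : Tendsto (fun p : GL (Fin n) F × GL (Fin n) F => p⁻¹) (𝓝 1) (𝓝 1) := by
      simpa using (continuous_inv (G := GL (Fin n) F × GL (Fin n) F)).tendsto 1
    exact hc.eventually h1
  obtain ⟨V1, hV1, V2, hV2, hV⟩ := mem_nhds_prod_iff.mp (h1.and h2)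
  refine ⟨V1 ∩ V2, inter_mem hV1 hV2, fun v hv w hw g => ?_⟩
  obtain ⟨h3, h4⟩ := hV (Set.mk_mem_prod hv.1 hw.2)
  by_cases hg : f g = 0
  · rw [hg]
    by_contra h5
    obtain ⟨z, k, hk, e⟩ := hs _ h5
    have h6 : g = v⁻¹ * (v * g * w) * w⁻¹ := by group
    rw [e, scalar_mul_mul] at h6
    rw [e, hf.central] at h5
    rw [h6, hf.central] at hg
    have h7 := h4 k hk
    simp only at h7
    rw [h7] at hg
    exact h5 hg
  · obtain ⟨z, k, hk, rfl⟩ := hs g hg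
    rw [scalar_mul_mul, hf.central, hf.central]
    exact congrArg _ (h3 k hk)

theorem exists_entry_bound_of_det_eq_one {K : Set (GL (Fin n) F)} (hK : IsCompact K) :
    ∃ γ : ValueGroupWithZero F, ∀ (z : Fˣ), ∀ k ∈ K,
      (GeneralLinearGroup.scalar (Fin n) z * k).1.det = 1 →
        ∀ i j, valuation F ((GeneralLinearGroup.scalar (Fin n) z * k).1 i j) ≤ γ := by
  obtain ⟨γ1, -, h1⟩ := exists_valuation_le_of_continuousOn (F := F) hK
    (h := fun g => (g⁻¹ : GL (Fin n) F).1.det)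
    (Continuous.continuousOn (Units.continuous_val.comp continuous_inv).matrix_det)
  obtain ⟨γ2, -, h2⟩ := exists_valuation_le_of_continuousOn (F := F)
    ((isCompact_univ (X := Fin n × Fin n)).prod hK) (h := fun p => p.2.1 p.1.1 p.1.2) (by
      refine Continuous.continuousOn (continuous_prod_of_discrete_left.mpr fun q => ?_)
      exact continuous_entry q.1 q.2)
  refine ⟨max 1 γ1 * γ2, fun z k hk hdet i j => ?_⟩
  have hz : valuation F (z : F) ≤ max 1 γ1 := by
    have h3 : (z : F) ^ n = (k⁻¹ : GL (Fin n) F).1.det := by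
      have h4 : (z : F) ^ n * k.1.det = 1 := by
        rw [← hdet, Units.val_mul, Matrix.det_mul]
        simp
      have h5 : k.1.det * (k⁻¹ : GL (Fin n) F).1.det = 1 := by
        rw [← Matrix.det_mul, ← Units.val_mul, mul_inv_cancel]; simp
      calc (z : F) ^ n = (z : F) ^ n * (k.1.det * (k⁻¹ : GL (Fin n) F).1.det) := by
            rw [h5, mul_one]
        _ = _ := by rw [← mul_assoc, h4, one_mul]
    rcases le_total (valuation F (z : F)) 1 with h | h
    · exact h.trans (le_max_left _ _)
    · refine le_trans ?_ (le_max_right _ _)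
      calc valuation F (z : F) ≤ valuation F (z : F) ^ n :=
            le_self_pow₀ h (Fin.pos i).ne'
        _ = valuation F (k⁻¹ : GL (Fin n) F).1.det := by rw [← h3, map_pow]
        _ ≤ γ1 := h1 k hk
  rw [scalar_mul_apply, map_mul]
  exact mul_le_mul' hz (h2 ((i, j), k) ⟨trivial, hk⟩)

/-- For fixed `g`, a function compactly supported modulo the center restricts to a compactly
supported function on `U g`, because `U` consists of matrices of determinant `1`. -/
theorem IsSmoothCompactModCenter.exists_unipotentBall (hf : IsSmoothCompactModCenter ω Ω f)
    (g : GL (Fin n) F) : ∃ m, ∀ x : unipotent n F, f (x * g) ≠ 0 → x ∈ unipotentBall n F m := by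
  obtain ⟨K, hK, -, hs⟩ := hf.support
  obtain ⟨γ, hγ⟩ := exists_entry_bound_of_det_eq_one (hK.image (continuous_mul_const g⁻¹))
  obtain ⟨m, hm⟩ := exists_le_uniformizer_inv_pow γ
  refine ⟨m, fun x hx => mem_unipotentBall_of_entry_le hm ?_⟩
  obtain ⟨z, k, hk, e⟩ := hs _ hx
  have h1 : x.1 = GeneralLinearGroup.scalar (Fin n) z * (k * g⁻¹) := by
    rw [← mul_assoc, ← e, mul_inv_cancel_right]
  rw [h1]
  exact hγ z _ ⟨k, hk, rfl⟩ (by rw [← h1, det_unipotent])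

end Stability

/-! ### Linearity of the partial Bessel integral -/

section Integrals

variable {n : ℕ} {F : Type*} [Field F] [ValuativeRel F] [TopologicalSpace F]
  [IsNonarchimedeanLocalField F] {ω : Fˣ →ₜ* ℂˣ} {Ω : Set (GL (Fin n) F)}
  {f : GL (Fin n) F → ℂ} {ψ : AddChar F Circle}

theorem continuous_genericChar_inv (hψ : Continuous ψ) :
    Continuous fun u : unipotent n F => (((genericChar ψ u)⁻¹ : Circle) : ℂ) := by
  have := continuous_genericChar (n := n) hψ
  fun_prop

theorem continuous_whittaker_integrand (hψ : Continuous ψ)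
    (hf : IsSmoothCompactModCenter ω Ω f) (g : GL (Fin n) F) :
    Continuous fun x : unipotent n F => f (x * g) * ((genericChar ψ x)⁻¹ : Circle) :=
  (hf.smooth.continuous.comp (continuous_subtype_val.mul continuous_const)).mul
    (continuous_genericChar_inv hψ)

theorem hasCompactSupport_whittaker_integrand (ψ : AddChar F Circle)
    (hf : IsSmoothCompactModCenter ω Ω f) (g : GL (Fin n) F) :
    HasCompactSupport fun x : unipotent n F => f (x * g) * ((genericChar ψ x)⁻¹ : Circle) := by
  obtain ⟨m, hm⟩ := hf.exists_unipotentBall g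
  refine HasCompactSupport.intro (isCompact_unipotentBall m) fun x hx => ?_
  have : f (x * g) = 0 := by
    by_contra h
    exact hx (hm x h)
  rw [this, zero_mul]

theorem isLocallyConstant_cutoff (N : ℕ) :
    IsLocallyConstant (cutoff N : Matrix (Fin n) (Fin n) F → ℂ) := by
  classical
  have hc : IsClopen {x : Matrix (Fin n) (Fin n) F | ∀ i j : Fin n,
      valuation F (x i j) ≤ (uniformizer F)⁻¹ ^ (((i : ℕ) + j + 1) * N)} := by
    have : {x : Matrix (Fin n) (Fin n) F | ∀ i j : Fin n,
        valuation F (x i j) ≤ (uniformizer F)⁻¹ ^ (((i : ℕ) + j + 1) * N)} =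
        ⋂ i, ⋂ j, {x : Matrix (Fin n) (Fin n) F |
          valuation F (x i j) ≤ (uniformizer F)⁻¹ ^ (((i : ℕ) + j + 1) * N)} := by
      ext x; simp
    rw [this]
    refine isClopen_iInter_of_finite fun i => isClopen_iInter_of_finite fun j => ?_
    exact IsClopen.preimage ⟨isClosed_ball _, isOpen_ball
      (pow_ne_zero _ (inv_ne_zero uniformizer_ne_zero))⟩ (continuous_id.matrix_elem i j)
  rw [IsLocallyConstant.iff_eventually_eq]
  intro x
  by_cases hx : ∀ i j : Fin n, valuation F (x i j) ≤ (uniformizer F)⁻¹ ^ (((i : ℕ) + j + 1) * N)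
  · filter_upwards [hc.isOpen.mem_nhds hx] with y hy
    exact (if_pos hy).trans (if_pos hx).symm
  · filter_upwards [hc.compl.isOpen.mem_nhds hx] with y hy
    exact (if_neg hy).trans (if_neg hx).symm

/-- Boundedness of `ᵗu a u` bounds `u`, row by row. -/
theorem exists_unipotentBall_of_cutoff (N : ℕ) (a : Torus n F) :
    ∃ m, ∀ u : unipotent n F, cutoff N (u.1.1ᵀ * (diag a).1 * u.1.1) ≠ 0 →
      u ∈ unipotentBall n F m := by
  classical
  obtain ⟨γa, -, ha⟩ := exists_valuation_le_of_continuousOn (F := F)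
    (isCompact_univ : IsCompact (Set.univ : Set (Fin n))) (h := fun i => (a i : F))
    continuous_of_discreteTopology.continuousOn
  obtain ⟨γb, -, hb⟩ := exists_valuation_le_of_continuousOn (F := F)
    (isCompact_univ : IsCompact (Set.univ : Set (Fin n))) (h := fun i => ((a i)⁻¹ : F))
    continuous_of_discreteTopology.continuousOn
  set Q : ValueGroupWithZero F := (uniformizer F)⁻¹ ^ ((2 * n) * N) with hQ
  have key : ∀ k : ℕ, ∃ γ : ValueGroupWithZero F, ∀ u : unipotent n F,
      cutoff N (u.1.1ᵀ * (diag a).1 * u.1.1) ≠ 0 → ∀ i j : Fin n, (i : ℕ) < k →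
        valuation F (u.1.1 i j) ≤ γ := by
    intro k
    induction k with
    | zero => exact ⟨0, fun u _ i j h => absurd h (Nat.not_lt_zero _)⟩
    | succ k ih =>
      obtain ⟨γ, hγ⟩ := ih
      refine ⟨max γ (γb * max Q (γ * γa * γ)), fun u hu i j hi => ?_⟩
      rcases Nat.lt_succ_iff_lt_or_eq.mp hi with h | h
      · exact (hγ u hu i j h).trans (le_max_left _ _)
      · refine le_trans ?_ (le_max_right _ _)
        have hS : ∀ i j : Fin n, valuation F ((u.1.1ᵀ * (diag a).1 * u.1.1) i j) ≤
            (uniformizer F)⁻¹ ^ (((i : ℕ) + j + 1) * N) := by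
          by_contra h'
          exact hu (if_neg h')
        have h1 : (u.1.1ᵀ * (diag a).1 * u.1.1) i j =
            a i * u.1.1 i j + ∑ l ∈ Finset.univ.erase i, u.1.1 l i * a l * u.1.1 l j := by
          rw [Matrix.mul_apply, ← Finset.add_sum_erase _ _ (Finset.mem_univ i)]
          simp [diag, Matrix.mul_diagonal, unipotent_diag]
        have h2 : u.1.1 i j = (a i : F)⁻¹ * ((u.1.1ᵀ * (diag a).1 * u.1.1) i j -
            ∑ l ∈ Finset.univ.erase i, u.1.1 l i * a l * u.1.1 l j) := by
          rw [h1, add_sub_cancel_right, inv_mul_cancel_left₀ (a i).ne_zero]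
        rw [h2, map_mul]
        refine mul_le_mul' (hb i trivial) ((valuation F).map_sub_le ?_ ?_)
        · exact (hS i j).trans ((pow_le_pow_right₀ one_le_uniformizer_inv
            (Nat.mul_le_mul_right _ (by omega))).trans (le_max_left _ _))
        · refine ((valuation F).map_sum_le fun l hl => ?_).trans (le_max_right _ _)
          rcases lt_or_gt_of_ne (Finset.mem_erase.mp hl).1 with h' | h'
          · have h'' : (l : ℕ) < k := by rw [← h]; exact h'
            rw [map_mul, map_mul]
            exact mul_le_mul' (mul_le_mul' (hγ u hu l i h'') (ha l trivial)) (hγ u hu l j h'')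
          · rw [unipotent_lower u h', zero_mul, zero_mul, map_zero]
            exact zero_le
  obtain ⟨γ, hγ⟩ := key n
  obtain ⟨m, hm⟩ := exists_le_uniformizer_inv_pow γ
  exact ⟨m, fun u hu => mem_unipotentBall_of_entry_le hm fun i j => hγ u hu i j i.2⟩

variable [MeasurableSpace (unipotent n F)] (μ : Measure (unipotent n F))

/-- The integrand of the partial Bessel integral. -/
noncomputable def besselIntegrand [NeZero n] (ψ : AddChar F Circle) (N : ℕ) (f : GL (Fin n) F → ℂ)
    (a : Torus n F) (u : unipotent n F) : ℂ :=
  whittaker μ ψ f (longRep n F * diag a * u) *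
    cutoff N (u.1.1ᵀ * (diag ((central (a 0))⁻¹ * a)).1 * u.1.1) *
      ((genericChar ψ u)⁻¹ : Circle)

theorem partialBessel_eq [NeZero n] (ψ : AddChar F Circle) (N : ℕ) (f : GL (Fin n) F → ℂ)
    (a : Torus n F) :
    partialBessel μ ψ (cutoff N) f a = ∫ u, besselIntegrand μ ψ N f a u ∂μ := rfl

theorem continuous_whittaker (hf : IsSmoothCompactModCenter ω Ω f) :
    Continuous (whittaker μ ψ f) := by
  obtain ⟨V, hV, h⟩ := hf.exists_nhds_one
  refine IsLocallyConstant.continuous ((IsLocallyConstant.iff_eventually_eq _).mpr fun g => ?_)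
  have h1 : ∀ᶠ g' in 𝓝 g, g⁻¹ * g' ∈ V := by
    have : Tendsto (fun g' => g⁻¹ * g') (𝓝 g) (𝓝 1) := by
      simpa using (continuous_const_mul g⁻¹).tendsto g
    exact this.eventually hV
  filter_upwards [h1] with g' hg'
  refine integral_congr_ae (Eventually.of_forall fun x => ?_)
  have h2 := h 1 (mem_of_mem_nhds hV) _ hg' (x * g)
  rw [one_mul, mul_assoc, mul_inv_cancel_left] at h2
  simp only [h2]

theorem continuous_besselIntegrand [NeZero n] (hψ : Continuous ψ)
    (hf : IsSmoothCompactModCenter ω Ω f) (N : ℕ) (a : Torus n F) :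
    Continuous (besselIntegrand μ ψ N f a) := by
  refine (((continuous_whittaker μ hf).comp
    (continuous_const.mul continuous_subtype_val)).mul ?_).mul (continuous_genericChar_inv hψ)
  have hv : Continuous fun u : unipotent n F => u.1.1 :=
    Units.continuous_val.comp continuous_subtype_val
  exact (isLocallyConstant_cutoff N).continuous.comp
    ((hv.matrix_transpose.mul continuous_const).mul hv)

theorem hasCompactSupport_besselIntegrand [NeZero n] (N : ℕ) (a : Torus n F) :
    HasCompactSupport (besselIntegrand μ ψ N f a) := by
  obtain ⟨m, hm⟩ := exists_unipotentBall_of_cutoff N ((central (a 0))⁻¹ * a)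
  refine HasCompactSupport.intro (isCompact_unipotentBall m) fun x hx => ?_
  have : cutoff N (x.1.1ᵀ * (diag ((central (a 0))⁻¹ * a)).1 * x.1.1) = 0 := by
    by_contra h
    exact hx (hm x h)
  rw [besselIntegrand, this, mul_zero, zero_mul]

variable [BorelSpace (unipotent n F)] [μ.IsHaarMeasure]

theorem integrable_besselIntegrand [NeZero n] (hψ : Continuous ψ)
    (hf : IsSmoothCompactModCenter ω Ω f) (N : ℕ) (a : Torus n F) :
    Integrable (besselIntegrand μ ψ N f a) μ :=
  (continuous_besselIntegrand μ hψ hf N a).integrable_of_hasCompactSupport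
    (hasCompactSupport_besselIntegrand μ N a)

theorem whittaker_smul_sum {ι : Type*} (hψ : Continuous ψ) (s : Finset ι) (c : ι → ℂ)
    {f : ι → GL (Fin n) F → ℂ} (hf : ∀ i ∈ s, IsSmoothCompactModCenter ω Ω (f i))
    (g : GL (Fin n) F) :
    whittaker μ ψ (∑ i ∈ s, c i • f i) g = ∑ i ∈ s, c i * whittaker μ ψ (f i) g := by
  simp only [whittaker, ← integral_const_mul]
  rw [← integral_finsetSum s fun i hi =>
    ((continuous_whittaker_integrand hψ (hf i hi) g).integrable_of_hasCompactSupport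
      (hasCompactSupport_whittaker_integrand ψ (hf i hi) g)).const_mul (c i)]
  refine integral_congr_ae (Eventually.of_forall fun x => ?_)
  simp only [Finset.sum_apply, Pi.smul_apply, smul_eq_mul, Finset.sum_mul, mul_assoc]

theorem partialBessel_smul_sum [NeZero n] {ι : Type*} (hψ : Continuous ψ) (s : Finset ι)
    (c : ι → ℂ) {f : ι → GL (Fin n) F → ℂ} (hf : ∀ i ∈ s, IsSmoothCompactModCenter ω Ω (f i))
    (N : ℕ) (a : Torus n F) :
    partialBessel μ ψ (cutoff N) (∑ i ∈ s, c i • f i) a =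
      ∑ i ∈ s, c i * partialBessel μ ψ (cutoff N) (f i) a := by
  simp only [partialBessel_eq, ← integral_const_mul]
  rw [← integral_finsetSum s fun i hi =>
    (integrable_besselIntegrand μ hψ (hf i hi) N a).const_mul (c i)]
  refine integral_congr_ae (Eventually.of_forall fun u => ?_)
  simp only [besselIntegrand, whittaker_smul_sum μ hψ s c hf, Finset.sum_mul, mul_assoc]

end Integrals

/-! ### Averaging over compact open subgroups of `U × U` -/

section Twist

variable {n : ℕ} {F : Type*} [Field F]

/-- The translate `g ↦ ψ⁻¹(x) ψ⁻¹(y) f(x g y)` of `f`, for `x, y ∈ U`. -/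
noncomputable def twist (ψ : AddChar F Circle) (x y : unipotent n F) (f : GL (Fin n) F → ℂ) :
    GL (Fin n) F → ℂ :=
  fun g => (((genericChar ψ x)⁻¹ * (genericChar ψ y)⁻¹ : Circle) : ℂ) * f (x * g * y)

theorem twist_twist (ψ : AddChar F Circle) (x y x' y' : unipotent n F) (f : GL (Fin n) F → ℂ) :
    twist ψ x' y' (twist ψ x y f) = twist ψ (x * x') (y' * y) f := by
  funext g
  simp only [twist, Subgroup.coe_mul, genericChar_mul, mul_inv, Circle.coe_mul, mul_assoc]
  ring

theorem twist_one (ψ : AddChar F Circle) (f : GL (Fin n) F → ℂ) : twist ψ 1 1 f = f := by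
  funext g
  simp [twist, genericChar_one]

variable [ValuativeRel F] [TopologicalSpace F]
  [IsNonarchimedeanLocalField F] {ω : Fˣ →ₜ* ℂˣ} {Ω : Set (GL (Fin n) F)}
  {f : GL (Fin n) F → ℂ} {ψ : AddChar F Circle}

theorem IsSmoothCompactModCenter.twist (hf : IsSmoothCompactModCenter ω Set.univ f)
    (ψ : AddChar F Circle) (x y : unipotent n F) :
    IsSmoothCompactModCenter ω Set.univ (twist ψ x y f) where
  smooth := (hf.smooth.comp_continuous
    ((continuous_const_mul x.1).mul continuous_const)).comp
      ((((genericChar ψ x)⁻¹ * (genericChar ψ y)⁻¹ : Circle) : ℂ) * ·)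
  central z g := by
    simp only [PartialBessel.twist, scalar_mul_mul, hf.central]
    ring
  support := by
    obtain ⟨K, hK, -, hs⟩ := hf.support
    refine ⟨(fun k => x.1⁻¹ * k * y.1⁻¹) '' K,
      hK.image ((continuous_const_mul _).mul continuous_const), Set.subset_univ _, fun g hg => ?_⟩
    obtain ⟨z, k, hk, e⟩ := hs (x * g * y) (right_ne_zero_of_mul hg)
    refine ⟨z, _, ⟨k, hk, rfl⟩, ?_⟩
    rw [← scalar_mul_mul, ← e]
    group

/-- The translates of `f` by a compact subgroup of `U × U` form a finite set. -/
theorem IsSmoothCompactModCenter.finite_twists (hf : IsSmoothCompactModCenter ω Ω f)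
    (hψ : Continuous ψ) (m : ℕ) :
    (Set.range fun p : unipotentBall n F m × unipotentBall n F m =>
      PartialBessel.twist ψ p.1.1 p.2.1 f).Finite := by
  have : CompactSpace (unipotentBall n F m) :=
    isCompact_iff_compactSpace.mp (isCompact_unipotentBall m)
  refine IsLocallyConstant.range_finite ((IsLocallyConstant.iff_eventually_eq _).mpr fun p => ?_)
  obtain ⟨V, hV, h⟩ := hf.exists_nhds_one
  have h1 : ∀ᶠ q : unipotentBall n F m × unipotentBall n F m in 𝓝 p, q.1.1.1 * p.1.1.1⁻¹ ∈ V := by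
    have hc : Continuous fun q : unipotentBall n F m × unipotentBall n F m =>
      q.1.1.1 * p.1.1.1⁻¹ := by fun_prop
    exact hc.continuousAt.eventually (by simpa using hV)
  have h2 : ∀ᶠ q : unipotentBall n F m × unipotentBall n F m in 𝓝 p, p.2.1.1⁻¹ * q.2.1.1 ∈ V := by
    have hc : Continuous fun q : unipotentBall n F m × unipotentBall n F m =>
      p.2.1.1⁻¹ * q.2.1.1 := by fun_prop
    exact hc.continuousAt.eventually (by simpa using hV)
  have h3 := ((isLocallyConstant_genericChar (n := n) hψ).comp_continuous
    (f := fun q : unipotentBall n F m × unipotentBall n F m => q.1.1)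
    (by fun_prop)).eventually_eq p
  have h4 := ((isLocallyConstant_genericChar (n := n) hψ).comp_continuous
    (f := fun q : unipotentBall n F m × unipotentBall n F m => q.2.1)
    (by fun_prop)).eventually_eq p
  filter_upwards [h1, h2, h3, h4] with q h1 h2 h3 h4
  simp only [Function.comp_apply] at h3 h4
  funext g
  simp only [PartialBessel.twist, h3, h4]
  rw [← h _ h1 _ h2 (p.1.1.1 * g * p.2.1.1)]
  congr 2
  group

variable [MeasurableSpace (unipotent n F)] [BorelSpace (unipotent n F)]
  (μ : Measure (unipotent n F)) [μ.IsHaarMeasure]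

theorem whittaker_twist (x y : unipotent n F) (g : GL (Fin n) F) :
    whittaker μ ψ (twist ψ x y f) g =
      ((genericChar ψ y)⁻¹ : Circle) * whittaker μ ψ f (g * y) := by
  have h := integral_mul_left_eq_self (μ := μ) (fun t : unipotent n F =>
    ((genericChar ψ y)⁻¹ : Circle) * (f (t * (g * y)) * ((genericChar ψ t)⁻¹ : Circle))) x
  rw [whittaker, whittaker, ← integral_const_mul, ← h]
  refine integral_congr_ae (Eventually.of_forall fun t => ?_)
  simp only [twist, Subgroup.coe_mul, genericChar_mul, mul_inv, Circle.coe_mul, mul_assoc]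
  ring

theorem whittaker_twist_one (hψ : Continuous ψ) (hf : IsSmoothCompactModCenter ω Set.univ f)
    (x y : unipotent n F) : whittaker μ ψ (twist ψ x y f) 1 = whittaker μ ψ f 1 := by
  rw [whittaker_twist, one_mul, whittaker, whittaker, ← integral_const_mul]
  have h := integral_unipotent_mul_right μ (continuous_whittaker_integrand hψ hf 1)
    (hasCompactSupport_whittaker_integrand ψ hf 1) y
  rw [← h]
  refine integral_congr_ae (Eventually.of_forall fun t => ?_)
  simp only [Subgroup.coe_mul, mul_one, genericChar_mul, mul_inv, Circle.coe_mul]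
  ring

/-- The partial Bessel integral does not see translations by elements of `U` fixing the
cutoff. -/
theorem partialBessel_twist [NeZero n] (hψ : Continuous ψ)
    (hf : IsSmoothCompactModCenter ω Set.univ f) {m N : ℕ} (hmN : m ≤ N) (x : unipotent n F)
    {y : unipotent n F} (hy : y ∈ unipotentBall n F m) (a : Torus n F) :
    partialBessel μ ψ (cutoff N) (twist ψ x y f) a = partialBessel μ ψ (cutoff N) f a := by
  rw [partialBessel_eq, partialBessel_eq, ← integral_unipotent_mul_right μ
    (continuous_besselIntegrand μ hψ hf N a) (hasCompactSupport_besselIntegrand μ N a) y]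
  refine integral_congr_ae (Eventually.of_forall fun u => ?_)
  have h := cutoff_conj hmN hy (u.1.1ᵀ * (diag ((central (a 0))⁻¹ * a)).1 * u.1.1)
  simp only [besselIntegrand, whittaker_twist, Subgroup.coe_mul, genericChar_mul, mul_inv,
    Circle.coe_mul, Units.val_mul, Matrix.transpose_mul, mul_assoc] at h ⊢
  rw [h]
  ring

/-- Averaging `f` over the compact group `U_m × U_m` against `ψ` makes it equivariant without
changing its partial Bessel integrals for the cutoffs `φ_N` with `N ≥ m`. -/
theorem exists_average [NeZero n] (hψ : Continuous ψ)
    (hf : IsSmoothCompactModCenter ω Set.univ f) (m : ℕ) :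
    ∃ f' : GL (Fin n) F → ℂ, IsSmoothCompactModCenter ω Set.univ f' ∧
      (∀ x ∈ unipotentBall n F m, ∀ y ∈ unipotentBall n F m, ∀ g,
        f' (x * g * y) = (genericChar ψ x * genericChar ψ y : Circle) * f' g) ∧
      (∀ g, f' g ≠ 0 → ∃ x ∈ unipotentBall n F m, ∃ y ∈ unipotentBall n F m,
        f (x * g * y) ≠ 0) ∧
      whittaker μ ψ f' 1 = whittaker μ ψ f 1 ∧
      ∀ N ≥ m, ∀ a, partialBessel μ ψ (cutoff N) f' a = partialBessel μ ψ (cutoff N) f a := by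
  classical
  have hfin := hf.finite_twists hψ m
  set R := hfin.toFinset with hR
  have hmem : ∀ h, h ∈ R ↔ ∃ x ∈ unipotentBall n F m, ∃ y ∈ unipotentBall n F m,
      twist ψ x y f = h := by
    intro h
    simp [hR]
  have hne : (R.card : ℂ) ≠ 0 := by
    have : R.Nonempty := ⟨f, (hmem f).mpr ⟨1, one_mem _, 1, one_mem _, twist_one ψ f⟩⟩
    exact_mod_cast this.card_pos.ne'
  have hS : ∀ h ∈ R, IsSmoothCompactModCenter ω Set.univ h := by
    intro h hh
    obtain ⟨x, -, y, -, rfl⟩ := (hmem h).mp hh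
    exact hf.twist ψ x y
  refine ⟨∑ h ∈ R, (R.card : ℂ)⁻¹ • h,
    IsSmoothCompactModCenter.finset_sum fun h hh => (hS h hh).smul _, ?_, ?_, ?_, ?_⟩
  · intro x hx y hy g
    have h1 : ∑ h ∈ R, (R.card : ℂ)⁻¹ • h = ∑ h ∈ R, (R.card : ℂ)⁻¹ • twist ψ x y h := by
      refine Finset.sum_nbij' (twist ψ x⁻¹ y⁻¹) (twist ψ x y) ?_ ?_ ?_ ?_ ?_
      · intro h hh
        obtain ⟨x', hx', y', hy', rfl⟩ := (hmem h).mp hh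
        exact (hmem _).mpr ⟨x' * x⁻¹, mul_mem hx' (inv_mem hx), y⁻¹ * y', mul_mem (inv_mem hy) hy',
          (twist_twist ..).symm⟩
      · intro h hh
        obtain ⟨x', hx', y', hy', rfl⟩ := (hmem h).mp hh
        exact (hmem _).mpr ⟨x' * x, mul_mem hx' hx, y * y', mul_mem hy hy',
          (twist_twist ..).symm⟩
      · intro h _
        rw [twist_twist, inv_mul_cancel, mul_inv_cancel, twist_one]
      · intro h _
        rw [twist_twist, mul_inv_cancel, inv_mul_cancel, twist_one]
      · intro h _
        rw [twist_twist, inv_mul_cancel, mul_inv_cancel, twist_one]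
    have h2 := congrFun h1 g
    rw [h2]
    simp only [Finset.sum_apply, Pi.smul_apply, Finset.mul_sum, twist, smul_eq_mul]
    refine Finset.sum_congr rfl fun h _ => ?_
    have h3 : ((genericChar ψ x * genericChar ψ y : Circle) : ℂ) *
        ((genericChar ψ x)⁻¹ * (genericChar ψ y)⁻¹ : Circle) = 1 := by
      rw [← Circle.coe_mul, ← mul_inv, mul_inv_cancel, Circle.coe_one]
    linear_combination (-(R.card : ℂ)⁻¹ * h (x * g * y)) * h3
  · intro g hg
    by_contra h0
    push Not at h0
    refine hg ?_
    rw [Finset.sum_apply]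
    refine Finset.sum_eq_zero fun h hh => ?_
    obtain ⟨x, hx, y, hy, rfl⟩ := (hmem h).mp hh
    simp [twist, h0 x hx y hy]
  · rw [whittaker_smul_sum μ hψ R _ hS, Finset.sum_congr rfl (g := fun _ =>
      (R.card : ℂ)⁻¹ * whittaker μ ψ f 1), Finset.sum_const, nsmul_eq_mul,
      mul_inv_cancel_left₀ hne]
    intro h hh
    obtain ⟨x, hx, y, hy, rfl⟩ := (hmem h).mp hh
    rw [whittaker_twist_one μ hψ hf]
  · intro N hN a
    rw [partialBessel_smul_sum μ hψ R _ hS, Finset.sum_congr rfl (g := fun _ =>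
      (R.card : ℂ)⁻¹ * partialBessel μ ψ (cutoff N) f a), Finset.sum_const, nsmul_eq_mul,
      mul_inv_cancel_left₀ hne]
    intro h hh
    obtain ⟨x, hx, y, hy, rfl⟩ := (hmem h).mp hh
    rw [partialBessel_twist μ hψ hf hN x hy]

/-- If the Whittaker integral of `f` vanishes at the identity, averaging makes `f` vanish on
`Z U`. -/
theorem exists_average_vanish_unipotent [NeZero n] (hψ : Continuous ψ)
    (hf : IsSmoothCompactModCenter ω Set.univ f) (hW : whittaker μ ψ f 1 = 0) :
    ∃ f' : GL (Fin n) F → ℂ, IsSmoothCompactModCenter ω Set.univ f' ∧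
      (∀ z : Fˣ, ∀ u : unipotent n F, f' (GeneralLinearGroup.scalar (Fin n) z * u) = 0) ∧
      ∃ m, ∀ N ≥ m, ∀ a,
        partialBessel μ ψ (cutoff N) f' a = partialBessel μ ψ (cutoff N) f a := by
  obtain ⟨m, hm⟩ := hf.exists_unipotentBall 1
  obtain ⟨f', hf', heq, hsupp, hW', hB⟩ := exists_average μ hψ hf m
  refine ⟨f', hf', fun z u => ?_, m, hB⟩
  have h1 : ∀ u : unipotent n F, f' u ≠ 0 → u ∈ unipotentBall n F m := by
    intro u hu
    obtain ⟨x, hx, y, hy, h⟩ := hsupp _ hu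
    have h2 := hm (x * u * y) (by simpa using h)
    exact (mul_mem_cancel_left hx).mp ((mul_mem_cancel_right hy).mp h2)
  have h2 : ∀ u ∈ unipotentBall n F m, f' u = (genericChar ψ u : Circle) * f' 1 := by
    intro u hu
    simpa [genericChar_one] using heq u hu 1 (one_mem _) 1
  have h3 : whittaker μ ψ f' 1 = μ.real (unipotentBall n F m) * f' 1 := by
    have h4 : ∀ u : unipotent n F, f' (u.1 * 1) * ((genericChar ψ u)⁻¹ : Circle) =
        (unipotentBall n F m : Set (unipotent n F)).indicator (fun _ => f' 1) u := by
      intro u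
      by_cases hu : u ∈ unipotentBall n F m
      · rw [Set.indicator_of_mem (by exact hu), mul_one, h2 u hu, mul_right_comm,
          ← Circle.coe_mul, mul_inv_cancel, Circle.coe_one, one_mul]
      · rw [Set.indicator_of_notMem (by exact hu), mul_one]
        have : f' u = 0 := by
          by_contra h
          exact hu (h1 u h)
        rw [this, zero_mul]
    rw [whittaker, integral_congr_ae (Eventually.of_forall h4),
      integral_indicator_const _ (isOpen_unipotentBall m).measurableSet, Complex.real_smul]
  rw [hW', hW] at h3
  have h5 : μ.real (unipotentBall n F m) ≠ 0 :=
    (ENNReal.toReal_pos ((isOpen_unipotentBall m).measure_pos μ ⟨1, one_mem _⟩).ne'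
      (isCompact_unipotentBall m).measure_lt_top.ne).ne'
  have h6 : f' 1 = 0 := by
    rcases mul_eq_zero.mp h3.symm with h | h
    · exact absurd (by exact_mod_cast h) h5
    · exact h
  rw [hf'.central]
  by_cases hu : u ∈ unipotentBall n F m
  · rw [h2 u hu, h6, mul_zero, mul_zero]
  · have : f' u = 0 := by
      by_contra h
      exact hu (h1 u h)
    rw [this, mul_zero]

end Twist

/-! ### The lower left minors -/

section Minors

variable {n : ℕ} {F : Type*} [Field F]

/-- The matrix whose first `k` columns are those of `A`, and whose remaining columns are the first
`n - k` standard basis vectors. -/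
def minorMatrix (k : ℕ) (A : Matrix (Fin n) (Fin n) F) : Matrix (Fin n) (Fin n) F :=
  Matrix.of fun i j => if (j : ℕ) < k then A i j else if (i : ℕ) + k = j then 1 else 0

/-- Up to sign, the minor of `A` formed by its last `k` rows and its first `k` columns. -/
def lowerMinor (k : ℕ) (A : Matrix (Fin n) (Fin n) F) : F := (minorMatrix k A).det

theorem minorMatrix_of_lt {k : ℕ} {A : Matrix (Fin n) (Fin n) F} {i j : Fin n} (h : (j : ℕ) < k) :
    minorMatrix k A i j = A i j := if_pos h

theorem minorMatrix_of_ge {k : ℕ} {A : Matrix (Fin n) (Fin n) F} {i j : Fin n} (h : k ≤ (j : ℕ)) :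
    minorMatrix k A i j = if (i : ℕ) + k = j then 1 else 0 := if_neg (not_lt.mpr h)

theorem minorMatrix_mul_diagonal (k : ℕ) (A : Matrix (Fin n) (Fin n) F) (d : Fin n → F) :
    minorMatrix k (A * Matrix.diagonal d) =
      minorMatrix k A * Matrix.diagonal fun j : Fin n => if (j : ℕ) < k then d j else 1 := by
  ext i j
  rw [Matrix.mul_diagonal]
  by_cases h : (j : ℕ) < k
  · rw [minorMatrix_of_lt h, minorMatrix_of_lt h, Matrix.mul_diagonal, if_pos h]
  · rw [minorMatrix_of_ge (not_lt.mp h), minorMatrix_of_ge (not_lt.mp h), if_neg h, mul_one]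

theorem lowerMinor_mul_diagonal (k : ℕ) (A : Matrix (Fin n) (Fin n) F) (d : Fin n → F) :
    lowerMinor k (A * Matrix.diagonal d) =
      lowerMinor k A * ∏ j : Fin n, if (j : ℕ) < k then d j else 1 := by
  rw [lowerMinor, minorMatrix_mul_diagonal, Matrix.det_mul, Matrix.det_diagonal, lowerMinor]

theorem lowerMinor_scalar_mul {k : ℕ} (hk : k ≤ n) (z : Fˣ) (g : GL (Fin n) F) :
    lowerMinor k (GeneralLinearGroup.scalar (Fin n) z * g).1 = (z : F) ^ k * lowerMinor k g.1 := by
  have h : (GeneralLinearGroup.scalar (Fin n) z * g).1 =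
      g.1 * Matrix.diagonal fun _ => (z : F) := by
    ext i j
    rw [scalar_mul_apply, Matrix.mul_diagonal, mul_comm]
  rw [h, lowerMinor_mul_diagonal, mul_comm]
  congr 1
  rw [Finset.prod_ite, Finset.prod_const_one, mul_one, Finset.prod_const]
  congr 1
  rw [Fin.card_filter_val_lt, min_eq_right hk]

theorem lowerMinor_mul_unipotent (k : ℕ) (A : Matrix (Fin n) (Fin n) F) (y : unipotent n F) :
    lowerMinor k (A * y.1.1) = lowerMinor k A := by
  let T : Matrix (Fin n) (Fin n) F := Matrix.of fun l j =>
    if (j : ℕ) < k then y.1.1 l j else (1 : Matrix (Fin n) (Fin n) F) l j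
  have hT : T.BlockTriangular id := by
    intro l j (h : j < l)
    simp only [T, Matrix.of_apply]
    split_ifs
    · exact unipotent_lower y h
    · exact Matrix.one_apply_ne h.ne'
  have hdet : T.det = 1 := by
    rw [Matrix.det_of_isUpperTriangular hT]
    refine Finset.prod_eq_one fun j _ => ?_
    simp only [T, Matrix.of_apply]
    split_ifs
    · exact unipotent_diag y j
    · exact Matrix.one_apply_eq j
  have h : minorMatrix k (A * y.1.1) = minorMatrix k A * T := by
    ext i j
    rw [Matrix.mul_apply]
    by_cases hj : (j : ℕ) < k
    · rw [minorMatrix_of_lt hj, Matrix.mul_apply]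
      refine Finset.sum_congr rfl fun l _ => ?_
      simp only [T, Matrix.of_apply, if_pos hj]
      rcases lt_or_ge j l with h' | h'
      · rw [unipotent_lower y h', mul_zero, mul_zero]
      · rw [minorMatrix_of_lt (lt_of_le_of_lt h' hj)]
    · simp only [T, Matrix.of_apply, if_neg hj]
      rw [← Matrix.mul_apply, Matrix.mul_one, minorMatrix_of_ge (not_lt.mp hj),
        minorMatrix_of_ge (not_lt.mp hj)]
  rw [lowerMinor, h, Matrix.det_mul, hdet, mul_one, lowerMinor]

theorem lowerMinor_unipotent_mul (k : ℕ) (x : unipotent n F) (A : Matrix (Fin n) (Fin n) F) :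
    lowerMinor k (x.1.1 * A) = lowerMinor k A := by
  let T : Matrix (Fin n) (Fin n) F := Matrix.of fun l j =>
    if k ≤ (j : ℕ) then
      if k ≤ (l : ℕ) then
        x.1.1 ⟨l - k, (Nat.sub_le _ _).trans_lt l.2⟩ ⟨j - k, (Nat.sub_le _ _).trans_lt j.2⟩
      else 0
    else (1 : Matrix (Fin n) (Fin n) F) l j
  have hT : T.BlockTriangular id := by
    intro l j (h : j < l)
    simp only [T, Matrix.of_apply]
    split_ifs with h1 h2
    · exact unipotent_lower x (by rw [Fin.lt_def] at h ⊢; simp only; omega)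
    · rfl
    · exact Matrix.one_apply_ne h.ne'
  have hdet : T.det = 1 := by
    rw [Matrix.det_of_isUpperTriangular hT]
    refine Finset.prod_eq_one fun j _ => ?_
    simp only [T, Matrix.of_apply]
    split_ifs with h1
    · exact unipotent_diag x _
    · exact Matrix.one_apply_eq j
  have h : minorMatrix k (x.1.1 * A) * T = x.1.1 * minorMatrix k A := by
    ext i j
    rw [Matrix.mul_apply, Matrix.mul_apply]
    by_cases hj : (j : ℕ) < k
    · simp only [T, Matrix.of_apply, if_neg (not_le.mpr hj)]
      rw [← Matrix.mul_apply, Matrix.mul_one, minorMatrix_of_lt hj, Matrix.mul_apply]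
      exact Finset.sum_congr rfl fun l _ => by rw [minorMatrix_of_lt hj]
    · have hj := not_lt.mp hj
      have hr : ∑ l, x.1.1 i l * minorMatrix k A l j =
          x.1.1 i ⟨j - k, (Nat.sub_le _ _).trans_lt j.2⟩ := by
        rw [Finset.sum_eq_single ⟨j - k, (Nat.sub_le _ _).trans_lt j.2⟩]
        · rw [minorMatrix_of_ge hj, if_pos (show (j : ℕ) - k + k = j by omega), mul_one]
        · intro l _ hl
          rw [minorMatrix_of_ge hj, if_neg, mul_zero]
          intro e
          exact hl (Fin.ext (show (l : ℕ) = j - k by omega))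
        · simp
      rw [hr]
      by_cases hi : (i : ℕ) + k < n
      · rw [Finset.sum_eq_single ⟨i + k, hi⟩]
        · rw [minorMatrix_of_ge (by simp), if_pos rfl, one_mul]
          simp only [T, Matrix.of_apply, if_pos hj]
          rw [if_pos (by simp)]
          exact congrArg (fun l => x.1.1 l _) (Fin.ext (Nat.add_sub_cancel (n := i) (m := k)))
        · intro l _ hl
          by_cases hlk : k ≤ (l : ℕ)
          · rw [minorMatrix_of_ge hlk, if_neg, zero_mul]
            exact fun e => hl (Fin.ext (show (l : ℕ) = i + k by omega))
          · simp only [T, Matrix.of_apply, if_pos hj, if_neg hlk, mul_zero]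
        · simp
      · rw [unipotent_lower x (by rw [Fin.lt_def]; simp only; omega)]
        refine Finset.sum_eq_zero fun l _ => ?_
        by_cases hlk : k ≤ (l : ℕ)
        · rw [minorMatrix_of_ge hlk, if_neg (by omega), zero_mul]
        · simp only [T, Matrix.of_apply, if_pos hj, if_neg hlk, mul_zero]
  have h2 := congrArg Matrix.det h
  rwa [Matrix.det_mul, Matrix.det_mul, hdet, det_unipotent, mul_one, one_mul] at h2

/-- The minor does not vanish if the last `k` rows have no common kernel among the vectors
supported in the first `k` coordinates. -/
theorem lowerMinor_ne_zero {k : ℕ} {A : Matrix (Fin n) (Fin n) F}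
    (h : ∀ v : Fin n → F, (∀ c : Fin n, k ≤ (c : ℕ) → v c = 0) →
      (∀ r : Fin n, n ≤ (r : ℕ) + k → ∑ c, A r c * v c = 0) → v = 0) :
    lowerMinor k A ≠ 0 := by
  intro h0
  obtain ⟨v, hv, hv0⟩ := Matrix.exists_mulVec_eq_zero_iff.mpr h0
  have hrow : ∀ r, ∑ c, minorMatrix k A r c * v c = 0 := fun r => congrFun hv0 r
  let w : Fin n → F := fun c => if (c : ℕ) < k then v c else 0
  have hw : w = 0 := by
    refine h w (fun c hc => if_neg (not_lt.mpr hc)) fun r hr => ?_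
    rw [← hrow r]
    refine Finset.sum_congr rfl fun c _ => ?_
    by_cases hc : (c : ℕ) < k
    · rw [minorMatrix_of_lt hc]
      simp only [w, if_pos hc]
    · rw [minorMatrix_of_ge (not_lt.mp hc), if_neg (by omega)]
      simp only [w, if_neg hc, mul_zero, zero_mul]
  have hw' : ∀ c : Fin n, (c : ℕ) < k → v c = 0 := by
    intro c hc
    have := congrFun hw c
    simpa only [w, if_pos hc, Pi.zero_apply] using this
  refine hv (funext fun c => ?_)
  by_cases hc : (c : ℕ) < k
  · exact hw' c hc
  have hc := not_lt.mp hc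
  have h1 := hrow ⟨c - k, (Nat.sub_le _ _).trans_lt c.2⟩
  rw [Finset.sum_eq_single c] at h1
  · rwa [minorMatrix_of_ge hc, if_pos (by simp only; omega), one_mul] at h1
  · intro c' _ hc'
    by_cases hck : (c' : ℕ) < k
    · rw [hw' c' hck, mul_zero]
    · rw [minorMatrix_of_ge (not_lt.mp hck), if_neg, zero_mul]
      exact fun e => hc' (Fin.ext (by simp only at e; omega))
  · simp

theorem lowerMinor_longMatrix_ne_zero (k : ℕ) : lowerMinor k (longMatrix n F) ≠ 0 := by
  refine lowerMinor_ne_zero fun v hv hrow => funext fun c => ?_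
  by_cases hc : (c : ℕ) < k
  · have h1 := hrow (Fin.rev c) (by rw [Fin.val_rev]; omega)
    rw [Finset.sum_eq_single c] at h1
    · simpa [longMatrix] using h1
    · intro c' _ hc'
      simp [longMatrix, hc']
    · simp
  · exact hv c (not_lt.mp hc)

theorem continuous_lowerMinor [TopologicalSpace F] [IsTopologicalRing F] (k : ℕ) :
    Continuous fun g : GL (Fin n) F => lowerMinor k g.1 := by
  refine Continuous.matrix_det (continuous_matrix fun i j => ?_)
  by_cases hj : (j : ℕ) < k
  · simpa only [minorMatrix_of_lt hj] using continuous_entry i j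
  · simpa only [minorMatrix_of_ge (not_lt.mp hj)] using continuous_const

end Minors

/-! ### Points with a stabilizer on which the character is non-trivial -/

section Stabilizers

variable {n : ℕ} {F : Type*} [Field F]

theorem sum_superdiagonal_eq {M : Matrix (Fin n) (Fin n) F} {a b : Fin n} (hab : (a : ℕ) + 1 = b)
    (h : ∀ i j : Fin n, (i : ℕ) + 1 = j → i ≠ a → M i j = 0) :
    (∑ i : Fin n, ∑ j : Fin n, if (i : ℕ) + 1 = j then M i j else 0) = M a b := by
  rw [Finset.sum_eq_single a, Finset.sum_eq_single b]
  · rw [if_pos hab]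
  · intro j _ hj
    rw [if_neg]
    exact fun e => hj (Fin.ext (by omega))
  · simp
  · intro i _ hi
    refine Finset.sum_eq_zero fun j _ => ?_
    split_ifs with e
    · exact h i j e hi
    · rfl
  · simp

/-- Suppose that the rows of `g` from the `q`-th on vanish in the columns up to the `i`-th, and
that `g q (i + 1) ≠ 0`. For a vector `ξ` with last nonzero coordinate `ξ i = 1`, and `η` the
`q`-th row of `g` scaled to `η (i + 1) = 1`, the rank one perturbations `y = 1 + s ξ η` and
`x = g y⁻¹ g⁻¹ = 1 - s (g ξ) η g⁻¹` of the identity lie in `U` and satisfy `x g y = g`. Each of them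
has one nonzero superdiagonal entry, and `s` is chosen such that these two sum to `s₀`. -/
theorem exists_stabilizer (ψ : AddChar F Circle) (g : GL (Fin n) F) {q' q i i' : Fin n}
    (hq : (q' : ℕ) + 1 = q) (hi : (i : ℕ) + 1 = i') (hz : ∀ r c, q ≤ r → c ≤ i → g.1 r c = 0)
    (hp : g.1 q i' ≠ 0) (ξ : Fin n → F) (h1 : ξ i = 1) (h0 : ∀ c, i < c → ξ c = 0)
    (s₀ : F) (hδ : 1 - (g.1 *ᵥ ξ) q' / g.1 q i' ≠ 0) :
    ∃ x y : unipotent n F, x * g * y = g ∧ genericChar ψ x * genericChar ψ y = ψ s₀ ∧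
      (∀ a b, x.1.1 a b = (1 : Matrix (Fin n) (Fin n) F) a b -
        s₀ / (1 - (g.1 *ᵥ ξ) q' / g.1 q i') / g.1 q i' * (g.1 *ᵥ ξ) a * if b = q then 1 else 0) ∧
      (∀ a b, y.1.1 a b = (1 : Matrix (Fin n) (Fin n) F) a b +
        s₀ / (1 - (g.1 *ᵥ ξ) q' / g.1 q i') * ξ a * (g.1 q b / g.1 q i')) := by
  set w := g.1 *ᵥ ξ with hw
  set δ := 1 - w q' / g.1 q i' with hδdef
  set s := s₀ / δ with hs
  have hw0 : ∀ r, q ≤ r → w r = 0 := by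
    intro r hr
    rw [hw, Matrix.mulVec, dotProduct]
    refine Finset.sum_eq_zero fun c _ => ?_
    rcases lt_or_ge i c with h | h
    · rw [h0 c h, mul_zero]
    · rw [hz r c hr h, zero_mul]
  have hprod : ∀ a b : Fin n, b ≤ a → ξ a * (g.1 q b / g.1 q i') = 0 := by
    intro a b hab
    rcases lt_or_ge i a with h | h
    · rw [h0 a h, zero_mul]
    · rw [hz q b le_rfl (hab.trans h), zero_div, mul_zero]
  have hwq : ∀ a b : Fin n, b ≤ a → w a * (if b = q then (1 : F) else 0) = 0 := by
    intro a b hab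
    split_ifs with h
    · rw [hw0 a (h ▸ hab), zero_mul]
    · rw [mul_zero]
  let x : unipotent n F := toUnipotent (Matrix.of fun a b => (1 : Matrix (Fin n) (Fin n) F) a b -
      s / g.1 q i' * w a * if b = q then 1 else 0)
    (fun a => by rw [Matrix.of_apply, mul_assoc, hwq a a le_rfl, mul_zero, sub_zero,
      Matrix.one_apply_eq])
    (fun a b hab => by rw [Matrix.of_apply, mul_assoc, hwq a b hab.le, mul_zero, sub_zero,
      Matrix.one_apply_ne hab.ne'])
  let y : unipotent n F := toUnipotent (Matrix.of fun a b => (1 : Matrix (Fin n) (Fin n) F) a b +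
      s * ξ a * (g.1 q b / g.1 q i'))
    (fun a => by rw [Matrix.of_apply, mul_assoc, hprod a a le_rfl, mul_zero, add_zero,
      Matrix.one_apply_eq])
    (fun a b hab => by rw [Matrix.of_apply, mul_assoc, hprod a b hab.le, mul_zero, add_zero,
      Matrix.one_apply_ne hab.ne'])
  have hx : ∀ a b, x.1.1 a b = (1 : Matrix (Fin n) (Fin n) F) a b -
      s / g.1 q i' * w a * if b = q then 1 else 0 := fun a b => rfl
  have hy : ∀ a b, y.1.1 a b = (1 : Matrix (Fin n) (Fin n) F) a b +
      s * ξ a * (g.1 q b / g.1 q i') := fun a b => rfl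
  refine ⟨x, y, ?_, ?_, hx, hy⟩
  · apply Units.ext
    ext a b
    have hgy : ∀ a b, (g.1 * y.1.1) a b = g.1 a b + s * w a * (g.1 q b / g.1 q i') := by
      intro a b
      rw [Matrix.mul_apply]
      simp only [hy, mul_add, Finset.sum_add_distrib]
      rw [← Matrix.mul_apply, Matrix.mul_one]
      congr 1
      rw [hw, Matrix.mulVec, dotProduct, Finset.mul_sum, Finset.sum_mul]
      exact Finset.sum_congr rfl fun c _ => by ring
    rw [mul_assoc, Units.val_mul, Units.val_mul, Matrix.mul_apply]
    simp only [hx, sub_mul, Finset.sum_sub_distrib]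
    rw [← Matrix.mul_apply, Matrix.one_mul, Finset.sum_eq_single q, if_pos rfl, hgy, hgy,
      hw0 q le_rfl]
    · field_simp
      ring
    · intro c _ hc
      rw [if_neg hc]
      ring
    · simp
  · rw [genericChar, genericChar, ← AddChar.map_add_eq_mul]
    congr 1
    have e1 := sum_superdiagonal_eq (M := x.1.1) hq (by
      intro a b hab ha
      rw [hx, if_neg, mul_zero, sub_zero, Matrix.one_apply_ne]
      · exact fun e => by subst e; omega
      · exact fun e => ha (Fin.ext (by subst e; omega)))
    have e2 := sum_superdiagonal_eq (M := y.1.1) hi (by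
      intro a b hab ha
      have hne : a ≠ b := fun e => by subst e; omega
      rw [hy, Matrix.one_apply_ne hne, zero_add, mul_assoc]
      rcases lt_or_gt_of_ne ha with h | h
      · rw [hz q b le_rfl (by rw [Fin.le_def, ← hab]; exact h), zero_div, mul_zero, mul_zero]
      · rw [h0 a h, zero_mul, mul_zero])
    rw [e1, e2, hx, hy, if_pos rfl, h1, Matrix.one_apply_ne, Matrix.one_apply_ne, div_self hp]
    · rw [hs]
      field_simp
      rw [hδdef]
      field_simp
      ring
    · exact fun e => by subst e; omega
    · exact fun e => by subst e; omega

end Stabilizers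

section Pivots

variable {n : ℕ} {F : Type*} [Field F]

/-- A staircase position of `g` at which `exists_stabilizer` yields a stabilizer with non-trivial
character: the rows from the `q`-th on vanish in the columns up to the `i`-th, `g q (i + 1) ≠ 0`,
and the entries of `g` above and to the left do not continue a scalar diagonal. -/
structure IsIrrelevantAt (g : Matrix (Fin n) (Fin n) F) (q' q i i' : Fin n) : Prop where
  succ_row : (q' : ℕ) + 1 = q
  succ_col : (i : ℕ) + 1 = i'
  zero : ∀ r c, q ≤ r → c ≤ i → g r c = 0
  pivot : g q i' ≠ 0
  step : (∃ j, j < i ∧ g q' j ≠ 0) ∨ g q' i ≠ g q i'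

/-- Walking up from the last row of `g`: as long as no position is irrelevant, the pivots form a
diagonal with a constant entry. This diagonal either ends at the first column above the
last rows, where it gives a non-vanishing minor, or it is the main diagonal. -/
theorem exists_isIrrelevantAt [NeZero n] (g : GL (Fin n) F)
    (hΔ : ∀ k, 1 ≤ k → k < n → lowerMinor k g.1 = 0)
    (hU : ¬ ∃ (z : Fˣ) (u : unipotent n F), g = GeneralLinearGroup.scalar (Fin n) z * u) :
    ∃ q' q i i', IsIrrelevantAt g.1 q' q i i' := by
  by_contra hcon
  push Not at hcon
  have hn : 0 < n := Nat.pos_of_ne_zero (NeZero.ne n)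
  let l : Fin n := ⟨n - 1, by omega⟩
  obtain ⟨k₀, hk₀, hmin⟩ : ∃ k₀, g.1 l k₀ ≠ 0 ∧ ∀ c, c < k₀ → g.1 l c = 0 := by
    have hex : ∃ c, g.1 l c ≠ 0 := by
      by_contra h
      push Not at h
      have hdet : IsUnit g.1.det := (Matrix.isUnit_iff_isUnit_det _).mp g.isUnit
      rw [Matrix.det_eq_zero_of_row_eq_zero l h] at hdet
      exact not_isUnit_zero hdet
    have hwf := (wellFounded_lt (α := Fin n)).has_min {c | g.1 l c ≠ 0} hex
    obtain ⟨k₀, h1, h2⟩ := hwf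
    exact ⟨k₀, h1, fun c hc => by
      by_contra h
      exact h2 c h hc⟩
  set z := g.1 l k₀ with hz
  have key : ∀ t : ℕ, t ≤ k₀ → ∀ r : Fin n, n ≤ (r : ℕ) + t + 1 → ∀ c : Fin n,
      ((c : ℕ) + n < k₀ + r + 1 → g.1 r c = 0) ∧ ((c : ℕ) + n = k₀ + r + 1 → g.1 r c = z) := by
    intro t
    induction t with
    | zero =>
      intro _ r hr c
      have hrl : r = l := Fin.ext (show (r : ℕ) = n - 1 by omega)
      subst hrl
      have hl : (l : ℕ) = n - 1 := rfl
      refine ⟨fun h => hmin c (by rw [Fin.lt_def]; omega), fun h => ?_⟩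
      rw [hz, show c = k₀ from Fin.ext (by omega)]
    | succ t ih =>
      intro ht r hr c
      have ih := ih (by omega)
      rcases Nat.lt_or_ge (r + t + 1) n with hr' | hr'
      · let q : Fin n := ⟨r + 1, by omega⟩
        let i' : Fin n := ⟨k₀ - t, by omega⟩
        let i : Fin n := ⟨k₀ - t - 1, by omega⟩
        have hq : (q : ℕ) = r + 1 := rfl
        have hi : (i : ℕ) = k₀ - t - 1 := rfl
        have hi' : (i' : ℕ) = k₀ - t := rfl
        have hpiv : g.1 q i' = z := (ih q (by omega) i').2 (by omega)
        have h := hcon r q i i'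
        have h1 : (∀ j, j < i → g.1 r j = 0) ∧ g.1 r i = g.1 q i' := by
          by_contra h2
          refine h ⟨by omega, by omega, fun r' c' hr' hc' => ?_, by rw [hpiv]; exact hk₀, ?_⟩
          · rw [Fin.le_def] at hr' hc'
            exact (ih r' (by omega) c').1 (by omega)
          · by_contra h3
            push Not at h3
            exact h2 h3
        refine ⟨fun hc => h1.1 c (by rw [Fin.lt_def]; omega), fun hc => ?_⟩
        rw [show c = i from Fin.ext (by omega), h1.2, hpiv]
      · exact ih r (by omega) c
  have hkey := key k₀ le_rfl
  rcases Nat.lt_or_ge (k₀ + 1) n with hk | hk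
  · refine lowerMinor_ne_zero (fun v hv hrow => ?_) (hΔ (k₀ + 1) (by omega) hk)
    have hback : ∀ d : ℕ, ∀ c : Fin n, (c : ℕ) + d = k₀ → v c = 0 := by
      intro d
      induction d using Nat.strong_induction_on with
      | _ d ih =>
        intro c hc
        let r : Fin n := ⟨c + n - (k₀ + 1), by omega⟩
        have hr : (r : ℕ) = c + n - (k₀ + 1) := rfl
        have h1 := hrow r (by omega)
        rw [Finset.sum_eq_single c] at h1
        · rw [(hkey r (by omega) c).2 (by omega)] at h1
          exact (mul_eq_zero.mp h1).resolve_left hk₀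
        · intro c' _ hc'
          rcases lt_or_gt_of_ne hc' with h2 | h2
          · rw [Fin.lt_def] at h2
            rw [(hkey r (by omega) c').1 (by omega), zero_mul]
          · rw [Fin.lt_def] at h2
            rcases Nat.lt_or_ge (c' : ℕ) (k₀ + 1) with h3 | h3
            · rw [ih (k₀ - c') (by omega) c' (by omega), mul_zero]
            · rw [hv c' h3, mul_zero]
        · simp
    funext c
    rcases Nat.lt_or_ge (c : ℕ) (k₀ + 1) with h3 | h3
    · exact hback (k₀ - c) c (by omega)
    · exact hv c h3
  · have hk : (k₀ : ℕ) + 1 = n := by omega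
    let z' : Fˣ := Units.mk0 z hk₀
    refine hU ⟨z', toUnipotent (Matrix.of fun a b => z⁻¹ * g.1 a b) (fun a => ?_)
      (fun a b hab => ?_), ?_⟩
    · rw [Matrix.of_apply, (hkey a (by omega) a).2 (by omega), inv_mul_cancel₀ hk₀]
    · rw [Fin.lt_def] at hab
      rw [Matrix.of_apply, (hkey a (by omega) b).1 (by omega), mul_zero]
    · apply Units.ext
      ext a b
      rw [scalar_mul_apply]
      exact (mul_inv_cancel_left₀ hk₀ _).symm

end Pivots

section LocalStabilizers

variable {n : ℕ} {F : Type*} [Field F] [ValuativeRel F] [TopologicalSpace F]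
  [IsNonarchimedeanLocalField F] {ψ : AddChar F Circle}

theorem exists_eventually_entry_le {X : Type*} [TopologicalSpace X] {x : X}
    {h : X → Matrix (Fin n) (Fin n) F} (hh : ∀ a b, ContinuousAt (fun y => h y a b) x) :
    ∃ m : ℕ, ∀ᶠ y in 𝓝 x, ∀ a b, valuation F (h y a b) ≤ (uniformizer F)⁻¹ ^ m := by
  obtain ⟨γ, -, hγ⟩ := exists_valuation_le_of_continuousOn (F := F)
    (isCompact_univ : IsCompact (Set.univ : Set (Fin n × Fin n)))
    (h := fun p => h x p.1 p.2) continuous_of_discreteTopology.continuousOn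
  obtain ⟨m, hm⟩ := exists_le_uniformizer_inv_pow γ
  refine ⟨m, eventually_all.mpr fun a => eventually_all.mpr fun b => ?_⟩
  exact (hh a b).eventually ((isOpen_ball
    (pow_ne_zero m (inv_ne_zero uniformizer_ne_zero))).mem_nhds ((hγ (a, b) trivial).trans hm))

/-- The stabilizing pairs of `exists_stabilizer` are locally bounded if `ξ` is continuous. -/
theorem eventually_exists_stabilizer (hψ' : ψ ≠ 1) (g : GL (Fin n) F) {q' q i i' : Fin n}
    (hq : (q' : ℕ) + 1 = q) (hi : (i : ℕ) + 1 = i') (hp : g.1 q i' ≠ 0)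
    (ξ : GL (Fin n) F → Fin n → F) (hξ : ∀ c, ContinuousAt (fun g => ξ g c) g)
    (h1 : ∀ g, ξ g i = 1) (h0 : ∀ g c, i < c → ξ g c = 0)
    (hδ : 1 - (g.1 *ᵥ ξ g) q' / g.1 q i' ≠ 0) :
    ∃ m, ∀ᶠ g' : GL (Fin n) F in 𝓝 g, (∀ r c, q ≤ r → c ≤ i → g'.1 r c = 0) →
      ∃ x ∈ unipotentBall n F m, ∃ y ∈ unipotentBall n F m,
        x * g' * y = g' ∧ genericChar ψ x * genericChar ψ y ≠ 1 := by
  obtain ⟨s₀, hs₀⟩ := (AddChar.ne_one_iff).mp hψ'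
  have hcp : ContinuousAt (fun g : GL (Fin n) F => g.1 q i') g :=
    (continuous_entry q i').continuousAt
  have hcw : ∀ a, ContinuousAt (fun g : GL (Fin n) F => (g.1 *ᵥ ξ g) a) g := by
    intro a
    simp only [Matrix.mulVec, dotProduct]
    exact tendsto_finsetSum _ fun c _ => (continuous_entry a c).continuousAt.mul (hξ c)
  have hcδ : ContinuousAt (fun g : GL (Fin n) F => 1 - (g.1 *ᵥ ξ g) q' / g.1 q i') g :=
    continuousAt_const.sub ((hcw q').div₀ hcp hp)
  have hcs : ContinuousAt (fun g : GL (Fin n) F =>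
      s₀ / (1 - (g.1 *ᵥ ξ g) q' / g.1 q i')) g := continuousAt_const.div₀ hcδ hδ
  obtain ⟨m1, hm1⟩ := exists_eventually_entry_le (x := g)
    (h := fun g : GL (Fin n) F => Matrix.of fun a b => (1 : Matrix (Fin n) (Fin n) F) a b -
      s₀ / (1 - (g.1 *ᵥ ξ g) q' / g.1 q i') / g.1 q i' * (g.1 *ᵥ ξ g) a * if b = q then 1 else 0)
    fun a b => continuousAt_const.sub
      (((hcs.div₀ hcp hp).mul (hcw a)).mul continuousAt_const)
  obtain ⟨m2, hm2⟩ := exists_eventually_entry_le (x := g)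
    (h := fun g : GL (Fin n) F => Matrix.of fun a b => (1 : Matrix (Fin n) (Fin n) F) a b +
      s₀ / (1 - (g.1 *ᵥ ξ g) q' / g.1 q i') * ξ g a * (g.1 q b / g.1 q i'))
    fun a b => continuousAt_const.add
      ((hcs.mul (hξ a)).mul ((continuous_entry q b).continuousAt.div₀ hcp hp))
  refine ⟨max m1 m2, ?_⟩
  filter_upwards [hm1, hm2, hcp.eventually_ne hp, hcδ.eventually_ne hδ] with g' hm1 hm2 hp' hδ' hz
  obtain ⟨x, y, hxy, hχ, hx, hy⟩ := exists_stabilizer ψ g' hq hi hz hp' (ξ g') (h1 g') (h0 g')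
    s₀ hδ'
  refine ⟨x, ?_, y, ?_, hxy, by rw [hχ]; exact hs₀⟩
  · exact unipotentBall_mono (le_max_left _ _) (mem_unipotentBall_of_entry_le le_rfl fun a b => by
      rw [hx]; exact hm1 a b)
  · exact unipotentBall_mono (le_max_right _ _) (mem_unipotentBall_of_entry_le le_rfl fun a b => by
      rw [hy]; exact hm2 a b)

theorem IsIrrelevantAt.eventually_exists_stabilizer (hψ' : ψ ≠ 1) {g : GL (Fin n) F}
    {q' q i i' : Fin n} (h : IsIrrelevantAt g.1 q' q i i') :
    ∃ m, ∀ᶠ g' : GL (Fin n) F in 𝓝 g, (∀ r c, q ≤ r → c ≤ i → g'.1 r c = 0) →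
      ∃ x ∈ unipotentBall n F m, ∃ y ∈ unipotentBall n F m,
        x * g' * y = g' ∧ genericChar ψ x * genericChar ψ y ≠ 1 := by
  rcases h.step with ⟨j, hj, hne⟩ | hne
  · -- a column operation with the `j`-th column clears the entry at `(q - 1, i)`
    refine PartialBessel.eventually_exists_stabilizer hψ' g h.succ_row h.succ_col h.pivot
      (fun g c => (if c = i then 1 else 0) - g.1 q' i / g.1 q' j * if c = j then 1 else 0)
      (fun c => continuousAt_const.sub (((continuous_entry q' i).continuousAt.div₀
        (continuous_entry q' j).continuousAt hne).mul continuousAt_const))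
      (fun g => by simp [hj.ne']) (fun g c hc => by simp [hc.ne', (hj.trans hc).ne']) ?_
    have : (g.1 *ᵥ fun c => (if c = i then 1 else 0) -
        g.1 q' i / g.1 q' j * if c = j then 1 else 0) q' = 0 := by
      simp [Matrix.mulVec, dotProduct, mul_sub, Finset.sum_sub_distrib]
      field_simp
      ring
    rw [this]
    simp
  · refine PartialBessel.eventually_exists_stabilizer hψ' g h.succ_row h.succ_col h.pivot
      (fun g c => if c = i then 1 else 0) (fun c => continuousAt_const)
      (fun g => by simp) (fun g c hc => by simp [hc.ne']) ?_
    have : (g.1 *ᵥ fun c => if c = i then 1 else 0) q' = g.1 q' i := by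
      simp [Matrix.mulVec, dotProduct]
    rw [this, sub_ne_zero]
    intro e
    exact hne ((div_eq_one_iff_eq h.pivot).mp e.symm)

end LocalStabilizers

/-! ### Removing the support outside of the open sets of non-vanishing minors -/

section Corners

variable {n : ℕ} {F : Type*} [Field F]

open Classical in
/-- The positions `(r, c)` such that all entries of `g` weakly below and to the left of `(r, c)`
vanish. These invariants of the double coset `U g U` are the strata of the induction. -/
noncomputable def zeroCorners (g : Matrix (Fin n) (Fin n) F) : Finset (Fin n × Fin n) :=
  Finset.univ.filter fun p => ∀ r c, p.1 ≤ r → c ≤ p.2 → g r c = 0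

theorem mem_zeroCorners {g : Matrix (Fin n) (Fin n) F} {p : Fin n × Fin n} :
    p ∈ zeroCorners g ↔ ∀ r c, p.1 ≤ r → c ≤ p.2 → g r c = 0 := by
  simp [zeroCorners]

theorem zeroCorners_subset_mul (x y : unipotent n F) (g : GL (Fin n) F) :
    zeroCorners g.1 ⊆ zeroCorners (x * g * y : GL (Fin n) F).1 := by
  intro p hp
  rw [mem_zeroCorners] at hp ⊢
  intro r c hr hc
  rw [Units.val_mul, Matrix.mul_apply]
  refine Finset.sum_eq_zero fun b _ => ?_
  rw [Units.val_mul, Matrix.mul_apply, Finset.sum_mul]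
  refine Finset.sum_eq_zero fun a _ => ?_
  rcases lt_or_ge a r with h1 | h1
  · rw [unipotent_lower x h1, zero_mul, zero_mul]
  rcases lt_or_ge c b with h2 | h2
  · rw [unipotent_lower y h2, mul_zero]
  rw [hp a b (hr.trans h1) (h2.trans hc), mul_zero, zero_mul]

theorem zeroCorners_scalar_mul_subset (z : Fˣ) (g : GL (Fin n) F) :
    zeroCorners (GeneralLinearGroup.scalar (Fin n) z * g).1 ⊆ zeroCorners g.1 := by
  intro p hp
  rw [mem_zeroCorners] at hp ⊢
  intro r c hr hc
  have := hp r c hr hc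
  rw [scalar_mul_apply] at this
  exact (mul_eq_zero.mp this).resolve_left z.ne_zero

variable [ValuativeRel F] [TopologicalSpace F] [IsNonarchimedeanLocalField F]

theorem eventually_zeroCorners_subset (g : GL (Fin n) F) :
    ∀ᶠ g' : GL (Fin n) F in 𝓝 g, zeroCorners g'.1 ⊆ zeroCorners g.1 := by
  have h : ∀ p : Fin n × Fin n, ∀ᶠ g' : GL (Fin n) F in 𝓝 g,
      p ∈ zeroCorners g'.1 → p ∈ zeroCorners g.1 := by
    intro p
    by_cases hp : p ∈ zeroCorners g.1
    · exact Eventually.of_forall fun _ _ => hp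
    · rw [mem_zeroCorners] at hp
      push Not at hp
      obtain ⟨r, c, hr, hc, hne⟩ := hp
      filter_upwards [(continuous_entry r c).continuousAt.eventually_ne hne] with g' hg' hp'
      exact absurd (mem_zeroCorners.mp hp' r c hr hc) hg'
  filter_upwards [eventually_all.mpr h] with g' hg' p hp
  exact hg' p hp

theorem isClosed_card_zeroCorners (t : ℕ) :
    IsClosed {g : GL (Fin n) F | t ≤ (zeroCorners g.1).card} := by
  rw [← isOpen_compl_iff, isOpen_iff_mem_nhds]
  intro g hg
  filter_upwards [eventually_zeroCorners_subset g] with g' hg'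
  have h1 := Finset.card_le_card hg'
  have h2 : ¬ t ≤ (zeroCorners g.1).card := hg
  exact fun h3 : t ≤ (zeroCorners g'.1).card => h2 (h3.trans h1)

variable {ω : Fˣ →ₜ* ℂˣ} {f : GL (Fin n) F → ℂ} {ψ : AddChar F Circle}
  [MeasurableSpace (unipotent n F)] [BorelSpace (unipotent n F)]
  (μ : Measure (unipotent n F)) [μ.IsHaarMeasure]

/-- One step of the induction: if `f` vanishes on `Z U` and, among the points where all minors
vanish, on those with more than `t` zero corners, then averaging makes it vanish on those with `t`
zero corners. The stabilizers are bounded uniformly on the compact support. -/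
theorem exists_average_vanish_corners [NeZero n] (hψ : Continuous ψ) (hψ' : ψ ≠ 1)
    (hf : IsSmoothCompactModCenter ω Set.univ f)
    (hfU : ∀ z : Fˣ, ∀ u : unipotent n F, f (GeneralLinearGroup.scalar (Fin n) z * u) = 0)
    (t : ℕ) (ht : ∀ g : GL (Fin n) F, (∀ k, 1 ≤ k → k < n → lowerMinor k g.1 = 0) →
      t < (zeroCorners g.1).card → f g = 0) :
    ∃ f' : GL (Fin n) F → ℂ, IsSmoothCompactModCenter ω Set.univ f' ∧
      (∀ z : Fˣ, ∀ u : unipotent n F, f' (GeneralLinearGroup.scalar (Fin n) z * u) = 0) ∧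
      (∀ g : GL (Fin n) F, (∀ k, 1 ≤ k → k < n → lowerMinor k g.1 = 0) →
        t ≤ (zeroCorners g.1).card → f' g = 0) ∧
      ∃ m, ∀ N ≥ m, ∀ a,
        partialBessel μ ψ (cutoff N) f' a = partialBessel μ ψ (cutoff N) f a := by
  obtain ⟨K, hK, hKf, hs⟩ := hf.exists_compact_support
  set Y : Set (GL (Fin n) F) := K ∩ ((⋂ k, ⋂ _ : 1 ≤ k, ⋂ _ : k < n,
    {g : GL (Fin n) F | lowerMinor k g.1 = 0}) ∩
      {g : GL (Fin n) F | t ≤ (zeroCorners g.1).card}) with hY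
  have hYc : IsCompact Y := hK.inter_right
    ((isClosed_iInter fun k => isClosed_iInter fun _ => isClosed_iInter fun _ =>
      isClosed_eq (continuous_lowerMinor k) continuous_const).inter (isClosed_card_zeroCorners t))
  have hmem : ∀ g, g ∈ Y ↔ g ∈ K ∧ (∀ k, 1 ≤ k → k < n → lowerMinor k g.1 = 0) ∧
      t ≤ (zeroCorners g.1).card := by
    intro g
    simp [hY]
  have hcard : ∀ g ∈ Y, (zeroCorners g.1).card = t := by
    intro g hg
    obtain ⟨h1, h2, h3⟩ := (hmem g).mp hg
    by_contra h4
    exact hKf g h1 (ht g h2 (lt_of_le_of_ne h3 (Ne.symm h4)))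
  obtain ⟨m, hm⟩ : ∃ m, ∀ g ∈ Y, ∃ x ∈ unipotentBall n F m, ∃ y ∈ unipotentBall n F m,
      x * g * y = g ∧ genericChar ψ x * genericChar ψ y ≠ 1 := by
    refine hYc.induction_on (p := fun s => ∃ m, ∀ g ∈ s, ∃ x ∈ unipotentBall n F m,
      ∃ y ∈ unipotentBall n F m, x * g * y = g ∧ genericChar ψ x * genericChar ψ y ≠ 1)
      ⟨0, by simp⟩ (fun s s' hss ⟨m, hm⟩ => ⟨m, fun g hg => hm g (hss hg)⟩) ?_ ?_
    · rintro s s' ⟨m, hm⟩ ⟨m', hm'⟩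
      refine ⟨max m m', fun g hg => ?_⟩
      rcases hg with hg | hg
      · obtain ⟨x, hx, y, hy, h⟩ := hm g hg
        exact ⟨x, unipotentBall_mono (le_max_left _ _) hx, y,
          unipotentBall_mono (le_max_left _ _) hy, h⟩
      · obtain ⟨x, hx, y, hy, h⟩ := hm' g hg
        exact ⟨x, unipotentBall_mono (le_max_right _ _) hx, y,
          unipotentBall_mono (le_max_right _ _) hy, h⟩
    · intro g hg
      obtain ⟨h1, h2, h3⟩ := (hmem g).mp hg
      obtain ⟨q', q, i, i', hirr⟩ := exists_isIrrelevantAt g h2 (by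
        rintro ⟨z, u, rfl⟩
        exact hKf _ h1 (hfU z u))
      obtain ⟨m, hm⟩ := hirr.eventually_exists_stabilizer hψ'
      refine ⟨_, inter_mem (mem_nhdsWithin_of_mem_nhds
        (hm.and (eventually_zeroCorners_subset g))) self_mem_nhdsWithin, m, ?_⟩
      rintro g' ⟨⟨h4, h5⟩, h6⟩
      refine h4 ?_
      have h7 : zeroCorners g'.1 = zeroCorners g.1 :=
        Finset.eq_of_subset_of_card_le h5 (by rw [hcard g' h6, hcard g hg])
      have h8 : (q, i) ∈ zeroCorners g'.1 := by
        rw [h7, mem_zeroCorners]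
        exact hirr.zero
      exact mem_zeroCorners.mp h8
  obtain ⟨f', hf', heq, hsupp, -, hB⟩ := exists_average μ hψ hf m
  refine ⟨f', hf', fun z u => ?_, fun g hg hgt => ?_, m, hB⟩
  · by_contra h
    obtain ⟨x, -, y, -, h1⟩ := hsupp _ h
    rw [scalar_mul_mul] at h1
    exact h1 (hfU z (x * u * y))
  · by_contra h
    obtain ⟨x, hx, y, hy, h1⟩ := hsupp g h
    obtain ⟨z, k, hk, e⟩ := hs _ h1
    have hkY : k ∈ Y := by
      refine (hmem k).mpr ⟨hk, fun j hj hjn => ?_, ?_⟩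
      · have h2 : lowerMinor j (x * g * y : GL (Fin n) F).1 = 0 := by
          rw [Units.val_mul, lowerMinor_mul_unipotent, Units.val_mul, lowerMinor_unipotent_mul,
            hg j hj hjn]
        rw [e, lowerMinor_scalar_mul hjn.le] at h2
        exact (mul_eq_zero.mp h2).resolve_left (pow_ne_zero _ z.ne_zero)
      · refine hgt.trans ((Finset.card_le_card (zeroCorners_subset_mul x y g)).trans ?_)
        rw [e]
        exact Finset.card_le_card (zeroCorners_scalar_mul_subset z k)
    obtain ⟨x', hx', y', hy', h2, h3⟩ := hm k hkY
    have h4 : f' k = 0 := by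
      have h5 := heq x' hx' y' hy' k
      rw [h2] at h5
      by_contra h6
      exact h3 (Circle.ext (mul_right_cancel₀ h6 (by rw [← h5, Circle.coe_one, one_mul])))
    have h5 := heq x hx y hy g
    rw [e, hf'.central, h4, mul_zero] at h5
    exact (mul_ne_zero (Circle.coe_ne_zero _) h) h5.symm

/-- If the Whittaker integral of `f` vanishes at the identity, then for large `N` the partial
Bessel integrals of `f` are those of a function supported where some lower left minor does not
vanish. -/
theorem exists_vanish_of_lowerMinor_eq_zero [NeZero n] (hψ : Continuous ψ) (hψ' : ψ ≠ 1)
    (hf : IsSmoothCompactModCenter ω Set.univ f) (hW : whittaker μ ψ f 1 = 0) :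
    ∃ f' : GL (Fin n) F → ℂ, IsSmoothCompactModCenter ω Set.univ f' ∧
      (∀ g : GL (Fin n) F, f' g ≠ 0 → ∃ k, 1 ≤ k ∧ k < n ∧ lowerMinor k g.1 ≠ 0) ∧
      ∃ m, ∀ N ≥ m, ∀ a,
        partialBessel μ ψ (cutoff N) f' a = partialBessel μ ψ (cutoff N) f a := by
  have key : ∀ s : ℕ, ∃ f' : GL (Fin n) F → ℂ, IsSmoothCompactModCenter ω Set.univ f' ∧
      (∀ z : Fˣ, ∀ u : unipotent n F, f' (GeneralLinearGroup.scalar (Fin n) z * u) = 0) ∧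
      (∀ g : GL (Fin n) F, (∀ k, 1 ≤ k → k < n → lowerMinor k g.1 = 0) →
        n * n < (zeroCorners g.1).card + s → f' g = 0) ∧
      ∃ m, ∀ N ≥ m, ∀ a,
        partialBessel μ ψ (cutoff N) f' a = partialBessel μ ψ (cutoff N) f a := by
    intro s
    induction s with
    | zero =>
      obtain ⟨f', h1, h2, h3⟩ := exists_average_vanish_unipotent μ hψ hf hW
      refine ⟨f', h1, h2, fun g _ hg => absurd hg (not_lt.mpr ?_), h3⟩
      have := Finset.card_le_univ (zeroCorners g.1)
      simpa using this
    | succ s ih =>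
      obtain ⟨f', h1, h2, h3, m, hm⟩ := ih
      rcases Nat.lt_or_ge (n * n) s with hs | hs
      · exact ⟨f', h1, h2, fun g hg _ => h3 g hg (by omega), m, hm⟩
      obtain ⟨f'', h1', h2', h3', m', hm'⟩ := exists_average_vanish_corners μ hψ hψ' h1 h2
        (n * n - s) fun g hg hlt => h3 g hg (by omega)
      exact ⟨f'', h1', h2', fun g hg hlt => h3' g hg (by omega), max m m', fun N hN a =>
        (hm' N (le_trans (le_max_right _ _) hN) a).trans
          (hm N (le_trans (le_max_left _ _) hN) a)⟩
  obtain ⟨f', h1, -, h3, h4⟩ := key (n * n + 1)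
  refine ⟨f', h1, fun g hg => ?_, h4⟩
  by_contra h
  push Not at h
  exact hg (h3 g h (by omega))

end Corners

/-! ### Splitting a function along the minors -/

section Splitting

variable {n : ℕ} {F : Type*} [Field F]

theorem det_ne_zero_GL (g : GL (Fin n) F) : g.1.det ≠ 0 :=
  ((Matrix.isUnit_iff_isUnit_det _).mp g.isUnit).ne_zero

variable [ValuativeRel F]

/-- The points where the minor `Δ_k`, normalized to the function `Δ_k^n / det^k` invariant under
the center, has absolute value at least `γ`. -/
def largeMinor (γ : ValueGroupWithZero F) (k : ℕ) : Set (GL (Fin n) F) :=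
  {g | γ ≤ valuation F (lowerMinor k g.1 ^ n / g.1.det ^ k)}

theorem largeMinor_anti {γ γ' : ValueGroupWithZero F} (h : γ ≤ γ') {k : ℕ} {g : GL (Fin n) F}
    (hg : g ∈ largeMinor γ' k) : g ∈ largeMinor γ k :=
  h.trans hg

theorem lowerMinor_ne_zero_of_mem_largeMinor [NeZero n] {γ : ValueGroupWithZero F} (hγ : γ ≠ 0)
    {k : ℕ} {g : GL (Fin n) F} (hg : g ∈ largeMinor γ k) : lowerMinor k g.1 ≠ 0 := by
  intro h0
  have h1 : γ ≤ valuation F (lowerMinor k g.1 ^ n / g.1.det ^ k) := hg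
  rw [h0, zero_pow (NeZero.ne n), zero_div, map_zero, le_zero_iff] at h1
  exact hγ h1

theorem scalar_mul_mem_largeMinor {γ : ValueGroupWithZero F} {k : ℕ} (hk : k ≤ n) (z : Fˣ)
    (g : GL (Fin n) F) :
    GeneralLinearGroup.scalar (Fin n) z * g ∈ largeMinor γ k ↔ g ∈ largeMinor γ k := by
  have h : (GeneralLinearGroup.scalar (Fin n) z * g).1.det = (z : F) ^ n * g.1.det := by
    rw [Units.val_mul, Matrix.det_mul]
    simp
  have h2 : ((z : F) ^ k * lowerMinor k g.1) ^ n / ((z : F) ^ n * g.1.det) ^ k =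
      lowerMinor k g.1 ^ n / g.1.det ^ k := by
    rw [mul_pow, mul_pow, ← pow_mul, ← pow_mul, mul_comm k n,
      mul_div_mul_left _ _ (pow_ne_zero _ z.ne_zero)]
  change γ ≤ _ ↔ γ ≤ _
  rw [lowerMinor_scalar_mul hk, h, h2]

variable [TopologicalSpace F] [IsNonarchimedeanLocalField F] {ω : Fˣ →ₜ* ℂˣ}
  {f : GL (Fin n) F → ℂ}

theorem isClopen_setOf_le_valuation {γ : ValueGroupWithZero F} (hγ : γ ≠ 0) :
    IsClopen {x : F | γ ≤ valuation F x} := by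
  have hb := fun x : F => (IsValuativeTopology.hasBasis_nhds' x).mem_of_mem hγ
  constructor
  · rw [← isOpen_compl_iff, isOpen_iff_mem_nhds]
    intro x hx
    filter_upwards [hb x] with y (hy : valuation F (y - x) < γ)
    have hx' : valuation F x < γ := not_le.mp hx
    refine fun hle : γ ≤ valuation F y => absurd hle (not_le.mpr ?_)
    have := (valuation F).map_add_lt hy hx'
    rwa [sub_add_cancel] at this
  · rw [isOpen_iff_mem_nhds]
    intro x (hx : γ ≤ valuation F x)
    filter_upwards [hb x] with y (hy : valuation F (y - x) < γ)
    by_contra h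
    have hy' : valuation F y < γ := not_le.mp h
    have := (valuation F).map_sub_lt hy' hy
    rw [sub_sub_cancel] at this
    exact absurd hx (not_le.mpr this)

theorem isClopen_largeMinor {γ : ValueGroupWithZero F} (hγ : γ ≠ 0) (k : ℕ) :
    IsClopen (largeMinor γ k : Set (GL (Fin n) F)) :=
  (isClopen_setOf_le_valuation hγ).preimage
    (((continuous_lowerMinor k).pow n).div₀ (Units.continuous_val.matrix_det.pow k)
      fun g => pow_ne_zero k (det_ne_zero_GL g))

/-- A function supported where some minor does not vanish is a sum of functions each supported
where one given minor does not vanish. -/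
theorem exists_split_lowerMinor [NeZero n] (hf : IsSmoothCompactModCenter ω Set.univ f)
    (hsupp : ∀ g : GL (Fin n) F, f g ≠ 0 → ∃ k, 1 ≤ k ∧ k < n ∧ lowerMinor k g.1 ≠ 0) :
    ∃ h : ℕ → GL (Fin n) F → ℂ, (∀ k < n, IsSmoothCompactModCenter ω Set.univ (h k)) ∧
      (∀ k g, h k g ≠ 0 → lowerMinor k g.1 ≠ 0) ∧ f = ∑ k ∈ Finset.Ico 1 n, h k := by
  classical
  obtain ⟨K, hK, hKf, hs⟩ := hf.exists_compact_support
  obtain ⟨γ, hγ, hcov⟩ : ∃ γ : ValueGroupWithZero F, γ ≠ 0 ∧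
      ∀ g ∈ K, ∃ k, 1 ≤ k ∧ k < n ∧ g ∈ largeMinor γ k := by
    refine hK.induction_on (p := fun s => ∃ γ : ValueGroupWithZero F, γ ≠ 0 ∧
      ∀ g ∈ s, ∃ k, 1 ≤ k ∧ k < n ∧ g ∈ largeMinor γ k) ⟨1, one_ne_zero, by simp⟩
      (fun s s' hss ⟨γ, hγ, h⟩ => ⟨γ, hγ, fun g hg => h g (hss hg)⟩) ?_ ?_
    · rintro s s' ⟨γ, hγ, h⟩ ⟨γ', hγ', h'⟩
      refine ⟨min γ γ', by rcases min_choice γ γ' with e | e <;> rw [e] <;> assumption, ?_⟩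
      rintro g (hg | hg)
      · obtain ⟨k, h1, h2, h3⟩ := h g hg
        exact ⟨k, h1, h2, largeMinor_anti (min_le_left _ _) h3⟩
      · obtain ⟨k, h1, h2, h3⟩ := h' g hg
        exact ⟨k, h1, h2, largeMinor_anti (min_le_right _ _) h3⟩
    · intro g hg
      obtain ⟨k, h1, h2, h3⟩ := hsupp g (hKf g hg)
      have hγ : valuation F (lowerMinor k g.1 ^ n / g.1.det ^ k) ≠ 0 := by
        rw [Valuation.ne_zero_iff]
        exact div_ne_zero (pow_ne_zero _ h3) (pow_ne_zero _ (det_ne_zero_GL g))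
      exact ⟨_, mem_nhdsWithin_of_mem_nhds ((isClopen_largeMinor hγ k).isOpen.mem_nhds
        (le_refl (valuation F (lowerMinor k g.1 ^ n / g.1.det ^ k)))), _, hγ,
        fun g' hg' => ⟨k, h1, h2, hg'⟩⟩
  have hcov' : ∀ g, f g ≠ 0 → ∃ k, 1 ≤ k ∧ k < n ∧ g ∈ largeMinor γ k := by
    intro g hg
    obtain ⟨z, κ, hκ, rfl⟩ := hs g hg
    obtain ⟨k, h1, h2, h3⟩ := hcov κ hκ
    exact ⟨k, h1, h2, (scalar_mul_mem_largeMinor h2.le z κ).mpr h3⟩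
  -- the points for which `k` is the first index with a large minor
  let E : ℕ → Set (GL (Fin n) F) := fun k =>
    largeMinor γ k ∩ ⋂ j ∈ Finset.Ico 1 k, (largeMinor γ j)ᶜ
  have hE : ∀ k, IsClopen (E k) := fun k => (isClopen_largeMinor hγ k).inter
    (isClopen_biInter_finset fun j _ => (isClopen_largeMinor hγ j).compl)
  have hmemE : ∀ k g, g ∈ E k ↔ g ∈ largeMinor γ k ∧ ∀ j, 1 ≤ j → j < k → g ∉ largeMinor γ j := by
    intro k g
    simp [E]
  refine ⟨fun k g => if g ∈ E k then f g else 0, fun k hk => ?_, fun k g hg => ?_, ?_⟩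
  · refine ⟨?_, fun z g => ?_, ?_⟩
    · rw [IsLocallyConstant.iff_eventually_eq]
      intro g
      by_cases hg : g ∈ E k
      · filter_upwards [(hE k).isOpen.mem_nhds hg, hf.smooth.eventually_eq g] with g' h1 h2
        rw [if_pos h1, if_pos hg, h2]
      · filter_upwards [(hE k).compl.isOpen.mem_nhds hg] with g' h1
        rw [if_neg h1, if_neg hg]
    · have : GeneralLinearGroup.scalar (Fin n) z * g ∈ E k ↔ g ∈ E k := by
        rw [hmemE, hmemE, scalar_mul_mem_largeMinor hk.le]
        refine and_congr_right fun _ => forall_congr' fun j => forall_congr' fun _ =>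
          forall_congr' fun hj => ?_
        rw [scalar_mul_mem_largeMinor (hj.le.trans hk.le)]
      simp only [this]
      split_ifs
      · exact hf.central z g
      · rw [mul_zero]
    · obtain ⟨K, hK, hKΩ, hs⟩ := hf.support
      exact ⟨K, hK, hKΩ, fun g hg => hs g fun h0 => hg (by simp [h0])⟩
  · have h1 : g ∈ E k := by
      by_contra h
      exact hg (if_neg h)
    exact lowerMinor_ne_zero_of_mem_largeMinor hγ ((hmemE k g).mp h1).1
  · funext g
    rw [Finset.sum_apply]
    by_cases hg : f g = 0
    · rw [hg, Finset.sum_eq_zero]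
      intro k _
      exact ite_self 0
    · have hex := hcov' g hg
      have hk := Nat.find_spec hex
      have hmin := fun j => Nat.find_min hex (m := j)
      set k := Nat.find hex
      rw [Finset.sum_eq_single k]
      · rw [if_pos]
        rw [hmemE]
        exact ⟨hk.2.2, fun j h1 h2 h3 => hmin j h2 ⟨h1, h2.trans hk.2.1, h3⟩⟩
      · intro j hj hjk
        rw [Finset.mem_Ico] at hj
        rw [if_neg]
        intro hjE
        obtain ⟨h1, h2⟩ := (hmemE j g).mp hjE
        rcases lt_or_gt_of_ne hjk with h | h
        · exact hmin j h ⟨hj.1, hj.2, h1⟩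
        · exact h2 k hk.1 h hk.2.2
      · intro h
        exact absurd (Finset.mem_Ico.mpr ⟨hk.1, hk.2.1⟩) h

end Splitting

/-! ### Bruhat cells -/

section Bruhat

variable {n : ℕ} {F : Type*} [Field F]

theorem weylMatrix_mul_diag_apply (w : Equiv.Perm (Fin n)) (a : Torus n F) (i j : Fin n) :
    (weylMatrix F w * (diag a).1) i j = if i = w j then (a j : F) else 0 := by
  simp [weylMatrix, diag, Matrix.mul_diagonal]

theorem bruhat_apply (u₁ u₂ : unipotent n F) (w : Equiv.Perm (Fin n)) (a : Torus n F)
    (r t : Fin n) : (u₁.1.1 * weylMatrix F w * (diag a).1 * u₂.1.1) r t =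
      ∑ i, u₁.1.1 r (w i) * a i * u₂.1.1 i t := by
  rw [Matrix.mul_apply]
  refine Finset.sum_congr rfl fun i _ => ?_
  rw [Matrix.mul_assoc, Matrix.mul_apply, Finset.sum_eq_single (w i)]
  · rw [weylMatrix_mul_diag_apply, if_pos rfl]
  · intro b _ hb
    rw [weylMatrix_mul_diag_apply, if_neg hb, mul_zero]
  · simp

/-- The permutation matrix of `w`, as an element of `GL_n(F)`. -/
def weylRep (w : Equiv.Perm (Fin n)) : GL (Fin n) F where
  val := weylMatrix F w
  inv := weylMatrix F w⁻¹
  val_inv := by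
    ext i j
    rw [Matrix.mul_apply, Finset.sum_eq_single (w⁻¹ i)]
    · simp [weylMatrix, Matrix.one_apply]
    · intro b _ hb
      rw [weylMatrix, Matrix.of_apply, if_neg, zero_mul]
      exact fun e => hb (by simp [e])
    · simp
  inv_val := by
    ext i j
    rw [Matrix.mul_apply, Finset.sum_eq_single (w i)]
    · simp [weylMatrix, Matrix.one_apply]
    · intro b _ hb
      rw [weylMatrix, Matrix.of_apply, if_neg, zero_mul]
      exact fun e => hb (by simp [e])
    · simp

theorem diag_one : (diag (1 : Torus n F)).1 = 1 := by
  simp [diag]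

theorem diag_mul (a b : Torus n F) : diag (a * b) = diag a * diag b := by
  apply Units.ext
  simp [diag, Matrix.diagonal_mul_diagonal]

theorem weylRep_mem_bruhatCell (w : Equiv.Perm (Fin n)) : weylRep w ∈ bruhatCell F w :=
  ⟨1, one_mem _, 1, 1, one_mem _, by simp [diag_one, weylRep]⟩

theorem exists_unipotent_mul_diag (u : unipotent n F) (a : Torus n F) :
    ∃ u' : unipotent n F, u * diag a = diag a * u' := by
  refine ⟨toUnipotent (Matrix.of fun i j => ((a i)⁻¹ : F) * u.1.1 i j * a j) (fun i => ?_)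
    (fun i j hij => ?_), ?_⟩
  · simp [unipotent_diag]
  · simp [unipotent_lower u hij]
  · apply Units.ext
    ext i j
    simp [diag, toUnipotent, Matrix.mul_diagonal, Matrix.diagonal_mul, ← mul_assoc]

theorem mul_mem_bruhatCell {w : Equiv.Perm (Fin n)} {g : GL (Fin n) F} (hg : g ∈ bruhatCell F w)
    (u v : unipotent n F) (a : Torus n F) : u * g * diag a * v ∈ bruhatCell F w := by
  obtain ⟨u₁, hu₁, b, u₂, hu₂, e⟩ := hg
  obtain ⟨u', hu'⟩ := exists_unipotent_mul_diag ⟨u₂, hu₂⟩ a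
  refine ⟨u * u₁, mul_mem u.2 hu₁, b * a, u' * v, mul_mem u'.2 v.2, ?_⟩
  have hu'' := congrArg Units.val hu'
  simp only [Units.val_mul] at hu''
  simp only [Units.val_mul, diag_mul, e, Matrix.mul_assoc]
  rw [← Matrix.mul_assoc u₂.1, hu'', Matrix.mul_assoc]

/-- The matrix `1 + t E_{i,j}` in `GL_n(F)`. -/
def transvectionGL (i j : Fin n) (hij : i ≠ j) (t : F) : GL (Fin n) F where
  val := Matrix.transvection i j t
  inv := Matrix.transvection i j (-t)
  val_inv := by rw [Matrix.transvection_mul_transvection_same _ _ hij, add_neg_cancel,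
    Matrix.transvection_zero]
  inv_val := by rw [Matrix.transvection_mul_transvection_same _ _ hij, neg_add_cancel,
    Matrix.transvection_zero]

theorem transvection_apply (i j : Fin n) (t : F) (a b : Fin n) :
    Matrix.transvection i j t a b = (1 : Matrix (Fin n) (Fin n) F) a b +
      if a = i ∧ b = j then t else 0 := by
  rw [Matrix.transvection, Matrix.add_apply, Matrix.single_apply]
  simp only [eq_comm]

/-- Upper triangular elementary matrices as elements of `U`. -/
def unipotentTransvection (i j : Fin n) (hij : i < j) (t : F) : unipotent n F :=
  toUnipotent (Matrix.transvection i j t)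
    (fun a => by
      rw [transvection_apply, if_neg, add_zero, Matrix.one_apply_eq]
      exact fun h => hij.ne (h.1.symm.trans h.2))
    (fun a b hab => by
      rw [transvection_apply, if_neg, add_zero, Matrix.one_apply_ne hab.ne']
      rintro ⟨rfl, rfl⟩
      exact absurd hij hab.asymm)

/-- The identity in `SL_2` behind the Bruhat order: if `w` reverses `i < j`, then the lower
triangular elementary matrices at `(j, i)`, multiplied by the permutation matrix
of `w (i j)`, lie in the larger cell `C(w)`. -/
theorem weylRep_swap_mul_transvection_mem (w : Equiv.Perm (Fin n)) {i j : Fin n} (hij : i < j)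
    (hw : w j < w i) {t : F} (ht : t ≠ 0) :
    weylRep (w * Equiv.swap i j) * transvectionGL j i hij.ne' t ∈ bruhatCell F w := by
  refine ⟨unipotentTransvection (w j) (w i) hw t⁻¹, Subtype.mem _,
    fun b => if b = i then Units.mk0 t ht else if b = j then - (Units.mk0 t ht)⁻¹ else 1,
    unipotentTransvection i j hij t⁻¹, Subtype.mem _, ?_⟩
  ext a b
  have hsum : ∀ (X : Fin n → F) (p q : Fin n) (s : F),
      ∑ c, X c * Matrix.transvection p q s c b = X b + if b = q then X p * s else 0 := by
    intro X p q s
    simp only [transvection_apply, mul_add, Finset.sum_add_distrib]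
    congr 1
    · simp [Matrix.one_apply]
    · split_ifs with h <;> simp [h]
  have hL := hsum (fun c => weylMatrix F (w * Equiv.swap i j) a c) j i t
  have hR := hsum (fun c => Matrix.transvection (w j) (w i) t⁻¹ a (w c) *
    (if c = i then Units.mk0 t ht else if c = j then - (Units.mk0 t ht)⁻¹ else 1 : Fˣ)) i j t⁻¹
  rw [bruhat_apply, Units.val_mul, Matrix.mul_apply]
  refine hL.trans (Eq.trans ?_ hR.symm)
  have hne : i ≠ j := hij.ne
  have hwne : w i ≠ w j := hw.ne'
  simp only [transvection_apply, weylMatrix, Matrix.of_apply, Equiv.Perm.mul_apply,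
    Matrix.one_apply, EmbeddingLike.apply_eq_iff_eq, Equiv.swap_apply_right]
  by_cases hbi : b = i
  · subst hbi
    simp only [Equiv.swap_apply_left, if_true, if_neg hne, and_true]
    by_cases h1 : a = w j <;> by_cases h2 : a = w b <;>
      simp_all
  · by_cases hbj : b = j
    · subst hbj
      simp only [Equiv.swap_apply_right, if_neg hbi, if_true, and_true]
      by_cases h1 : a = w i <;> by_cases h2 : a = w b <;>
        simp_all
    · simp [Equiv.swap_apply_of_ne_of_ne hbi hbj, hbi, hbj]

end Bruhat

/-! ### The Bruhat decomposition and the Bruhat order -/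

section BruhatDecomposition

variable {n : ℕ} {F : Type*} [Field F]

/-- One step of the elimination: if the rows below the `r`-th are monomial, with their pivots
isolated in their columns, the same can be reached for the `r`-th row. -/
theorem exists_eliminate_row (h : GL (Fin n) F) (r : Fin n)
    (hr : ∀ a, r < a → ∃ c, h.1 a c ≠ 0 ∧ (∀ c', c' ≠ c → h.1 a c' = 0) ∧
      ∀ a', a' ≠ a → h.1 a' c = 0) :
    ∃ x y : unipotent n F, ∀ a, r ≤ a → ∃ c, (x * h * y : GL (Fin n) F).1 a c ≠ 0 ∧
      (∀ c', c' ≠ c → (x * h * y : GL (Fin n) F).1 a c' = 0) ∧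
        ∀ a', a' ≠ a → (x * h * y : GL (Fin n) F).1 a' c = 0 := by
  obtain ⟨c, hc, hmin⟩ : ∃ c, h.1 r c ≠ 0 ∧ ∀ c', c' < c → h.1 r c' = 0 := by
    have hex : ∃ c, h.1 r c ≠ 0 := by
      by_contra h0
      push Not at h0
      exact det_ne_zero_GL h (Matrix.det_eq_zero_of_row_eq_zero r h0)
    obtain ⟨c, h1, h2⟩ := (wellFounded_lt (α := Fin n)).has_min {c | h.1 r c ≠ 0} hex
    exact ⟨c, h1, fun c' hc' => by
      by_contra h0
      exact h2 c' h0 hc'⟩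
  -- `y` clears the `r`-th row to the right of its pivot, `x` the column above it
  let η : Fin n → F := fun b => if c < b then -h.1 r b / h.1 r c else 0
  let ζ : Fin n → F := fun a => if a < r then -h.1 a c / h.1 r c else 0
  let y : unipotent n F := toUnipotent (Matrix.of fun a b => (1 : Matrix (Fin n) (Fin n) F) a b +
      if a = c then η b else 0)
    (fun a => by
      rw [Matrix.of_apply, Matrix.one_apply_eq]
      split_ifs with e
      · simp [η, e]
      · simp)
    (fun a b hab => by
      rw [Matrix.of_apply, Matrix.one_apply_ne hab.ne']
      split_ifs with e
      · subst e
        simp [η, hab.not_gt]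
      · simp)
  let x : unipotent n F := toUnipotent (Matrix.of fun a b => (1 : Matrix (Fin n) (Fin n) F) a b +
      if b = r then ζ a else 0)
    (fun a => by
      rw [Matrix.of_apply, Matrix.one_apply_eq]
      split_ifs with e
      · simp [ζ, e]
      · simp)
    (fun a b hab => by
      rw [Matrix.of_apply, Matrix.one_apply_ne hab.ne']
      split_ifs with e
      · subst e
        simp [ζ, hab.not_gt]
      · simp)
  have hy : ∀ a b, (h.1 * y.1.1) a b = h.1 a b + h.1 a c * η b := by
    intro a b
    rw [Matrix.mul_apply]
    change ∑ l, h.1 a l * ((1 : Matrix (Fin n) (Fin n) F) l b + if l = c then η b else 0) = _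
    simp [mul_add, Finset.sum_add_distrib, Matrix.one_apply]
  have hyr : ∀ b, (h.1 * y.1.1) r b = if b = c then h.1 r c else 0 := by
    intro b
    rw [hy]
    rcases lt_trichotomy b c with hb | hb | hb
    · rw [hmin b hb, if_neg hb.ne]
      simp [η, hb.not_gt]
    · subst hb
      simp [η]
    · rw [if_neg hb.ne']
      simp only [η, if_pos hb]
      field_simp
      ring
  have hxy : ∀ a b, (x * h * y : GL (Fin n) F).1 a b =
      h.1 a b + h.1 a c * η b + ζ a * if b = c then h.1 r c else 0 := by
    intro a b
    rw [mul_assoc, Units.val_mul, Units.val_mul, Matrix.mul_apply]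
    change ∑ l, ((1 : Matrix (Fin n) (Fin n) F) a l + if l = r then ζ a else 0) *
      (h.1 * y.1.1) l b = _
    rw [← hyr, ← hy]
    simp [add_mul, Finset.sum_add_distrib, Matrix.one_apply]
  have hηc : η c = 0 := by simp [η]
  have hζ : ∀ a, r ≤ a → ζ a = 0 := fun a ha => by simp [ζ, ha.not_gt]
  -- the pivot of a lower row is not in the `c`-th column
  have hlow : ∀ a, r < a → h.1 a c = 0 := by
    intro a ha
    obtain ⟨ca, h1, h2, h3⟩ := hr a ha
    refine h2 c ?_
    rintro rfl
    exact hc (h3 r ha.ne)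
  refine ⟨x, y, fun a ha => ?_⟩
  rcases ha.eq_or_lt with rfl | ha
  · refine ⟨c, ?_, fun c' hc' => ?_, fun a' ha' => ?_⟩
    · rw [hxy, hηc, hζ r le_rfl]
      simpa using hc
    · rw [hxy, hζ r le_rfl, ← hy, hyr, if_neg hc', zero_mul, add_zero]
    · rw [hxy, hηc, if_pos rfl]
      rcases lt_or_gt_of_ne ha' with h1 | h1
      · simp only [ζ, if_pos h1]
        field_simp
        ring
      · rw [hlow a' h1, hζ a' h1.le]
        ring
  · obtain ⟨ca, h1, h2, h3⟩ := hr a ha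
    have hrow : ∀ b, (x * h * y : GL (Fin n) F).1 a b = h.1 a b := by
      intro b
      rw [hxy, hlow a ha, hζ a ha.le]
      ring
    have hcac : ca ≠ c := by
      rintro rfl
      exact hc (h3 r ha.ne)
    have hηca : η ca = 0 := by simp [η, h3 r ha.ne]
    refine ⟨ca, by rwa [hrow], fun c' hc' => by rw [hrow]; exact h2 c' hc', fun a' ha' => ?_⟩
    rw [hxy, h3 a' ha', hηca, if_neg hcac]
    ring

/-- The Bruhat decomposition: every element of `GL_n(F)` lies in some cell `C(w)`. -/
theorem exists_mem_bruhatCell (g : GL (Fin n) F) : ∃ w, g ∈ bruhatCell F w := by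
  have key : ∀ t : ℕ, ∃ x y : unipotent n F, ∀ a : Fin n, n ≤ (a : ℕ) + t →
      ∃ c, (x * g * y : GL (Fin n) F).1 a c ≠ 0 ∧
        (∀ c', c' ≠ c → (x * g * y : GL (Fin n) F).1 a c' = 0) ∧
          ∀ a', a' ≠ a → (x * g * y : GL (Fin n) F).1 a' c = 0 := by
    intro t
    induction t with
    | zero => exact ⟨1, 1, fun a ha => absurd a.2 (by omega)⟩
    | succ t ih =>
      obtain ⟨x, y, h⟩ := ih
      rcases Nat.lt_or_ge t n with ht | ht
      · let r : Fin n := ⟨n - (t + 1), by omega⟩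
        have hr : (r : ℕ) = n - (t + 1) := rfl
        obtain ⟨x', y', h'⟩ := exists_eliminate_row (x * g * y : GL (Fin n) F) r
          fun a ha => h a (by rw [Fin.lt_def] at ha; omega)
        refine ⟨x' * x, y * y', fun a ha => ?_⟩
        have e : ((x' * x : unipotent n F) * g * (y * y' : unipotent n F) : GL (Fin n) F) =
            x' * (x * g * y) * y' := by
          simp only [Subgroup.coe_mul, mul_assoc]
        rw [e]
        exact h' a (by rw [Fin.le_def]; omega)
      · exact ⟨x, y, fun a _ => h a (by omega)⟩
  obtain ⟨x, y, h⟩ := key n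
  choose σ h1 h2 h3 using fun a => h a (by omega)
  have hinj : Function.Injective σ := by
    intro a b hab
    by_contra hne
    exact h1 a (by rw [hab]; exact h3 b a hne)
  let e : Equiv.Perm (Fin n) := Equiv.ofBijective σ (Finite.injective_iff_bijective.mp hinj)
  have he : ∀ a, e a = σ a := fun a => rfl
  refine ⟨e⁻¹, x⁻¹, inv_mem x.2, fun c => Units.mk0 ((x * g * y : GL (Fin n) F).1 (e⁻¹ c) c) ?_,
    y⁻¹, inv_mem y.2, ?_⟩
  · have := h1 (e⁻¹ c)
    rwa [← he, show e (e⁻¹ c) = c by simp] at this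
  · have hD : weylMatrix F e⁻¹ * (diag fun c => Units.mk0 ((x * g * y : GL (Fin n) F).1 (e⁻¹ c) c)
        (by have := h1 (e⁻¹ c); rwa [← he, show e (e⁻¹ c) = c by simp] at this)).1 =
        (x * g * y : GL (Fin n) F).1 := by
      ext a c
      rw [weylMatrix_mul_diag_apply]
      split_ifs with hac
      · rw [hac]; rfl
      · symm
        refine h2 a c ?_
        rintro rfl
        exact hac (by rw [← he]; simp)
    refine Eq.trans ?_ (congrArg (fun M => (x⁻¹).1.1 * M * (y⁻¹).1.1) hD.symm |>.trans ?_)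
    · have e2 : g = (x⁻¹).1 * (x * g * y) * (y⁻¹).1 := by
        rw [Subgroup.coe_inv, Subgroup.coe_inv]
        group
      exact congrArg Units.val e2
    · simp only [Matrix.mul_assoc]
      rfl

end BruhatDecomposition

theorem BruhatLE.trans {n : ℕ} {F : Type*} [Field F] [TopologicalSpace F]
    {w₁ w₂ w₃ : Equiv.Perm (Fin n)} (h : BruhatLE F w₁ w₂)
    (h' : BruhatLE F w₂ w₃) : BruhatLE F w₁ w₃ :=
  Set.Subset.trans h (closure_minimal h' isClosed_closure)

section BruhatOrder

variable {n : ℕ} {F : Type*} [Field F] [ValuativeRel F] [TopologicalSpace F]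
  [IsNonarchimedeanLocalField F]

theorem neBot_nhdsWithin_ne_zero : (𝓝[≠] (0 : F)).NeBot := by
  rw [← mem_closure_iff_nhdsWithin_neBot, mem_closure_iff_nhds]
  intro s hs
  obtain ⟨γ, hγ, hsub⟩ := (IsValuativeTopology.hasBasis_nhds_zero' F).mem_iff.mp hs
  obtain ⟨x, rfl⟩ := ValuativeRel.valuation_surjective γ
  obtain ⟨y, hy0, hy1⟩ := Valuation.IsNontrivial.exists_lt_one (v := valuation F)
  have hx : x ≠ 0 := by simpa using hγ
  have hy : y ≠ 0 := by simpa using hy0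
  refine ⟨x * y, hsub ?_, mul_ne_zero hx hy⟩
  change valuation F (x * y) < valuation F x
  rw [map_mul]
  calc valuation F x * valuation F y < valuation F x * 1 := by
        gcongr
        exact zero_lt_iff.mpr hγ
    _ = _ := mul_one _

theorem continuous_transvectionGL (i j : Fin n) (hij : i ≠ j) :
    Continuous fun t : F => transvectionGL i j hij t := by
  have h : Continuous fun t : F => Matrix.transvection i j t := by
    refine continuous_matrix fun a b => ?_
    simp only [transvection_apply]
    split_ifs <;> fun_prop
  exact Units.continuous_iff.mpr ⟨h, h.comp continuous_neg⟩

/-- Undoing an inversion of `w` gives a smaller element. -/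
theorem bruhatLE_mul_swap (w : Equiv.Perm (Fin n)) {i j : Fin n} (hij : i < j) (hw : w j < w i) :
    BruhatLE F (w * Equiv.swap i j) w := by
  rintro g ⟨u₁, hu₁, a, u₂, hu₂, e⟩
  let φ : F → GL (Fin n) F := fun t =>
    u₁ * (weylRep (w * Equiv.swap i j) * transvectionGL j i hij.ne' t) * diag a * u₂
  have hφ : Continuous φ := by
    have := continuous_transvectionGL (F := F) j i hij.ne'
    fun_prop
  have hφ0 : φ 0 = g := by
    apply Units.ext
    simp only [φ, Units.val_mul, e]
    rw [show (transvectionGL j i hij.ne' (0 : F)).1 = 1 from Matrix.transvection_zero _ _,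
      Matrix.mul_one]
    rfl
  have hlim : Tendsto φ (𝓝[≠] 0) (𝓝 g) := by
    rw [← hφ0]
    exact hφ.continuousAt.tendsto.mono_left nhdsWithin_le_nhds
  have := neBot_nhdsWithin_ne_zero (F := F)
  refine mem_closure_of_tendsto hlim ?_
  filter_upwards [self_mem_nhdsWithin] with t ht
  exact mul_mem_bruhatCell (weylRep_swap_mul_transvection_mem w hij hw ht) ⟨u₁, hu₁⟩ ⟨u₂, hu₂⟩ a

/-- If `C(w)` lies in the closure of `C(w')` and `w`, `w'` agree before `j`, then `w j ≤ w' j`: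
otherwise the minor of `w` in the columns up to `j` and the rows from `w j` on vanishes on `C(w')`
for reasons of rank. -/
theorem BruhatLE.apply_le {w w' : Equiv.Perm (Fin n)} (h : BruhatLE F w w') {j : Fin n}
    (hmin : ∀ i, i < j → w i = w' i) : w j ≤ w' j := by
  by_contra! hlt
  let S := {i : Fin n // i ≤ j ∧ w j ≤ w i}
  let S' := {i : Fin n // i ≤ j ∧ w j ≤ w' i}
  have hcard : Fintype.card S' < Fintype.card S := by
    refine Fintype.card_lt_of_injective_of_notMem (b := ⟨j, le_rfl, le_rfl⟩)
      (fun s : S' => (⟨s.1, s.2.1, ?_⟩ : S)) ?_ ?_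
    · have h1 : s.1 ≠ j := by
        intro e
        have := s.2.2
        rw [e] at this
        exact absurd hlt (not_lt.mpr this)
      rw [hmin s.1 (lt_of_le_of_ne s.2.1 h1)]
      exact s.2.2
    · intro s t hst
      exact Subtype.ext (congrArg (fun z : S => z.1) hst)
    · rintro ⟨s, hs⟩
      have h1 : s.1 = j := congrArg (fun z : S => z.1) hs
      have := s.2.2
      rw [h1] at this
      exact absurd hlt (not_lt.mpr this)
  have hopen : IsOpen {g : GL (Fin n) F |
      (g.1.submatrix (fun s : S => w s.1) (fun s : S => s.1)).det ≠ 0} := by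
    refine isOpen_ne_fun (Continuous.matrix_det ?_) continuous_const
    exact Units.continuous_val.matrix_submatrix _ _
  have hw : weylRep w ∈ {g : GL (Fin n) F |
      (g.1.submatrix (fun s : S => w s.1) (fun s : S => s.1)).det ≠ 0} := by
    have : (weylRep w : GL (Fin n) F).1.submatrix (fun s : S => w s.1) (fun s : S => s.1) = 1 := by
      ext s t
      change (if w s.1 = w t.1 then (1 : F) else 0) = _
      rw [Matrix.one_apply]
      exact if_congr (w.injective.eq_iff.trans Subtype.ext_iff.symm) rfl rfl
    change Matrix.det _ ≠ 0
    rw [this, Matrix.det_one]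
    exact one_ne_zero
  obtain ⟨g, hg, u₁, hu₁, a, u₂, hu₂, e⟩ :=
    mem_closure_iff.mp (h (weylRep_mem_bruhatCell w)) _ hopen hw
  let X : Matrix S S' F := Matrix.of fun s i => u₁.1 (w s.1) (w' i.1) * a i.1
  let Y : Matrix S' S F := Matrix.of fun i t => u₂.1 i.1 t.1
  have hXY : g.1.submatrix (fun s : S => w s.1) (fun s : S => s.1) = X * Y := by
    ext s t
    rw [Matrix.submatrix_apply, e]
    refine (bruhat_apply ⟨u₁, hu₁⟩ ⟨u₂, hu₂⟩ w' a (w s.1) t.1).trans ?_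
    rw [Matrix.mul_apply]
    refine Eq.trans ?_ (Finset.sum_subtype (Finset.univ.filter fun i => i ≤ j ∧ w j ≤ w' i)
      (by simp) fun i => u₁.1 (w s.1) (w' i) * a i * u₂.1 i t.1)
    refine (Finset.sum_filter_of_ne fun i _ hi => ?_).symm
    constructor
    · by_contra! hji
      exact hi (by rw [hu₂.2 i t.1 (t.2.1.trans_lt hji), mul_zero])
    · by_contra! hji
      exact hi (by rw [hu₁.2 _ _ (hji.trans_le s.2.2), zero_mul, zero_mul])
  refine hg ?_
  rw [hXY]
  by_contra hdet
  have h1 := Matrix.rank_of_isUnit (X * Y) ((Matrix.isUnit_iff_isUnit_det _).mpr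
    (isUnit_iff_ne_zero.mpr hdet))
  have h2 := (Matrix.rank_mul_le_left X Y).trans (Matrix.rank_le_card_width X)
  omega

theorem BruhatLE.antisymm {w w' : Equiv.Perm (Fin n)} (h : BruhatLE F w w')
    (h' : BruhatLE F w' w) : w = w' := by
  refine Equiv.ext fun j => ?_
  induction j using WellFoundedLT.induction with
  | ind j ih => exact le_antisymm (h.apply_le ih) (h'.apply_le fun i hi => (ih i hi).symm)

end BruhatOrder

/-! ### Block antidiagonal permutations and the open sets of non-vanishing minors -/

section LevelPerm

variable {n : ℕ}

/-- The block antidiagonal permutation moving the first `k` indices, in order, past the last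
`n - k` ones. -/
def levelPerm (k : ℕ) : Equiv.Perm (Fin n) where
  toFun j := ⟨if (j : ℕ) < k then j + (n - k) else j - k, by split_ifs <;> omega⟩
  invFun i := ⟨if (i : ℕ) + k < n then i + k else i - (n - k), by split_ifs <;> omega⟩
  left_inv j := by
    ext
    dsimp only
    split_ifs <;> omega
  right_inv i := by
    ext
    dsimp only
    split_ifs <;> omega

theorem levelPerm_apply (k : ℕ) (j : Fin n) :
    (levelPerm k j : ℕ) = if (j : ℕ) < k then j + (n - k) else j - k := rfl

theorem levelPerm_symm_apply (k : ℕ) (i : Fin n) :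
    ((levelPerm k).symm i : ℕ) = if (i : ℕ) + k < n then i + k else i - (n - k) := rfl

theorem levelPerm_self : levelPerm n = (1 : Equiv.Perm (Fin n)) := by
  ext j
  rw [levelPerm_apply, if_pos j.2]
  simp

theorem levelPerm_injOn [NeZero n] : Set.InjOn (levelPerm (n := n)) (Set.Icc 1 n) := by
  intro k hk l hl h
  have h1 := congrArg (fun w : Equiv.Perm (Fin n) =>
    ((w.symm ⟨n - 1, Nat.sub_one_lt (NeZero.ne n)⟩ : Fin n) : ℕ)) h
  have := NeZero.ne n
  obtain ⟨hk1, hk2⟩ := hk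
  obtain ⟨hl1, hl2⟩ := hl
  simp only [levelPerm_symm_apply] at h1
  split_ifs at h1 <;> omega

theorem levelPerm_ne_one [NeZero n] {k : ℕ} (hk : 1 ≤ k) (hkn : k < n) :
    levelPerm k ≠ (1 : Equiv.Perm (Fin n)) := by
  rw [← levelPerm_self]
  exact fun h => hkn.ne (levelPerm_injOn ⟨hk, hkn.le⟩ ⟨hk.trans hkn.le, le_rfl⟩ h)

theorem supportsBessel_levelPerm (k : ℕ) : SupportsBessel (levelPerm k : Equiv.Perm (Fin n)) := by
  rintro i j ⟨hij, hlt⟩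
  rw [Fin.lt_def] at hlt
  simp only [levelPerm_apply] at hlt ⊢
  split_ifs at hlt ⊢ <;> omega

theorem sendsPos_levelPerm {k : ℕ} {i j : Fin n} :
    SendsPos (levelPerm k) i j ↔ (i : ℕ) + 1 = j ∧ ((i : ℕ) < k ↔ (j : ℕ) < k) := by
  rw [SendsPos, Fin.lt_def, levelPerm_apply, levelPerm_apply]
  refine and_congr_right fun h => ?_
  split_ifs <;> omega

theorem sameBlock_levelPerm {k : ℕ} {i j : Fin n} :
    SameBlock (levelPerm k) i j ↔ ((i : ℕ) < k ↔ (j : ℕ) < k) := by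
  simp only [SameBlock, sendsPos_levelPerm, min_le_iff, le_max_iff, Fin.le_def]
  constructor
  · intro h
    by_contra hne
    have h1 := h ⟨k - 1, by omega⟩ ⟨k, by omega⟩
    simp only at h1
    omega
  · intro h l m hlm h1 h2
    omega

end LevelPerm

section Minors

variable {n : ℕ} {F : Type*} [Field F]

theorem lowerMinor_eq_of_mem_bruhatCell (k : ℕ) {w : Equiv.Perm (Fin n)} {g : GL (Fin n) F}
    (hg : g ∈ bruhatCell F w) : ∃ c, lowerMinor k g.1 = lowerMinor k (weylMatrix F w) * c := by
  obtain ⟨u₁, hu₁, a, u₂, hu₂, e⟩ := hg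
  refine ⟨∏ j : Fin n, if (j : ℕ) < k then (a j : F) else 1, ?_⟩
  have h1 := lowerMinor_mul_unipotent k (u₁.1 * weylMatrix F w * (diag a).1) ⟨u₂, hu₂⟩
  have h2 := lowerMinor_unipotent_mul k ⟨u₁, hu₁⟩ (weylMatrix F w * (diag a).1)
  rw [e]
  refine h1.trans ?_
  rw [Matrix.mul_assoc]
  exact h2.trans (lowerMinor_mul_diagonal k _ _)

theorem le_of_lowerMinor_weylMatrix_ne_zero {k : ℕ} {w : Equiv.Perm (Fin n)}
    (h : lowerMinor k (weylMatrix F w) ≠ 0) (j : Fin n) (hj : (j : ℕ) < k) :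
    n ≤ (w j : ℕ) + k := by
  by_contra! hlt
  refine h (Matrix.det_zero_of_column_eq (i := j) (j := ⟨w j + k, hlt⟩) ?_ fun i => ?_)
  · intro e
    have := congrArg Fin.val e
    simp only at this
    omega
  · rw [minorMatrix_of_lt hj, minorMatrix_of_ge (by simp)]
    simp [weylMatrix, Fin.ext_iff]

end Minors

section BruhatOrder

variable {n : ℕ} {F : Type*} [Field F] [ValuativeRel F] [TopologicalSpace F]
  [IsNonarchimedeanLocalField F]

/-- `levelPerm k` is the least element of the Bruhat order among the permutations that send the
first `k` indices to the last `k` ones. -/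
theorem bruhatLE_levelPerm {k : ℕ} {w : Equiv.Perm (Fin n)}
    (h : ∀ j : Fin n, (j : ℕ) < k → n ≤ (w j : ℕ) + k) : BruhatLE F (levelPerm k) w := by
  let r : Equiv.Perm (Fin n) → Equiv.Perm (Fin n) → Prop := fun v v' => BruhatLE F v v' ∧ v ≠ v'
  have : IsTrans _ r := ⟨fun a b c hab hbc => ⟨hab.1.trans hbc.1, by
    rintro rfl
    exact hab.2 (hab.1.antisymm hbc.1)⟩⟩
  have : Std.Irrefl r := ⟨fun a ha => ha.2 rfl⟩
  induction w using (Finite.wellFounded_of_trans_of_irrefl r).induction with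
  | _ w ih =>
  -- an inversion within one of the two blocks can be undone
  by_cases hinv : ∃ i j : Fin n, i < j ∧ w j < w i ∧ ((i : ℕ) < k ↔ (j : ℕ) < k)
  · obtain ⟨i, j, hij, hw, hb⟩ := hinv
    have hle := bruhatLE_mul_swap (F := F) w hij hw
    refine (ih (w * Equiv.swap i j) ⟨hle, ?_⟩ fun l hl => ?_).trans hle
    · intro e
      rw [mul_eq_left, Equiv.swap_eq_one_iff] at e
      exact hij.ne e
    · rw [Equiv.Perm.mul_apply]
      refine h _ ?_
      rcases eq_or_ne l i with rfl | hli
      · rw [Equiv.swap_apply_left]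
        exact hb.mp hl
      rcases eq_or_ne l j with rfl | hlj
      · rw [Equiv.swap_apply_right]
        exact hb.mpr hl
      · rwa [Equiv.swap_apply_of_ne_of_ne hli hlj]
  push Not at hinv
  have hmono : ∀ i j : Fin n, i < j → ((i : ℕ) < k ↔ (j : ℕ) < k) → w i < w j := by
    intro i j hij hb
    exact lt_of_le_of_ne (not_lt.mp fun hw => absurd hb (by have := hinv i j hij hw; omega))
      (w.injective.ne hij.ne)
  let p : Equiv.Perm (Fin n) := (levelPerm k)⁻¹ * w
  have hp : ∀ j, (p j : ℕ) = if (w j : ℕ) + k < n then w j + k else w j - (n - k) :=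
    fun j => levelPerm_symm_apply k (w j)
  have hmaps : Set.MapsTo p {j | (j : ℕ) < k} {j | (j : ℕ) < k} := by
    intro j hj
    have h1 := h j hj
    have h2 := (w j).2
    have h3 : (j : ℕ) < k := hj
    change (p j : ℕ) < k
    rw [hp]
    split_ifs <;> omega
  have hmaps' := Equiv.Perm.perm_symm_mapsTo_of_mapsTo p hmaps
  have hpk : ∀ j : Fin n, (p j : ℕ) < k ↔ (j : ℕ) < k := fun j =>
    ⟨fun hj => by simpa using hmaps' hj, fun hj => hmaps hj⟩
  have hpmono : StrictMono p := by
    intro i j hij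
    have hi := hpk i
    have hj := hpk j
    have h1 := hmono i j hij
    rw [Fin.lt_def] at h1 hij ⊢
    have h4 := (w i).2
    have h5 := (w j).2
    by_cases hb : (i : ℕ) < k ↔ (j : ℕ) < k
    · have h1 := h1 hb
      have h2 := h i
      have h3 := h j
      rw [hp, hp] at *
      split_ifs at * <;> omega
    · omega
  have hp1 : p = 1 := by
    have := Subsingleton.elim (StrictMono.orderIsoOfSurjective p hpmono p.surjective)
      (OrderIso.refl (Fin n))
    exact Equiv.ext fun j => congrArg (fun e : Fin n ≃o Fin n => e j) this
  rw [← inv_mul_eq_one.mp hp1]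
  exact subset_closure

theorem mem_bruhatOpen_levelPerm {k : ℕ} {g : GL (Fin n) F} (hg : lowerMinor k g.1 ≠ 0) :
    g ∈ bruhatOpen F (levelPerm k) := by
  obtain ⟨w, hw⟩ := exists_mem_bruhatCell g
  obtain ⟨c, hc⟩ := lowerMinor_eq_of_mem_bruhatCell k hw
  refine ⟨w, bruhatLE_levelPerm (le_of_lowerMinor_weylMatrix_ne_zero (F := F) ?_), hw⟩
  rw [hc] at hg
  exact left_ne_zero_of_mul hg

theorem bruhatLE_one (w : Equiv.Perm (Fin n)) : BruhatLE F 1 w := by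
  rw [← levelPerm_self]
  exact bruhatLE_levelPerm fun j _ => Nat.le_add_left _ _

/-- Chains for the Bruhat order are bounded in length, as their members are distinct; so `w ≠ 1`
has positive distance to `1`. -/
theorem one_le_besselDist {w : Equiv.Perm (Fin n)} (hw : w ≠ 1) (hB : SupportsBessel w) :
    1 ≤ besselDist F w 1 := by
  refine le_csSup ⟨Fintype.card (Equiv.Perm (Fin n)), ?_⟩ ?_
  · rintro m ⟨c, -, -, -, hc⟩
    let _ : PartialOrder (Equiv.Perm (Fin n)) :=
      { le := BruhatLE F
        le_refl := fun _ => subset_closure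
        le_trans := fun _ _ _ h h' => h.trans h'
        le_antisymm := fun _ _ h h' => h.antisymm h' }
    have hmono : StrictMono c :=
      Fin.strictMono_iff_lt_succ.mpr fun i => lt_of_le_of_ne (hc i).1 (hc i).2
    have := Fintype.card_le_of_injective c hmono.injective
    rw [Fintype.card_fin] at this
    omega
  · refine ⟨![1, w], fun i => ?_, rfl, rfl, fun i => ?_⟩
    · fin_cases i
      · rw [← levelPerm_self]
        exact supportsBessel_levelPerm n
      · exact hB
    · fin_cases i
      exact ⟨bruhatLE_one w, hw.symm⟩

theorem IsSmoothCompactModCenter.bruhatOpen_levelPerm {k : ℕ} {ω : Fˣ →ₜ* ℂˣ}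
    {f : GL (Fin n) F → ℂ} (hf : IsSmoothCompactModCenter ω Set.univ f)
    (hfk : ∀ g, f g ≠ 0 → lowerMinor k g.1 ≠ 0) :
    IsSmoothCompactModCenter ω (bruhatOpen F (levelPerm k)) f :=
  hf.of_vanish fun g hg => mem_bruhatOpen_levelPerm (hfk g hg)

end BruhatOrder

/-! ### Bounding the unipotent factor in terms of a minor -/

section Projections

variable {n : ℕ} {F : Type*} [Field F]

/-- The projection onto the first `k` coordinates. -/
def headProj (n : ℕ) (F : Type*) [Field F] (k : ℕ) : Matrix (Fin n) (Fin n) F :=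
  Matrix.diagonal fun j => if (j : ℕ) < k then 1 else 0

theorem headProj_mul_apply (k : ℕ) (A : Matrix (Fin n) (Fin n) F) (i j : Fin n) :
    (headProj n F k * A) i j = if (i : ℕ) < k then A i j else 0 := by
  rw [headProj, Matrix.diagonal_mul, ite_mul, one_mul, zero_mul]

theorem mul_headProj_apply (k : ℕ) (A : Matrix (Fin n) (Fin n) F) (i j : Fin n) :
    (A * headProj n F k) i j = if (j : ℕ) < k then A i j else 0 := by
  rw [headProj, Matrix.mul_diagonal, mul_ite, mul_one, mul_zero]

theorem headProj_mul_unipotent_mul_headProj (k : ℕ) (u : unipotent n F) :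
    headProj n F k * (u.1.1 * headProj n F k) = u.1.1 * headProj n F k := by
  ext i j
  rw [headProj_mul_apply, mul_headProj_apply]
  split_ifs with h1 h2
  · rfl
  · rfl
  · rw [unipotent_lower u (by rw [Fin.lt_def]; omega)]
  · rfl

theorem minorMatrix_mul_headProj (k : ℕ) (A : Matrix (Fin n) (Fin n) F) :
    minorMatrix k A * headProj n F k = A * headProj n F k := by
  ext i j
  rw [mul_headProj_apply, mul_headProj_apply]
  split_ifs with h
  · rw [minorMatrix_of_lt h]
  · rfl

/-- The conjugate by `u` of the projection onto the first `k` coordinates can be read off from any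
`g = x ẇ_ℓ a u`. -/
theorem conj_headProj_eq {k : ℕ} (x u : unipotent n F) (a : Torus n F)
    (hg : lowerMinor k (x * (longRep n F * diag a * u) : GL (Fin n) F).1 ≠ 0) :
    (u⁻¹).1.1 * headProj n F k * u.1.1 =
      headProj n F k * (minorMatrix k (x * (longRep n F * diag a * u) : GL (Fin n) F).1)⁻¹ *
        (x * (longRep n F * diag a * u) : GL (Fin n) F).1 := by
  set g : Matrix (Fin n) (Fin n) F := (x * (longRep n F * diag a * u) : GL (Fin n) F).1 with hgdef
  set P := headProj n F k with hP
  set X := (u⁻¹).1.1 * P * u.1.1 with hX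
  have huu : u.1.1 * (u⁻¹).1.1 = 1 := by
    rw [← Units.val_mul, ← Subgroup.coe_mul, mul_inv_cancel]
    simp
  have hPX : P * X = X := by
    rw [hX, ← Matrix.mul_assoc, headProj_mul_unipotent_mul_headProj]
  -- the rows of `g` from the `(n - k)`-th on are determined by their first `k` entries
  have hrow : ∀ i j : Fin n, n ≤ (i : ℕ) + k → (g - g * X) i j = 0 := by
    intro i j hi
    have e : g - g * X = x.1.1 * (longRep n F * diag a : GL (Fin n) F).1 * (1 - P) * u.1.1 := by
      have e1 : g = x.1.1 * (longRep n F * diag a : GL (Fin n) F).1 * u.1.1 := by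
        rw [hgdef, Units.val_mul, Units.val_mul, Matrix.mul_assoc]
      have e2 : u.1.1 * X = P * u.1.1 := by
        rw [hX, Matrix.mul_assoc, ← Matrix.mul_assoc u.1.1, huu, Matrix.one_mul]
      rw [e1, Matrix.mul_assoc _ u.1.1 X, e2, Matrix.mul_sub, Matrix.sub_mul, Matrix.mul_one,
        Matrix.mul_assoc _ P]
    rw [e, Matrix.mul_apply]
    refine Finset.sum_eq_zero fun l _ => ?_
    rw [Matrix.mul_sub, Matrix.mul_one, Matrix.sub_apply, mul_headProj_apply]
    split_ifs with hl
    · rw [sub_self, zero_mul]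
    · rw [sub_zero, Matrix.mul_apply]
      rw [Finset.sum_eq_zero, zero_mul]
      intro c _
      rw [Units.val_mul]
      change x.1.1 i c * (longMatrix n F * Matrix.diagonal fun i => (a i : F)) c l = 0
      rw [Matrix.mul_diagonal]
      by_cases hc : l = Fin.rev c
      · rw [unipotent_lower x, zero_mul]
        rw [hc, Fin.val_rev] at hl
        rw [Fin.lt_def]
        omega
      · simp [longMatrix, hc]
  let J : Matrix (Fin n) (Fin n) F := Matrix.of fun c r => if (c : ℕ) = r + k then 1 else 0
  have hPJ : P * J = 0 := by
    ext i j
    rw [headProj_mul_apply]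
    split_ifs with h
    · exact if_neg (by omega)
    · rfl
  have hMJ : minorMatrix k g * (J * (g - g * X)) = g - g * X := by
    ext i j
    rw [← Matrix.mul_assoc, Matrix.mul_apply]
    have hent : ∀ l : Fin n, (minorMatrix k g * J) i l =
        if i = l ∧ (l : ℕ) + k < n then 1 else 0 := by
      intro l
      rw [Matrix.mul_apply]
      by_cases hl : (l : ℕ) + k < n
      · rw [Finset.sum_eq_single ⟨l + k, hl⟩]
        · rw [minorMatrix_of_ge (by simp)]
          simp [J, hl, Fin.ext_iff]
        · intro c _ hc
          rw [show J c l = 0 from if_neg fun e => hc (Fin.ext e), mul_zero]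
        · simp
      · rw [if_neg fun h => hl h.2]
        refine Finset.sum_eq_zero fun c _ => ?_
        rw [show J c l = 0 from if_neg (by omega), mul_zero]
    simp only [hent, ite_and, ite_mul, one_mul, zero_mul]
    rw [Finset.sum_ite_eq, if_pos (Finset.mem_univ _)]
    split_ifs with h
    · rfl
    · exact (hrow i j (by omega)).symm
  have hMT : minorMatrix k g * (X + J * (g - g * X)) = g := by
    rw [Matrix.mul_add, hMJ]
    nth_rewrite 1 [← hPX]
    rw [← Matrix.mul_assoc, minorMatrix_mul_headProj, Matrix.mul_assoc, hPX]
    abel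
  have hunit : IsUnit (minorMatrix k g).det := isUnit_iff_ne_zero.mpr hg
  have hT : X + J * (g - g * X) = (minorMatrix k g)⁻¹ * g := by
    have h1 := congrArg ((minorMatrix k g)⁻¹ * ·) hMT
    rwa [Matrix.nonsing_inv_mul_cancel_left _ _ hunit] at h1
  rw [Matrix.mul_assoc, ← hT, Matrix.mul_add, hPX, ← Matrix.mul_assoc, hPJ, Matrix.zero_mul,
    add_zero]

/-- The conjugate by `u` of a torus element with two eigenvalues `1` and `β`, in terms of that of
the projection. -/
theorem conj_diag_sub_one {k : ℕ} (u : unipotent n F) (c : Torus n F) (β : F)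
    (hc : ∀ j : Fin n, (c j : F) = if (j : ℕ) < k then 1 else β) :
    ((u⁻¹ : unipotent n F) * diag c * u : GL (Fin n) F).1 - 1 =
      (β - 1) • (1 - (u⁻¹).1.1 * headProj n F k * u.1.1) := by
  have huu : (u⁻¹).1.1 * u.1.1 = 1 := by
    rw [← Units.val_mul, ← Subgroup.coe_mul, inv_mul_cancel]
    simp
  have hd : (diag c).1 = 1 + (β - 1) • (1 - headProj n F k) := by
    ext i j
    change Matrix.diagonal (fun i => (c i : F)) i j = _
    rcases eq_or_ne i j with rfl | hij
    · simp only [headProj, Matrix.diagonal_apply_eq, Matrix.add_apply, Matrix.smul_apply,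
        Matrix.sub_apply, Matrix.one_apply_eq, hc]
      split_ifs <;> simp
    · simp [headProj, hij]
  rw [Units.val_mul, Units.val_mul, hd, Matrix.mul_add, Matrix.add_mul, Matrix.mul_one, huu,
    add_sub_cancel_left, Matrix.mul_smul, Matrix.smul_mul, Matrix.mul_sub, Matrix.sub_mul,
    Matrix.mul_one, huu]

theorem diag_central_mul (z : Fˣ) (a : Torus n F) :
    diag (central z * a) = GeneralLinearGroup.scalar (Fin n) z * diag a := by
  apply Units.ext
  ext i j
  rw [scalar_mul_apply]
  change Matrix.diagonal _ i j = _ * Matrix.diagonal _ i j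
  rcases eq_or_ne i j with rfl | hij
  · simp [central]
  · simp [hij]

end Projections

section Bounds

variable {n : ℕ} {F : Type*} [Field F] [ValuativeRel F] [TopologicalSpace F]
  [IsNonarchimedeanLocalField F] {ω : Fˣ →ₜ* ℂˣ} {f : GL (Fin n) F → ℂ}

theorem continuousOn_inv_minorMatrix (k : ℕ) : ContinuousOn
    (fun g : GL (Fin n) F => (minorMatrix k g.1)⁻¹) {g | lowerMinor k g.1 ≠ 0} := by
  have h : Continuous fun g : GL (Fin n) F => minorMatrix k g.1 := by
    refine continuous_matrix fun i j => ?_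
    by_cases hj : (j : ℕ) < k
    · simpa only [minorMatrix_of_lt hj] using continuous_entry i j
    · simpa only [minorMatrix_of_ge (not_lt.mp hj)] using continuous_const
  simp only [Matrix.inv_def, Ring.inverse_eq_inv']
  refine ContinuousOn.smul (ContinuousOn.inv₀ ?_ fun g hg => hg) h.matrix_adjugate.continuousOn
  exact (continuous_lowerMinor k).continuousOn

/-- On the support of a function that vanishes where the `k`-th lower left minor does, the factor
`u` of `x ẇ_ℓ a u` conjugates the projection onto the first `k` coordinates into a bounded set. -/
theorem exists_conj_headProj_bound {k : ℕ} (hf : IsSmoothCompactModCenter ω Set.univ f)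
    (hfk : ∀ g, f g ≠ 0 → lowerMinor k g.1 ≠ 0) :
    ∃ γ : ValueGroupWithZero F, ∀ (x u : unipotent n F) (a : Torus n F),
      f (x * (longRep n F * diag a * u)) ≠ 0 →
        ∀ i j, valuation F (((u⁻¹).1.1 * headProj n F k * u.1.1) i j) ≤ γ := by
  obtain ⟨K, hK, hKf, hs⟩ := hf.exists_compact_support
  obtain ⟨γ, -, hγ⟩ := exists_valuation_le_of_continuousOn (F := F)
    (hK.prod (isCompact_univ : IsCompact (Set.univ : Set (Fin n × Fin n))))
    (h := fun p => (headProj n F k * (minorMatrix k p.1.1)⁻¹ * p.1.1) p.2.1 p.2.2) (by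
      have h1 : ContinuousOn (fun g : GL (Fin n) F =>
          headProj n F k * (minorMatrix k g.1)⁻¹ * g.1) K :=
        (continuousOn_const.mul ((continuousOn_inv_minorMatrix k).mono
          fun g hg => hfk g (hKf g hg))).mul Units.continuous_val.continuousOn
      have h2 : Continuous fun q : Matrix (Fin n) (Fin n) F × (Fin n × Fin n) =>
          q.1 q.2.1 q.2.2 := by
        refine continuous_prod_of_discrete_right.mpr fun b => ?_
        exact continuous_id.matrix_elem b.1 b.2
      exact h2.comp_continuousOn ((h1.comp continuousOn_fst fun p hp => hp.1).prodMk
        continuousOn_snd))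
  refine ⟨γ, fun x u a h i j => ?_⟩
  obtain ⟨z, κ, hκ, e⟩ := hs _ h
  have e' : x.1 * (longRep n F * diag (central z⁻¹ * a) * u.1) = κ := by
    rw [diag_central_mul, scalar_mul_mul, mul_scalar_mul, e, ← mul_assoc, ← map_mul,
      inv_mul_cancel, map_one, one_mul]
  rw [conj_headProj_eq x u (central z⁻¹ * a) (by rw [e']; exact hfk κ (hKf κ hκ)), e']
  exact hγ (κ, i, j) ⟨hκ, trivial⟩

end Bounds

/-! ### The tori attached to block antidiagonal permutations -/

section Tori

variable {n : ℕ} {F : Type*} [Field F]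

theorem apply_eq_of_sameBlock {w : Equiv.Perm (Fin n)} {a : Torus n F} (ha : a ∈ besselTorus F w)
    {i j : Fin n} (h : SameBlock w i j) : a i = a j := by
  have key : ∀ (d : ℕ) (i j : Fin n), (i : ℕ) + d = j → SameBlock w i j → a i = a j := by
    intro d
    induction d with
    | zero =>
      intro i j hij _
      exact congrArg a (Fin.ext hij)
    | succ d ih =>
      intro i j hij hb
      have hij' : i ≤ j := by rw [Fin.le_def]; omega
      let l : Fin n := ⟨i + d, by omega⟩
      have hl : (l : ℕ) = i + d := rfl
      have hil : i ≤ l := by rw [Fin.le_def]; omega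
      have hlj : l ≤ j := by rw [Fin.le_def]; omega
      have hb' : SameBlock w i l := by
        intro k m hkm h1 h2
        rw [min_eq_left hil] at h1
        rw [max_eq_right hil] at h2
        exact hb k m hkm ((min_le_left _ _).trans h1) ((h2.trans hlj).trans (le_max_right _ _))
      exact (ih i l hl.symm hb').trans
        (ha l j (hb l j (by omega) ((min_le_left _ _).trans hil) (le_max_right _ _)))
  rcases le_total i j with hij | hij
  · exact key (j - i) i j (by rw [Fin.le_def] at hij; omega) h
  · refine (key (i - j) j i (by rw [Fin.le_def] at hij; omega) fun k l hkl h1 h2 => ?_).symm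
    exact h k l hkl (by rwa [min_comm]) (by rwa [max_comm])

theorem reducedTorus_levelPerm_apply [NeZero n] {k : ℕ} (hk : 1 ≤ k) {c : Torus n F}
    (hc : c ∈ reducedTorus F (levelPerm k)) (j : Fin n) :
    (c j : F) = if (j : ℕ) < k then 1 else (c (Fin.rev 0) : F) := by
  split_ifs with h
  · rw [apply_eq_of_sameBlock hc.1 (show SameBlock (levelPerm k) j 0 from
      sameBlock_levelPerm.mpr ⟨fun _ => by rw [Fin.val_zero]; omega, fun _ => h⟩), hc.2,
      Units.val_one]
  · have := NeZero.ne n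
    rw [apply_eq_of_sameBlock hc.1 (show SameBlock (levelPerm k) j (Fin.rev 0) from
      sameBlock_levelPerm.mpr ?_)]
    rw [Fin.val_rev, Fin.val_zero]
    omega

theorem prod_sameBlock_eq_one {w : Equiv.Perm (Fin n)} {b : Torus n F}
    (hb : diag b ∈ derivedLevi F w) (i : Fin n) {s : Finset (Fin n)}
    (hs : ∀ j, j ∈ s ↔ SameBlock w i j) : ∏ j ∈ s, (b j : F) = 1 := by
  classical
  have h := hb.2 i
  change ((Matrix.diagonal fun j => (b j : F)).submatrix _ _).det = 1 at h
  rw [Matrix.submatrix_diagonal _ _ Subtype.val_injective] at h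
  rw [Matrix.det_diagonal] at h
  exact (Finset.prod_subtype s hs _).trans h

theorem prod_eq_one_of_mem_derivedLevi [NeZero n] {k : ℕ} (hk : 1 ≤ k) (hkn : k < n)
    {b : Torus n F} (hb : diag b ∈ derivedLevi F (levelPerm k)) :
    (∏ j ∈ {j : Fin n | (j : ℕ) < k}, (b j : F)) = 1 ∧
      (∏ j ∈ {j : Fin n | ¬ (j : ℕ) < k}, (b j : F)) = 1 := by
  constructor
  · refine prod_sameBlock_eq_one hb 0 fun j => ?_
    rw [sameBlock_levelPerm, Fin.val_zero, Finset.mem_filter]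
    simp only [Finset.mem_univ, true_and]
    omega
  · refine prod_sameBlock_eq_one hb (Fin.rev 0) fun j => ?_
    rw [sameBlock_levelPerm, Fin.val_rev, Fin.val_zero, Finset.mem_filter]
    simp only [Finset.mem_univ, true_and]
    omega

variable [ValuativeRel F] [TopologicalSpace F] [IsNonarchimedeanLocalField F]

theorem isClosed_reducedTorus [NeZero n] (w : Equiv.Perm (Fin n)) :
    IsClosed (reducedTorus F w : Set (Torus n F)) := by
  have h : (reducedTorus F w : Set (Torus n F)) =
      (⋂ (i) (j) (_ : SendsPos w i j), {a | a i = a j}) ∩ {a | a 0 = 1} := by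
    ext a
    simp only [Set.mem_inter_iff, Set.mem_iInter]
    exact Iff.rfl
  rw [h]
  refine IsClosed.inter (isClosed_iInter fun i => isClosed_iInter fun j => isClosed_iInter fun _ =>
    isClosed_eq (continuous_apply i) (continuous_apply j)) (isClosed_eq (continuous_apply 0)
      continuous_const)

theorem isCompact_setOf_units_le (γ : ValueGroupWithZero F) :
    IsCompact {u : Fˣ | valuation F u ≤ γ ∧ valuation F ((u⁻¹ : Fˣ) : F) ≤ γ} := by
  have h1 := IsNonarchimedeanLocalField.isCompact_closedBall F γ
  have h2 := h1.prod (h1.image (MulOpposite.continuous_op (M := F)))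
  refine (congrArg IsCompact (Set.ext fun u => ?_)).mp
    ((Units.isClosedEmbedding_embedProduct (α := F)).isCompact_preimage h2)
  constructor
  · rintro ⟨h1, x, hx, hx'⟩
    obtain rfl := MulOpposite.op_injective hx'
    exact ⟨h1, hx⟩
  · exact fun h => ⟨h.1, _, h.2, rfl⟩

theorem isCompact_setOf_reducedTorus_le [NeZero n] (w : Equiv.Perm (Fin n))
    (γ : ValueGroupWithZero F) :
    IsCompact {c : reducedTorus F w | ∀ j, valuation F (c.1 j : F) ≤ γ ∧
      valuation F (((c.1 j)⁻¹ : Fˣ) : F) ≤ γ} := by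
  have h := isCompact_univ_pi (X := fun _ : Fin n => Fˣ) fun _ => isCompact_setOf_units_le γ
  refine (congrArg IsCompact (Set.ext fun c => ?_)).mp
    ((isClosed_reducedTorus w).isClosedEmbedding_subtypeVal.isCompact_preimage h)
  exact ⟨fun h j => h j trivial, fun h j _ => h j⟩

/-- The elements of `A'_w` whose coordinates are congruent to `1`, with their inverses, modulo the
ball of radius `ρ ≤ 1`. -/
def congruenceTorus [NeZero n] (w : Equiv.Perm (Fin n)) (ρ : ValueGroupWithZero F) (hρ : ρ ≤ 1) :
    Subgroup (reducedTorus F w) where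
  carrier := {c | ∀ j, valuation F ((c.1 j : F) - 1) ≤ ρ ∧
    valuation F ((((c.1 j)⁻¹ : Fˣ) : F) - 1) ≤ ρ}
  one_mem' := fun j => by simp
  mul_mem' := by
    have key : ∀ x y : F, valuation F (x - 1) ≤ ρ → valuation F (y - 1) ≤ ρ →
        valuation F (x * y - 1) ≤ ρ := by
      intro x y hx hy
      rw [show x * y - 1 = (x - 1) * (y - 1) + (x - 1) + (y - 1) by ring]
      refine (valuation F).map_add_le ((valuation F).map_add_le ?_ hx) hy
      rw [map_mul]
      exact (mul_le_mul' hx (hy.trans hρ)).trans_eq (mul_one _)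
    intro c d hc hd j
    refine ⟨key _ _ (hc j).1 (hd j).1, ?_⟩
    have := key _ _ (hc j).2 (hd j).2
    rwa [← Units.val_mul, ← mul_inv] at this
  inv_mem' := by
    intro c hc j
    refine ⟨(hc j).2, ?_⟩
    have := (hc j).1
    rwa [← inv_inv (c.1 j)] at this

theorem isOpen_congruenceTorus [NeZero n] (w : Equiv.Perm (Fin n)) {ρ : ValueGroupWithZero F}
    (hρ : ρ ≤ 1) (hρ0 : ρ ≠ 0) : IsOpen (congruenceTorus w ρ hρ : Set (reducedTorus F w)) := by
  have h : (congruenceTorus w ρ hρ : Set (reducedTorus F w)) =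
      ⋂ j, ((fun c : reducedTorus F w => (c.1 j : F) - 1) ⁻¹' {x | valuation F x ≤ ρ} ∩
        (fun c : reducedTorus F w => (((c.1 j)⁻¹ : Fˣ) : F) - 1) ⁻¹' {x | valuation F x ≤ ρ}) := by
    ext c
    simp only [Set.mem_iInter]
    exact Iff.rfl
  rw [h]
  have hc : ∀ j, Continuous fun c : reducedTorus F w => c.1 j := fun j =>
    (continuous_apply j).comp continuous_subtype_val
  exact isOpen_iInter_of_finite fun j =>
    ((isOpen_ball hρ0).preimage ((Units.continuous_val.comp (hc j)).sub continuous_const)).inter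
      ((isOpen_ball hρ0).preimage
        ((Units.continuous_coe_inv.comp (hc j)).sub continuous_const))

theorem isCompact_congruenceTorus [NeZero n] (w : Equiv.Perm (Fin n)) {ρ : ValueGroupWithZero F}
    (hρ : ρ ≤ 1) (hρ0 : ρ ≠ 0) :
    IsCompact (congruenceTorus w ρ hρ : Set (reducedTorus F w)) := by
  refine (isCompact_setOf_reducedTorus_le w (1 : ValueGroupWithZero F)).of_isClosed_subset
    ((congruenceTorus w ρ hρ).isClosed_of_isOpen (isOpen_congruenceTorus w hρ hρ0)) ?_
  have key : ∀ x : F, valuation F (x - 1) ≤ ρ → valuation F x ≤ 1 := by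
    intro x hx
    rw [← sub_add_cancel x 1]
    exact (valuation F).map_add_le (hx.trans hρ) (by simp)
  exact fun c hc j => ⟨key _ (hc j).1, key _ (hc j).2⟩

end Tori

/-! ### Uniform smoothness -/

section Cutoff

variable {n : ℕ} {F : Type*} [Field F] [ValuativeRel F] [TopologicalSpace F]
  [IsNonarchimedeanLocalField F]

/-- Multiplication on the right by an upper triangular matrix that is integral, with its inverse,
does not affect the cutoff. -/
theorem cutoff_mul (N : ℕ) {y y' : Matrix (Fin n) (Fin n) F} (hyy' : y * y' = 1)
    (hy : ∀ i j, valuation F (y i j) ≤ 1) (hy' : ∀ i j, valuation F (y' i j) ≤ 1)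
    (hy0 : ∀ i j, j < i → y i j = 0) (hy0' : ∀ i j, j < i → y' i j = 0)
    (S : Matrix (Fin n) (Fin n) F) : cutoff N (S * y) = cutoff N S := by
  have key : ∀ y S : Matrix (Fin n) (Fin n) F, (∀ i j, valuation F (y i j) ≤ 1) →
      (∀ i j, j < i → y i j = 0) →
      (∀ i j : Fin n, valuation F (S i j) ≤ (uniformizer F)⁻¹ ^ (((i : ℕ) + j + 1) * N)) →
      ∀ i j : Fin n, valuation F ((S * y) i j) ≤
        (uniformizer F)⁻¹ ^ (((i : ℕ) + j + 1) * N) := by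
    intro y S hy hy0 hS i j
    rw [Matrix.mul_apply]
    refine (valuation F).map_sum_le fun l _ => ?_
    rcases lt_or_ge j l with hl | hl
    · simp [hy0 l j hl]
    rw [map_mul]
    refine (mul_le_mul' (hS i l) (hy l j)).trans ?_
    rw [mul_one]
    refine pow_le_pow_right₀ one_le_uniformizer_inv (Nat.mul_le_mul_right _ ?_)
    rw [Fin.le_def] at hl
    omega
  have hiff : (∀ i j : Fin n, valuation F ((S * y) i j) ≤
      (uniformizer F)⁻¹ ^ (((i : ℕ) + j + 1) * N)) ↔
      ∀ i j : Fin n, valuation F (S i j) ≤ (uniformizer F)⁻¹ ^ (((i : ℕ) + j + 1) * N) := by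
    refine ⟨fun hS => ?_, key y S hy hy0⟩
    have h1 := key y' _ hy' hy0' hS
    rwa [Matrix.mul_assoc, hyy', Matrix.mul_one] at h1
  simp only [cutoff, hiff]

end Cutoff

section Bessel

variable {n : ℕ} {F : Type*} [Field F] [TopologicalSpace F] [MeasurableSpace (unipotent n F)]
  (μ : Measure (unipotent n F)) (ψ : AddChar F Circle)
  {ω : Fˣ →ₜ* ℂˣ} {f : GL (Fin n) F → ℂ}

theorem whittaker_scalar_mul {Ω : Set (GL (Fin n) F)} (hf : IsSmoothCompactModCenter ω Ω f)
    (z : Fˣ) (g : GL (Fin n) F) :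
    whittaker μ ψ f (GeneralLinearGroup.scalar (Fin n) z * g) = ω z * whittaker μ ψ f g := by
  rw [whittaker, whittaker, ← integral_const_mul]
  refine integral_congr_ae (Eventually.of_forall fun x => ?_)
  change f _ * _ = _ * (f _ * _)
  rw [mul_scalar_mul, hf.central, mul_assoc]

theorem partialBessel_mul_central [NeZero n] {Ω : Set (GL (Fin n) F)}
    (hf : IsSmoothCompactModCenter ω Ω f) (φ : Matrix (Fin n) (Fin n) F → ℂ) (a : Torus n F)
    (z : Fˣ) : partialBessel μ ψ φ f (a * central z) = ω z * partialBessel μ ψ φ f a := by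
  rw [partialBessel, partialBessel, ← integral_const_mul]
  refine integral_congr_ae (Eventually.of_forall fun u => ?_)
  have h1 : (central ((a * central z : Torus n F) 0))⁻¹ * (a * central z) =
      (central (a 0))⁻¹ * a := by
    funext i
    simp only [central, Pi.mul_apply, Pi.inv_apply]
    rw [mul_inv, mul_mul_mul_comm, inv_mul_cancel, mul_one]
  have h2 : longRep n F * diag (a * central z) * u.1 =
      GeneralLinearGroup.scalar (Fin n) z * (longRep n F * diag a * u.1) := by
    rw [mul_comm a, diag_central_mul, scalar_mul_mul]
  simp only [h1, h2, whittaker_scalar_mul μ ψ hf]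
  ring

end Bessel

section Smoothness

variable {n : ℕ} {F : Type*} [Field F]

theorem conj_diag_lower (u : unipotent n F) (c : Torus n F) {i j : Fin n} (h : j < i) :
    ((u⁻¹ : unipotent n F) * diag c * u : GL (Fin n) F).1 i j = 0 := by
  rw [Units.val_mul, Units.val_mul, Matrix.mul_apply]
  refine Finset.sum_eq_zero fun l _ => ?_
  change (u⁻¹.1.1 * Matrix.diagonal fun i => (c i : F)) i l * _ = 0
  rw [Matrix.mul_diagonal]
  rcases lt_or_ge l i with hl | hl
  · rw [unipotent_lower u⁻¹ hl, zero_mul, zero_mul]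
  · rw [unipotent_lower u (h.trans_le hl), mul_zero]

theorem whittaker_eq_zero [MeasurableSpace (unipotent n F)] (μ : Measure (unipotent n F))
    (ψ : AddChar F Circle) {f : GL (Fin n) F → ℂ} {g : GL (Fin n) F}
    (h : ∀ x : unipotent n F, f (x * g) = 0) : whittaker μ ψ f g = 0 := by
  simp only [whittaker, h, zero_mul, integral_zero]

theorem le_max_one_of_pow_le {M : Type*} [MonoidWithZero M] [LinearOrder M] [ZeroLEOneClass M]
    [PosMulMono M] {γ x : M} {m : ℕ} (hm : m ≠ 0) (h : x ^ m ≤ γ) : x ≤ max 1 γ := by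
  rcases le_total x 1 with hx | hx
  · exact hx.trans (le_max_left _ _)
  · exact ((le_self_pow₀ hx hm).trans h).trans (le_max_right _ _)

variable [ValuativeRel F] [TopologicalSpace F] [IsNonarchimedeanLocalField F]
  {ω : Fˣ →ₜ* ℂˣ} {f : GL (Fin n) F → ℂ}

/-- If `f` vanishes where the `k`-th lower left minor does, its partial Bessel integrals are
invariant under a congruence subgroup of `A'_w`, `w = levelPerm k`, whatever the cutoff: moved past
`u`, an element of this subgroup acts by an element close to `1`, as long as `u` contributes to the
integral. -/
theorem exists_partialBessel_mul_congruenceTorus [NeZero n] {k : ℕ} (hk : 1 ≤ k)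
    (hf : IsSmoothCompactModCenter ω Set.univ f) (hfk : ∀ g, f g ≠ 0 → lowerMinor k g.1 ≠ 0) :
    ∃ (ρ : ValueGroupWithZero F) (hρ : ρ ≤ 1), ρ ≠ 0 ∧
      ∀ [MeasurableSpace (unipotent n F)] (μ : Measure (unipotent n F)) (ψ : AddChar F Circle)
        (N : ℕ) (a : Torus n F), ∀ c ∈ congruenceTorus (levelPerm k) ρ hρ,
          partialBessel μ ψ (cutoff N) f (a * c.1) = partialBessel μ ψ (cutoff N) f a := by
  obtain ⟨V, hV, hfV⟩ := hf.exists_nhds_one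
  obtain ⟨ρ₀, hρ₀, hρ₀1, hsub⟩ := exists_congruence_subset hV
  obtain ⟨γ, hγ⟩ := exists_conj_headProj_bound hf hfk
  have hγ1 : 1 ≤ max 1 γ := le_max_left _ _
  have hγ0 : 0 < max 1 γ := zero_lt_one.trans_le hγ1
  have hle : ρ₀ / max 1 γ ≤ ρ₀ := by
    rw [div_le_iff₀ hγ0]
    exact le_mul_of_one_le_right zero_le hγ1
  refine ⟨ρ₀ / max 1 γ, hle.trans hρ₀1, div_ne_zero hρ₀ hγ0.ne', ?_⟩
  intro _ μ ψ N a c hc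
  -- the conjugates by `u` of the elements of the congruence subgroup are close to `1`
  have hclose : ∀ u : unipotent n F, (∃ (x : unipotent n F) (a' : Torus n F),
      f (x.1 * (longRep n F * diag a' * u.1)) ≠ 0) →
      ∀ c ∈ congruenceTorus (levelPerm k) (ρ₀ / max 1 γ) (hle.trans hρ₀1), ∀ i j,
        valuation F (((u⁻¹).1 * diag c.1 * u.1 : GL (Fin n) F).1 i j -
          (1 : Matrix _ _ F) i j) ≤ ρ₀ := by
    rintro u ⟨x, a', h⟩ c hc i j
    rw [← Matrix.sub_apply, conj_diag_sub_one u c.1 _ (reducedTorus_levelPerm_apply hk c.2),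
      Matrix.smul_apply, smul_eq_mul, map_mul, ← div_mul_cancel₀ ρ₀ hγ0.ne']
    refine mul_le_mul' (hc _).1 ((valuation F).map_sub_le ?_ ?_)
    · refine le_trans ?_ hγ1
      rw [Matrix.one_apply]
      split_ifs <;> simp
    · exact (hγ x u a' h i j).trans (le_max_right _ _)
  have hint : ∀ u : unipotent n F, (∃ (x : unipotent n F) (a' : Torus n F),
      f (x.1 * (longRep n F * diag a' * u.1)) ≠ 0) →
      ∀ c ∈ congruenceTorus (levelPerm k) (ρ₀ / max 1 γ) (hle.trans hρ₀1), ∀ i j,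
        valuation F (((u⁻¹).1 * diag c.1 * u.1 : GL (Fin n) F).1 i j) ≤ 1 := by
    intro u hu c hc i j
    rw [← sub_add_cancel (((u⁻¹).1 * diag c.1 * u.1 : GL (Fin n) F).1 i j)
      ((1 : Matrix _ _ F) i j)]
    refine (valuation F).map_add_le ((hclose u hu c hc i j).trans hρ₀1) ?_
    rw [Matrix.one_apply]
    split_ifs <;> simp
  have hcinv : diag (c⁻¹).1 = (diag c.1)⁻¹ := by
    rw [eq_inv_iff_mul_eq_one, ← diag_mul, ← Subgroup.coe_mul, inv_mul_cancel]
    exact Units.ext (diag_one (n := n) (F := F))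
  refine integral_congr_ae (Eventually.of_forall fun u => ?_)
  change _ * _ * _ = _ * _ * _
  congr 1
  by_cases hu : ∃ (x : unipotent n F) (a' : Torus n F),
      f (x.1 * (longRep n F * diag a' * u.1)) ≠ 0
  · set y : GL (Fin n) F := (u⁻¹).1 * diag c.1 * u.1 with hy
    have hyinv : (u⁻¹).1 * diag (c⁻¹).1 * u.1 = y⁻¹ := by
      rw [hy, hcinv, Subgroup.coe_inv]
      group
    have hyV : y ∈ V := hsub y (hclose u hu c hc) (by
      rw [← hyinv]
      exact hclose u hu c⁻¹ (inv_mem hc))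
    congr 1
    · have e : longRep n F * diag (a * c.1) * u.1 = longRep n F * diag a * u.1 * y := by
        rw [hy, diag_mul, Subgroup.coe_inv]
        group
      refine integral_congr_ae (Eventually.of_forall fun x => ?_)
      change f _ * _ = f _ * _
      have := hfV 1 (mem_of_mem_nhds hV) y hyV (x.1 * (longRep n F * diag a * u.1))
      rw [one_mul] at this
      rw [e, ← mul_assoc x.1, this]
    · have e : (central ((a * c.1) 0))⁻¹ * (a * c.1) = (central (a 0))⁻¹ * a * c.1 := by
        rw [Pi.mul_apply, c.2.2, mul_one, mul_assoc]
      have e2 : u.1.1ᵀ * (diag ((central (a 0))⁻¹ * a * c.1)).1 * u.1.1 =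
          u.1.1ᵀ * (diag ((central (a 0))⁻¹ * a)).1 * u.1.1 * y.1 := by
        have h1 : diag ((central (a 0))⁻¹ * a * c.1) * u.1 =
            diag ((central (a 0))⁻¹ * a) * u.1 * y := by
          rw [hy, diag_mul, Subgroup.coe_inv]
          group
        rw [Matrix.mul_assoc, ← Units.val_mul, h1, Units.val_mul, Units.val_mul]
        simp only [Matrix.mul_assoc]
      rw [e, e2]
      refine cutoff_mul N (y' := (y⁻¹).1) ?_ (hint u hu c hc) ?_ ?_ ?_ _
      · rw [← Units.val_mul, mul_inv_cancel, Units.val_one]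
      · rw [← hyinv]
        exact hint u hu c⁻¹ (inv_mem hc)
      · exact fun i j => conj_diag_lower u c.1
      · rw [← hyinv]
        exact fun i j => conj_diag_lower u (c⁻¹).1
  · push Not at hu
    rw [whittaker_eq_zero μ ψ fun x => hu x _, whittaker_eq_zero μ ψ fun x => hu x _, zero_mul,
      zero_mul]

/-- If `f` vanishes where the `k`-th lower left minor does, its partial Bessel integrals at `b c'`
vanish unless `c'` lies in a fixed compact set: the coordinates of `c'` are determined, up to finite
ambiguity, by the ratio of powers of this minor and of the determinant that is invariant under the
center. -/
theorem exists_bound_of_partialBessel_ne_zero [NeZero n] {k : ℕ} (hk : 1 ≤ k) (hkn : k < n)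
    (hf : IsSmoothCompactModCenter ω Set.univ f) (hfk : ∀ g, f g ≠ 0 → lowerMinor k g.1 ≠ 0) :
    ∃ γ : ValueGroupWithZero F, ∀ [MeasurableSpace (unipotent n F)] (μ : Measure (unipotent n F))
      (ψ : AddChar F Circle) (N : ℕ), ∀ b ∈ transverseTorus F Fin.revPerm (levelPerm k),
        ∀ c : reducedTorus F (levelPerm (n := n) k),
          partialBessel μ ψ (cutoff N) f (b * c.1) ≠ 0 →
            ∀ j, valuation F (c.1 j : F) ≤ γ ∧ valuation F (((c.1 j)⁻¹ : Fˣ) : F) ≤ γ := by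
  obtain ⟨K, hK, hKf, hs⟩ := hf.exists_compact_support
  have hL := lowerMinor_longMatrix_ne_zero (F := F) (n := n) k
  have hδ := det_ne_zero_GL (longRep n F)
  set L := lowerMinor k (longMatrix n F) with hLdef
  set δ := (longRep n F).1.det with hδdef
  let φ : GL (Fin n) F → F := fun κ => δ⁻¹ ^ k * ((L * (lowerMinor k κ.1)⁻¹) ^ n * κ.1.det ^ k)
  have hdet : Continuous fun κ : GL (Fin n) F => κ.1.det := Units.continuous_val.matrix_det
  have hφ : ContinuousOn φ K :=
    continuousOn_const.mul (((continuousOn_const.mul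
      ((continuous_lowerMinor k).continuousOn.inv₀ fun g hg => hfk g (hKf g hg))).pow n).mul
        (hdet.pow k).continuousOn)
  have hφ0 : ∀ κ ∈ K, φ κ ≠ 0 := fun κ hκ =>
    mul_ne_zero (pow_ne_zero _ (inv_ne_zero hδ)) (mul_ne_zero (pow_ne_zero _
      (mul_ne_zero hL (inv_ne_zero (hfk κ (hKf κ hκ))))) (pow_ne_zero _ (det_ne_zero_GL κ)))
  obtain ⟨γ₁, -, hγ₁⟩ := exists_valuation_le_of_continuousOn hK hφ
  obtain ⟨γ₂, -, hγ₂⟩ := exists_valuation_le_of_continuousOn hK (hφ.inv₀ hφ0)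
  refine ⟨max 1 (max γ₁ γ₂), ?_⟩
  intro _ μ ψ N b hb c hB
  obtain ⟨u, hu⟩ : ∃ u : unipotent n F,
      whittaker μ ψ f (longRep n F * diag (b * c.1) * u.1) ≠ 0 := by
    by_contra! h
    refine hB ?_
    simp only [partialBessel, h, zero_mul, integral_zero]
  obtain ⟨x, hx⟩ : ∃ x : unipotent n F, f (x * (longRep n F * diag (b * c.1) * u)) ≠ 0 := by
    by_contra! h
    exact hu (whittaker_eq_zero μ ψ h)
  obtain ⟨z, κ, hκ, e⟩ := hs _ hx
  have hc := reducedTorus_levelPerm_apply hk c.2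
  set β := (c.1 (Fin.rev 0) : F) with hβ
  obtain ⟨hb1, hb2⟩ := prod_eq_one_of_mem_derivedLevi hk hkn hb.2
  have hcard : (Finset.univ.filter fun j : Fin n => ¬ (j : ℕ) < k).card = n - k := by
    have h1 := Finset.card_filter_add_card_filter_not (s := (Finset.univ : Finset (Fin n)))
      fun j : Fin n => (j : ℕ) < k
    have h2 : (Finset.univ.filter fun j : Fin n => (j : ℕ) < k).card = k := by
      rw [Fin.card_filter_val_lt]
      omega
    rw [h2, Finset.card_univ, Fintype.card_fin] at h1
    omega
  -- the minor and the determinant of `x ẇ_ℓ b c u`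
  have hminor : (z : F) ^ k * lowerMinor k κ.1 = L := by
    rw [← lowerMinor_scalar_mul hkn.le, ← e, Units.val_mul, lowerMinor_unipotent_mul, Units.val_mul,
      lowerMinor_mul_unipotent, Units.val_mul]
    refine (lowerMinor_mul_diagonal k _ _).trans ?_
    rw [← Finset.prod_filter]
    have h1 : ∀ j ∈ Finset.univ.filter fun j : Fin n => (j : ℕ) < k,
        (((b * c.1) j : Fˣ) : F) = b j := by
      intro j hj
      rw [Pi.mul_apply, Units.val_mul, hc, if_pos (Finset.mem_filter.mp hj).2, mul_one]
    rw [Finset.prod_congr rfl h1, hb1, mul_one]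
    rfl
  have hdet' : (z : F) ^ n * κ.1.det = δ * β ^ (n - k) := by
    have h1 : (GeneralLinearGroup.scalar (Fin n) z * κ).1 = (z : F) • κ.1 := by
      ext i j
      rw [scalar_mul_apply]
      rfl
    have h3 := Matrix.det_smul κ.1 (z : F)
    rw [Fintype.card_fin] at h3
    rw [← h3, ← h1, ← e, Units.val_mul,
      Units.val_mul, Units.val_mul, Matrix.det_mul, Matrix.det_mul, Matrix.det_mul, det_unipotent,
      det_unipotent, one_mul, mul_one]
    congr 1
    change (Matrix.diagonal fun j => (((b * c.1) j : Fˣ) : F)).det = _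
    rw [Matrix.det_diagonal, ← Finset.prod_filter_mul_prod_filter_not Finset.univ
      fun j : Fin n => (j : ℕ) < k]
    have h2 : ∀ j, (((b * c.1) j : Fˣ) : F) = b j * if (j : ℕ) < k then 1 else β := by
      intro j
      rw [Pi.mul_apply, Units.val_mul, hc]
    simp only [h2]
    rw [Finset.prod_mul_distrib, Finset.prod_mul_distrib, hb1, hb2, one_mul, one_mul,
      Finset.prod_ite_of_true (fun j hj => (Finset.mem_filter.mp hj).2),
      Finset.prod_ite_of_false (fun j hj => (Finset.mem_filter.mp hj).2), Finset.prod_const_one,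
      one_mul, Finset.prod_const, hcard]
  have hβφ : β ^ ((n - k) * k) = φ κ := by
    have hm0 := hfk κ (hKf κ hκ)
    have h1 : (z : F) ^ k = L * (lowerMinor k κ.1)⁻¹ := by
      rw [← hminor, mul_inv_cancel_right₀ hm0]
    have h2 : β ^ (n - k) = δ⁻¹ * ((z : F) ^ n * κ.1.det) := by
      rw [hdet', inv_mul_cancel_left₀ hδ]
    rw [pow_mul, h2, mul_pow, mul_pow, ← pow_mul, mul_comm n k, pow_mul, h1]
  have hm : (n - k) * k ≠ 0 := Nat.mul_ne_zero (by omega) (by omega)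
  have hβ1 : valuation F β ≤ max 1 (max γ₁ γ₂) := by
    refine le_max_one_of_pow_le hm ?_
    rw [← map_pow, hβφ]
    exact (hγ₁ κ hκ).trans (le_max_left _ _)
  have hβ2 : valuation F β⁻¹ ≤ max 1 (max γ₁ γ₂) := by
    refine le_max_one_of_pow_le hm ?_
    rw [← map_pow, inv_pow, hβφ]
    exact (hγ₂ κ hκ).trans (le_max_right _ _)
  intro j
  rw [Units.val_inv_eq_inv_val, hc j]
  split_ifs
  · simp
  · exact ⟨hβ1, hβ2⟩

theorem uniformlySmooth_partialBessel [NeZero n] [MeasurableSpace (unipotent n F)]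
    (μ : Measure (unipotent n F)) (ψ : AddChar F Circle) {k : ℕ} (hk : 1 ≤ k) (hkn : k < n)
    (hf : IsSmoothCompactModCenter ω Set.univ f) (hfk : ∀ g, f g ≠ 0 → lowerMinor k g.1 ≠ 0)
    (s : Set ℕ) :
    UniformlySmooth (levelPerm k) s fun N a => partialBessel μ ψ (cutoff N) f a := by
  obtain ⟨ρ, hρ, hρ0, hinv⟩ := exists_partialBessel_mul_congruenceTorus hk hf hfk
  obtain ⟨γ, hγ⟩ := exists_bound_of_partialBessel_ne_zero hk hkn hf hfk
  exact ⟨congruenceTorus _ ρ hρ, _, isOpen_congruenceTorus _ hρ hρ0,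
    isCompact_congruenceTorus _ hρ hρ0, isCompact_setOf_reducedTorus_le _ γ,
    fun N _ => ⟨hinv μ ψ N, fun b hb c h => hγ μ ψ N b hb c h⟩⟩

theorem uniformlySmooth_zero [NeZero n] {ι : Type*} (w : Equiv.Perm (Fin n)) (s : Set ι) :
    UniformlySmooth (F := F) w s fun _ _ => 0 :=
  ⟨congruenceTorus w 1 le_rfl, ∅, isOpen_congruenceTorus w le_rfl one_ne_zero,
    isCompact_congruenceTorus w le_rfl one_ne_zero, isCompact_empty,
    fun _ _ => ⟨fun _ _ _ => rfl, fun _ _ _ h => absurd rfl h⟩⟩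

end Smoothness

/-! ### Matrix coefficients and the expansion -/

section MatrixCoefficients

variable {n : ℕ} {F : Type*} [Field F] [TopologicalSpace F] [IsTopologicalRing F]
  {V : Type*} [AddCommGroup V] [Module ℂ V] {π : Representation ℂ (GL (Fin n) F) V}
  {ω : Fˣ →ₜ* ℂˣ}

theorem IsSupercuspidal.isSmoothCompactModCenter (hπ : IsSupercuspidal π)
    (hω : HasCentralCharacter π ω) {f : GL (Fin n) F → ℂ} (hf : f ∈ matrixCoefficients π) :
    IsSmoothCompactModCenter ω Set.univ f := by
  induction hf using Submodule.span_induction with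
  | mem f hf =>
    obtain ⟨v, l, hl, rfl⟩ := hf
    refine ⟨(IsLocallyConstant.iff_eventually_eq _).mpr fun g => ?_, fun z g => ?_, ?_⟩
    · have h1 : {h : GL (Fin n) F | π h v = v} ∈ 𝓝 (g⁻¹ * g) := by
        rw [inv_mul_cancel]
        exact (hπ.smooth v).mem_nhds (by simp)
      filter_upwards [(continuous_const_mul g⁻¹).continuousAt h1] with y hy
      have hy : π (g⁻¹ * y) v = v := hy
      rw [← mul_inv_cancel_left g y, map_mul, Module.End.mul_apply, hy]
    · rw [map_mul, Module.End.mul_apply, hω, map_smul, smul_eq_mul]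
    · obtain ⟨K, hK, h⟩ := hπ.cuspidal v l hl
      exact ⟨K, hK, Set.subset_univ _, h⟩
  | zero => exact IsSmoothCompactModCenter.zero
  | add f g _ _ hf hg => exact hf.add hg
  | smul c f _ hf => exact hf.smul c

end MatrixCoefficients

section Difference

variable {n : ℕ} [NeZero n] {F : Type*} [Field F] [ValuativeRel F] [TopologicalSpace F]
  [IsNonarchimedeanLocalField F] [MeasurableSpace (unipotent n F)] [BorelSpace (unipotent n F)]
  (μ : Measure (unipotent n F)) [μ.IsHaarMeasure] {ψ : AddChar F Circle} {ω : Fˣ →ₜ* ℂˣ}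

open Classical in
/-- The expansion of the partial Bessel integrals of a function whose Whittaker function
vanishes at `1`, with one term for each of the tori attached to the permutations `levelPerm k`. -/
theorem exists_expansion (hψ : Continuous ψ) (hψ' : ψ ≠ 1) {f : GL (Fin n) F → ℂ}
    (hf : IsSmoothCompactModCenter ω Set.univ f) (hW : whittaker μ ψ f 1 = 0) :
    ∃ f₁ : Equiv.Perm (Fin n) → GL (Fin n) F → ℂ,
      (∀ w, IsSmoothCompactModCenter ω (bruhatOpen F w) (f₁ w)) ∧
      (∀ w s, UniformlySmooth w s fun N a => partialBessel μ ψ (cutoff N) (f₁ w) a) ∧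
      ∃ m, ∀ N ≥ m, ∀ a, partialBessel μ ψ (cutoff N) f a =
        ∑ w : Equiv.Perm (Fin n) with SupportsBessel w ∧ 1 ≤ besselDist F w 1,
          partialBessel μ ψ (cutoff N) (f₁ w) a := by
  obtain ⟨f', hf', hsupp, m, hm⟩ := exists_vanish_of_lowerMinor_eq_zero μ hψ hψ' hf hW
  obtain ⟨h, hh, hhk, hsum⟩ := exists_split_lowerMinor hf' hsupp
  have hinj : Set.InjOn (levelPerm (n := n)) (Finset.Ico 1 n) := fun k hk l hl e => by
    rw [Finset.coe_Ico] at hk hl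
    exact levelPerm_injOn ⟨hk.1, hk.2.le⟩ ⟨hl.1, hl.2.le⟩ e
  let f₁ : Equiv.Perm (Fin n) → GL (Fin n) F → ℂ := fun w =>
    if hw : ∃ k ∈ Finset.Ico 1 n, levelPerm k = w then h hw.choose else 0
  have hf₁ : ∀ k ∈ Finset.Ico 1 n, f₁ (levelPerm k) = h k := by
    intro k hk
    have hw : ∃ l ∈ Finset.Ico 1 n, levelPerm l = (levelPerm k : Equiv.Perm (Fin n)) :=
      ⟨k, hk, rfl⟩
    simp only [f₁, dif_pos hw]
    rw [hinj hw.choose_spec.1 hk hw.choose_spec.2]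
  have hf₁0 : ∀ w, (¬ ∃ k ∈ Finset.Ico 1 n, levelPerm k = w) → f₁ w = 0 := fun w hw => dif_neg hw
  have hB0 : ∀ N a, partialBessel μ ψ (cutoff N) (0 : GL (Fin n) F → ℂ) a = 0 := fun N a => by
    simp [partialBessel, whittaker]
  refine ⟨f₁, fun w => ?_, fun w s => ?_, m, fun N hN a => ?_⟩
  · by_cases hw : ∃ k ∈ Finset.Ico 1 n, levelPerm k = w
    · obtain ⟨k, hk, rfl⟩ := hw
      rw [hf₁ k hk]
      exact (hh k (Finset.mem_Ico.mp hk).2).bruhatOpen_levelPerm (hhk k)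
    · rw [hf₁0 w hw]
      exact IsSmoothCompactModCenter.zero
  · by_cases hw : ∃ k ∈ Finset.Ico 1 n, levelPerm k = w
    · obtain ⟨k, hk, rfl⟩ := hw
      simp only [hf₁ k hk]
      have hk' := Finset.mem_Ico.mp hk
      exact uniformlySmooth_partialBessel μ ψ hk'.1 hk'.2 (hh k hk'.2) (hhk k) s
    · simp only [hf₁0 w hw, hB0]
      exact uniformlySmooth_zero w s
  · have h1 := partialBessel_smul_sum μ hψ (Finset.Ico 1 n) (fun _ => 1)
      (fun k hk => hh k (Finset.mem_Ico.mp hk).2) N a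
    simp only [one_smul, one_mul] at h1
    rw [← hm N hN a, hsum, h1]
    calc ∑ k ∈ Finset.Ico 1 n, partialBessel μ ψ (cutoff N) (h k) a
        = ∑ k ∈ Finset.Ico 1 n, partialBessel μ ψ (cutoff N) (f₁ (levelPerm k)) a :=
          Finset.sum_congr rfl fun k hk => by rw [hf₁ k hk]
      _ = ∑ w ∈ (Finset.Ico 1 n).image levelPerm, partialBessel μ ψ (cutoff N) (f₁ w) a :=
          by rw [Finset.sum_image hinj]
      _ = _ := by
        refine Finset.sum_subset (fun w hw => ?_) fun w _ hw => ?_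
        · obtain ⟨k, hk, rfl⟩ := Finset.mem_image.mp hw
          have hk' := Finset.mem_Ico.mp hk
          exact Finset.mem_filter.mpr ⟨Finset.mem_univ _, supportsBessel_levelPerm k,
            one_le_besselDist (levelPerm_ne_one hk'.1 hk'.2) (supportsBessel_levelPerm k)⟩
        · rw [hf₁0 w fun ⟨k, hk, e⟩ => hw (Finset.mem_image.mpr ⟨k, hk, e⟩), hB0]

end Difference

end PartialBessel

open Classical in
theorem mainTheorem8 {n : ℕ} [NeZero n] {F : Type*} [Field F] [CharZero F] [ValuativeRel F]
    [TopologicalSpace F] [IsNonarchimedeanLocalField F]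
    [MeasurableSpace (unipotent n F)] [BorelSpace (unipotent n F)]
    (μ : Measure (unipotent n F)) [μ.IsHaarMeasure]
    (ψ : AddChar F Circle) (hψ : Continuous ψ) (hψ' : ψ ≠ 1)
    (ω : Fˣ →ₜ* ℂˣ)
    (f₀ : GL (Fin n) F → ℂ) (hf₀ : IsSmoothCompactModCenter ω Set.univ f₀)
    (hf₀' : whittaker μ ψ f₀ 1 = 1) :
    ∃ f₁e : GL (Fin n) F → ℂ, IsSmoothCompactModCenter ω Set.univ f₁e ∧
      ∀ (V : Type*) [AddCommGroup V] [Module ℂ V] (π : Representation ℂ (GL (Fin n) F) V),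
        IsSupercuspidal π → HasCentralCharacter π ω →
        ∀ f ∈ matrixCoefficients π, whittaker μ ψ f 1 = 1 →
        ∃ f₁ : Equiv.Perm (Fin n) → GL (Fin n) F → ℂ,
          (∀ w', SupportsBessel w' → 1 ≤ besselDist F w' 1 →
            IsSmoothCompactModCenter ω (bruhatOpen F w') (f₁ w')) ∧
          ∃ N₀ : ℕ,
            (∀ N ≥ N₀, ∀ a : Torus n F,
              partialBessel μ ψ (cutoff N) f a = partialBessel μ ψ (cutoff N) f₁e a +
                ∑ w' : Equiv.Perm (Fin n) with SupportsBessel w' ∧ 1 ≤ besselDist F w' 1,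
                  partialBessel μ ψ (cutoff N) (f₁ w') a) ∧
            ∀ w', SupportsBessel w' → 1 ≤ besselDist F w' 1 →
              (∀ N ≥ N₀, ∀ b ∈ transverseTorus F Fin.revPerm w', ∀ c' ∈ reducedTorus F w',
                ∀ z : Fˣ, partialBessel μ ψ (cutoff N) (f₁ w') (b * (c' * central z)) =
                  ω z * partialBessel μ ψ (cutoff N) (f₁ w') (b * c')) ∧
              UniformlySmooth w' {N : ℕ | N₀ ≤ N}
                (fun N a => partialBessel μ ψ (cutoff N) (f₁ w') a) := by
  refine ⟨f₀, hf₀, ?_⟩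
  intro V _ _ π hπ hω f hf hfW
  have hfS := hπ.isSmoothCompactModCenter hω hf
  let c : Bool → ℂ := fun i => if i then 1 else -1
  let p : Bool → GL (Fin n) F → ℂ := fun i => if i then f else f₀
  have hp : ∀ i ∈ Finset.univ, IsSmoothCompactModCenter ω Set.univ (p i) := by
    rintro (_ | _) _
    · exact hf₀
    · exact hfS
  have hW := whittaker_smul_sum μ hψ Finset.univ c hp 1
  have hB := partialBessel_smul_sum μ hψ Finset.univ c hp
  have hd : ∑ i, c i • p i = f - f₀ := by
    simp [c, p, sub_eq_add_neg]
  rw [hd] at hW hB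
  obtain ⟨f₁, h1, h2, m, hm⟩ := exists_expansion μ hψ hψ'
    (hd ▸ IsSmoothCompactModCenter.finset_sum fun i hi => (hp i hi).smul (c i)) (f := f - f₀) (by
      rw [hW]
      simp [c, p, hfW, hf₀'])
  refine ⟨f₁, fun w _ _ => h1 w, m, fun N hN a => ?_, fun w _ _ => ⟨?_, h2 w _⟩⟩
  · rw [← hm N hN a, hB N a]
    simp [c, p]
  · intro N _ b _ c' _ z
    rw [← mul_assoc]
    exact partialBessel_mul_central μ ψ (h1 w) _ _ z
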